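/- **Theorem 1.2 (categorification of the comultiplication on $U_T$).** *The superalgebra $U_T$.* Let $U_T$ be the unital associative $\mathbb Z$-algebra with generators $E,F,T,T^{-1}$ and relations $E^2=F^2=0$, $EF+FE=1-T$, $ET=TE$, $FT=TF$, $TT^{-1}=T^{-1}T=1$, with the parity ($\mathbb Z$-grading) $p(E)=-1$, $p(F)=1$, $p(T)=0$. The product on $U_T\otimes_{\mathbb Z}U_T$ is $(a\otimes b)(c\otimes d)=(-1)^{p(b)p(c)}ac\otimes bd$, and $\Delta:U_T\to U_T\otimes U_T$ is the algebra homomorphism with $\Delta(E)=E\otimes 1+1\otimes E$, $\Delta(F)=F\otimes T+1\otimes F$, $\Delta(T)=T\otimes T$. Put $\mathcal B=\{I,E,F,EF\}\subset U_T$, where $I=1$. *The algebra $A$.* $A$ is the $\mathbb F_2$-algebra, with zero differential, generated by idempotents $e(\gamma)$, $\gamma\in\mathcal B$ (orthogonal, with sum $1$) and $\rho(I,EF),\rho(EF,I)$, where a generator $\rho(x,y)$ satisfies $e(x)\rho(x,y)=\rho(x,y)e(y)=\rho(x,y)$, with the relation $\rho(I,EF)\rho(EF,I)=0$. Its grading $(\deg_h,\deg_t)\in\mathbb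 Z^2$ is $(1,1)$ on $\rho(EF,I)$ and $(0,0)$ on the other generators. *The algebra $B$.* $B$ is the $\mathbb F_2$-algebra, with zero differential, generated by idempotents $e(x)$ for $x=\gamma_1\otimes\gamma_2\in\mathcal B\times\mathcal B$ (orthogonal, with sum $1$) and, writing $\rho(x,y)$ for a generator with $e(x)\rho(x,y)=\rho(x,y)e(y)=\rho(x,y)$, by $u_\gamma=\rho(I\otimes\gamma,EF\otimes\gamma)$, $d_\gamma=\rho(EF\otimes\gamma,I\otimes\gamma)$, $u'_\gamma=\rho(\gamma\otimes I,\gamma\otimes EF)$, $d'_\gamma=\rho(\gamma\otimes EF,\gamma\otimes I)$ for $\gamma\in\mathcal B$, and $r_1=\rho(E\otimes I,I\otimes E)$, $r_2=\rho(E\otimes F,I\otimes EF)$, $r_3=\rho(EF\otimes I,F\otimes E)$, $r_4=\rho(I\otimes F,F\otimes I)$, subject to $$u_\gamma d_\gamma=0,\quad u'_\gamma d'_\gamma=0\ (\gamma\in\mathcal B),\quad d'_Er_1=0,\ r_1u_E=0,\ r_2u_{EF}=0,\ d'_{EF}r_3=0,\ d_Fr_4=0,\ r_4u'_F=0,$$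 $$u'_Iu_{EF}=u_Iu'_{EF},\quad d'_Iu_I=u_{EF}d'_{EF},\quad d_Iu'_I=u'_{EF}d_{EF},\quad d_{EF}d'_I=d'_{EF}d_I.$$ Its grading $(\deg_h;\deg_{t_1},\deg_{t_2})\in\mathbb Z^3$ is $(1;0,0)$ on $r_1,r_2$; $(1;1,0)$ on $d_\gamma$; $(1;0,1)$ on $r_4$ and $d'_\gamma$; and $(0;0,0)$ on the other generators. *The categories.* A DG module is a left module graded by $\deg_h$ and the internal degree ($\mathbb Z$ for $A$, $\mathbb Z^2$ for $B$), with a linear differential of degree $1$ in $\deg_h$ and $0$ in the internal degree. $M[n]\{l\}$ denotes the shift whose degree $i$ part is the degree $i+(n,l)$ part of $M$. Put $P(\gamma)=Ae(\gamma)$ and $P(\gamma_1\otimes\gamma_2)=Be(\gamma_1\otimes\gamma_2)$. Let $DGP(A)$ (resp. $DGP(B)$) be the smallest full subcategory of the DG category of DG $A$-modules (resp. $B$-modules) which contains all $P(\gamma)$ (resp. all $P(\gamma_1\otimes\gamma_2)$) and is closed under isomorphisms, all grading shifts and mapping cones; let $HP(A)$, $HP(B)$ be their $0$th homology categories (morphisms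 are closed morphisms of degree $0$ in all gradings, modulo homotopy). *The bimodule $S$.* Let $S=\bigoplus_{\gamma\in\mathcal B}S(\gamma)$ with $S(I)=P(I\otimes I)$, $S(E)=P(E\otimes I)\oplus P(I\otimes E)$, $S(F)=P(I\otimes F)\oplus P(F\otimes I)\{0,1\}$, $S(EF)=P(E\otimes F)\oplus P(I\otimes EF)\oplus P(EF\otimes I)\{0,1\}\oplus P(F\otimes E)\{0,1\}[-1]$, as left $B$-modules. Write $m(x)$ for the generator of the summand $P(x)$. The $B$-linear differential is $m(E\otimes I)\mapsto r_1m(I\otimes E)$ on $S(E)$; $m(I\otimes F)\mapsto r_4m(F\otimes I)$ on $S(F)$; $m(E\otimes F)\mapsto r_2m(I\otimes EF)$, $m(I\otimes EF)\mapsto u_{EF}d'_{EF}m(EF\otimes I)$, $m(EF\otimes I)\mapsto r_3m(F\otimes E)$ on $S(EF)$; and zero on the other generators. The right action of $A$ is $B$-linear: $e(\gamma)$ acts as the projection onto $S(\gamma)$; $\rho(I,EF)$ sends $m(I\otimes I)$ to $u'_Im(I\otimes EF)$ and the other generators to $0$; $\rho(EF,I)$ sends $m(EF\otimes I)\in S(EF)$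 to $d_Im(I\otimes I)$ and the other generators to $0$. The right action of $a\in A$ of degree $(h,t)$ has degree $(h;t,t)$. This makes $S$ a DG $(B,A)$-bimodule. *Statement.* $HP(A)$ and $HP(B)$ are triangulated categories, the distinguished triangles being those isomorphic to mapping cone triangles. The functor $S\otimes_A-$ takes $DGP(A)$ to $DGP(B)$ and induces an exact functor $\delta:HP(A)\to HP(B)$. There are isomorphisms of abelian groups $$K_0(HP(A))\cong U_T,\qquad K_0(HP(B))\cong U_T\otimes_{\mathbb Z}U_T$$ which take $[P(\gamma)]$ to $\gamma$ and $[P(\gamma_1\otimes\gamma_2)]$ to $\gamma_1\otimes\gamma_2$, under which $[M\{l\}]=T^l[M]$ for all $M$ in $HP(A)$, $l\in\mathbb Z$, and $[M\{l_1,l_2\}]=(T^{l_1}\otimes T^{l_2})[M]$ for all $M$ in $HP(B)$, $l_1,l_2\in\mathbb Z$, and under which $K_0(\delta):K_0(HP(A))\to K_0(HP(B))$ is the comultiplication $\Delta:U_T\to U_T\otimes U_T$. -/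

import Mathlib

open CategoryTheory CategoryTheory.Pretriangulated
open scoped DirectSum TensorProduct

noncomputable section

namespace UTCat

/-! ### Algebras given by weighted generators and homogeneous relations -/

section Presentation

variable (k : Type) [CommRing k] {X : Type} {ι : Type} [AddCommMonoid ι]

/-- The span, in the free algebra, of the words of total weight `i`. -/
def freeDeg (w : X → ι) (i : ι) : Submodule k (FreeAlgebra k X) :=
  Submodule.span k {x | ∃ l : List X, (l.map w).sum = i ∧ (l.map (FreeAlgebra.ι k)).prod = x}

variable {k}

lemma freeDeg_one (w : X → ι) : (1 : FreeAlgebra k X) ∈ freeDeg k w 0 :=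
  Submodule.subset_span ⟨[], by simp, by simp⟩

lemma freeDeg_gen (w : X → ι) (x : X) : FreeAlgebra.ι k x ∈ freeDeg k w (w x) :=
  Submodule.subset_span ⟨[x], by simp, by simp⟩

lemma freeDeg_mul (w : X → ι) {i j : ι} {a b : FreeAlgebra k X}
    (ha : a ∈ freeDeg k w i) (hb : b ∈ freeDeg k w j) : a * b ∈ freeDeg k w (i + j) := by
  have := Submodule.mul_mem_mul ha hb
  rw [freeDeg, freeDeg, Submodule.span_mul_span] at this
  refine Submodule.span_mono ?_ this
  rintro _ ⟨_, ⟨l, rfl, rfl⟩, _, ⟨l', rfl, rfl⟩, rfl⟩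
  exact ⟨l ++ l', by simp, by simp⟩

/-- The relations are homogeneous for the weight `w` of the generators. -/
def Homogeneous (w : X → ι) (r : FreeAlgebra k X → FreeAlgebra k X → Prop) : Prop :=
  ∀ a b, r a b → ∃ i, a ∈ freeDeg k w i ∧ b ∈ freeDeg k w i

/-- The degree `i` part of the algebra presented by generators of weight `w` and relations `r`. -/
def presDeg (w : X → ι) (r : FreeAlgebra k X → FreeAlgebra k X → Prop) (i : ι) :
    Submodule k (RingQuot r) :=
  (freeDeg k w i).map (RingQuot.mkAlgHom k r).toLinearMap

/-- The class of a generator in a presented algebra. -/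
def gen (r : FreeAlgebra k X → FreeAlgebra k X → Prop) (x : X) : RingQuot r :=
  RingQuot.mkAlgHom k r (FreeAlgebra.ι k x)

variable (w : X → ι) (r : FreeAlgebra k X → FreeAlgebra k X → Prop)

lemma gen_mem (x : X) : gen r x ∈ presDeg w r (w x) :=
  Submodule.mem_map_of_mem (freeDeg_gen w x)

lemma gen_mem' {x : X} {i : ι} (h : w x = i) : gen r x ∈ presDeg w r i := h ▸ gen_mem w r x

lemma presDeg_gradedMonoid : SetLike.GradedMonoid (presDeg w r) where
  one_mem := ⟨1, freeDeg_one w, by simp⟩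
  mul_mem := by
    rintro i j _ _ ⟨a, ha, rfl⟩ ⟨b, hb, rfl⟩
    exact ⟨a * b, freeDeg_mul w ha hb, by simp⟩

variable [DecidableEq ι]

/-- An algebra presented by homogeneous relations is graded by the weight. -/
@[reducible] def presGraded (hr : Homogeneous w r) : GradedAlgebra (presDeg w r) :=
  letI : SetLike.GradedMonoid (presDeg w r) := presDeg_gradedMonoid w r
  let f : FreeAlgebra k X →ₐ[k] ⨁ i, presDeg w r i :=
    FreeAlgebra.lift k fun x => DirectSum.of (fun i => presDeg w r i) (w x) ⟨gen r x, gen_mem w r x⟩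
  have hf : ∀ (i : ι) (a : FreeAlgebra k X) (ha : a ∈ freeDeg k w i),
      f a = DirectSum.of (fun i => presDeg w r i) i
        ⟨RingQuot.mkAlgHom k r a, Submodule.mem_map_of_mem ha⟩ := by
    intro i a ha
    induction ha using Submodule.span_induction with
    | mem x hx =>
      obtain ⟨l, rfl, rfl⟩ := hx
      induction l with
      | nil =>
        simp only [List.map_nil, List.prod_nil, map_one]
        rfl
      | cons x l ih =>
        simp only [List.map_cons, List.prod_cons, map_mul, ih]
        rw [FreeAlgebra.lift_ι_apply, DirectSum.of_mul_of]
        rfl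
    | zero =>
      have h0 : (⟨RingQuot.mkAlgHom k r 0, Submodule.mem_map_of_mem (Submodule.zero_mem _)⟩ :
        presDeg w r i) = 0 := Subtype.ext (map_zero _)
      rw [map_zero, h0, map_zero]
    | add x y hx hy ihx ihy => rw [map_add, ihx, ihy, ← map_add]; congr 1; exact Subtype.ext (by simp)
    | smul c x hx ih =>
      rw [map_smul, ih, ← DirectSum.lof_eq_of k, ← map_smul]
      refine congrArg _ (Subtype.ext ?_)
      exact (map_smul (RingQuot.mkAlgHom k r) c x).symm
  let F : RingQuot r →ₐ[k] ⨁ i, presDeg w r i :=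
    RingQuot.liftAlgHom k ⟨f, by
      intro a b hab
      obtain ⟨i, ha, hb⟩ := hr a b hab
      rw [hf i a ha, hf i b hb]
      congr 2
      exact RingQuot.mkAlgHom_rel k hab⟩
  GradedAlgebra.ofAlgHom _ F
    (by
      apply RingQuot.ringQuot_ext'
      apply FreeAlgebra.hom_ext
      funext x
      simp [F, f, gen])
    (by
      rintro i ⟨_, a, ha, rfl⟩
      simp only [F, AlgHom.toLinearMap_apply, RingQuot.liftAlgHom_mkAlgHom_apply]
      exact hf i a ha)

end Presentation

/-! ### The Hopf superalgebra `U_T` and its comultiplication -/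

/-- The generators `E`, `F`, `T`, `T⁻¹`. -/
inductive UGen
  | E | F | T | Tinv
  deriving DecidableEq

namespace UGen

/-- A generator, as an element of the free ring. -/
abbrev v (x : UGen) : FreeAlgebra ℤ UGen := FreeAlgebra.ι ℤ x

/-- The parity of the generators: `p(E) = -1`, `p(F) = 1`, `p(T) = 0`. -/
def parity : UGen → ℤ
  | E => -1
  | F => 1
  | T => 0
  | Tinv => 0

end UGen

open UGen in
/-- The defining relations of `U_T`. -/
inductive URel : FreeAlgebra ℤ UGen → FreeAlgebra ℤ UGen → Prop
  | E_sq : URel (v E * v E) 0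
  | F_sq : URel (v F * v F) 0
  | EF_add_FE : URel (v E * v F + v F * v E) (1 - v T)
  | ET : URel (v E * v T) (v T * v E)
  | FT : URel (v F * v T) (v T * v F)
  | T_mul_Tinv : URel (v T * v Tinv) 1
  | Tinv_mul_T : URel (v Tinv * v T) 1

lemma URel.homogeneous : Homogeneous UGen.parity URel := by
  have g := fun x : UGen => freeDeg_gen (k := ℤ) UGen.parity x
  have m := fun x y : UGen => freeDeg_mul (k := ℤ) UGen.parity (g x) (g y)
  rintro _ _ (_ | _ | _ | _ | _ | _ | _)
  · exact ⟨_, m _ _, Submodule.zero_mem _⟩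
  · exact ⟨_, m _ _, Submodule.zero_mem _⟩
  · exact ⟨0, Submodule.add_mem _ (m .E .F) (m .F .E),
      Submodule.sub_mem _ (freeDeg_one _) (g .T)⟩
  · exact ⟨_, m _ _, m .T .E⟩
  · exact ⟨_, m _ _, m .T .F⟩
  · exact ⟨0, m .T .Tinv, freeDeg_one _⟩
  · exact ⟨0, m .Tinv .T, freeDeg_one _⟩

/-- The ring `U_T`. -/
def UT : Type := RingQuot URel

instance : Ring UT := inferInstanceAs (Ring (RingQuot URel))

instance : Algebra ℤ UT := inferInstanceAs (Algebra ℤ (RingQuot URel))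

namespace UT

/-- The quotient map from the free ring onto `U_T`. -/
def mk : FreeAlgebra ℤ UGen →ₐ[ℤ] UT := RingQuot.mkAlgHom ℤ URel

lemma mk_rel {a b : FreeAlgebra ℤ UGen} (h : URel a b) : mk a = mk b :=
  RingQuot.mkAlgHom_rel ℤ h

/-- The generator `E` of `U_T`. -/
def E : UT := mk UGen.E.v
/-- The generator `F` of `U_T`. -/
def F : UT := mk UGen.F.v
/-- The generator `T` of `U_T`. -/
def T : UT := mk UGen.T.v
/-- The generator `T⁻¹` of `U_T`. -/
def Tinv : UT := mk UGen.Tinv.v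

/-- The parity (a `ℤ`-grading) on `U_T`. -/
def deg : ℤ → Submodule ℤ UT := presDeg UGen.parity URel

instance : GradedAlgebra deg := presGraded UGen.parity URel URel.homogeneous

lemma E_mem : E ∈ deg (-1) := gen_mem UGen.parity URel .E
lemma F_mem : F ∈ deg 1 := gen_mem UGen.parity URel .F
lemma T_mem : T ∈ deg 0 := gen_mem UGen.parity URel .T
lemma Tinv_mem : Tinv ∈ deg 0 := gen_mem UGen.parity URel .Tinv

lemma E_mul_E : E * E = 0 := by
  simpa only [map_mul, map_add, map_sub, map_one, map_zero, E, F, T, Tinv] using mk_rel URel.E_sq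
lemma F_mul_F : F * F = 0 := by
  simpa only [map_mul, map_add, map_sub, map_one, map_zero, E, F, T, Tinv] using mk_rel URel.F_sq
lemma EF_add_FE : E * F + F * E = 1 - T := by
  simpa only [map_mul, map_add, map_sub, map_one, map_zero, E, F, T, Tinv] using mk_rel URel.EF_add_FE
lemma E_mul_T : E * T = T * E := by
  simpa only [map_mul, map_add, map_sub, map_one, map_zero, E, F, T, Tinv] using mk_rel URel.ET
lemma F_mul_T : F * T = T * F := by
  simpa only [map_mul, map_add, map_sub, map_one, map_zero, E, F, T, Tinv] using mk_rel URel.FT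
lemma T_mul_Tinv : T * Tinv = 1 := by
  simpa only [map_mul, map_add, map_sub, map_one, map_zero, E, F, T, Tinv] using mk_rel URel.T_mul_Tinv
lemma Tinv_mul_T : Tinv * T = 1 := by
  simpa only [map_mul, map_add, map_sub, map_one, map_zero, E, F, T, Tinv] using mk_rel URel.Tinv_mul_T

/-- `T` as a unit of `U_T`. -/
def Tunit : UTˣ := ⟨T, Tinv, T_mul_Tinv, Tinv_mul_T⟩

end UT

/-- The graded tensor square `U_T ⊗_ℤ U_T`, with multiplication
`(a ⊗ b)(c ⊗ d) = (-1)^(p(b)p(c)) ac ⊗ bd`. -/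
def UT2 : Type := GradedTensorProduct ℤ UT.deg UT.deg

instance : Ring UT2 := GradedTensorProduct.instRing UT.deg UT.deg

instance : Algebra ℤ UT2 := GradedTensorProduct.instAlgebra UT.deg UT.deg

namespace UT2

/-- The pure tensor `a ⊗ b` in `U_T ⊗ U_T`. -/
def tm (a b : UT) : UT2 := GradedTensorProduct.tmul ℤ a b

lemma zero_tm (b : UT) : tm 0 b = 0 := TensorProduct.zero_tmul _ _

lemma tm_zero (a : UT) : tm a 0 = 0 := TensorProduct.tmul_zero _ _

lemma add_tm (a b c : UT) : tm (a + b) c = tm a c + tm b c := TensorProduct.add_tmul _ _ _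

lemma tm_add (a b c : UT) : tm a (b + c) = tm a b + tm a c := TensorProduct.tmul_add _ _ _

lemma tm_one_one : tm 1 1 = 1 := rfl

lemma tm_mul_even {i j : ℤ} (a : UT) {b c : UT} (d : UT) (hb : b ∈ UT.deg i) (hc : c ∈ UT.deg j)
    (h : (-1 : ℤˣ) ^ (i * j) = 1) : tm a b * tm c d = tm (a * c) (b * d) :=
  (GradedTensorProduct.tmul_coe_mul_coe_tmul (R := ℤ) UT.deg UT.deg a ⟨b, hb⟩ ⟨c, hc⟩ d).trans
    (by rw [h]; exact one_smul _ _)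

lemma tm_mul_odd {i j : ℤ} (a : UT) {b c : UT} (d : UT) (hb : b ∈ UT.deg i) (hc : c ∈ UT.deg j)
    (h : (-1 : ℤˣ) ^ (i * j) = -1) : tm a b * tm c d = -tm (a * c) (b * d) :=
  (GradedTensorProduct.tmul_coe_mul_coe_tmul (R := ℤ) UT.deg UT.deg a ⟨b, hb⟩ ⟨c, hc⟩ d).trans
    (by rw [h, Units.neg_smul, one_smul]; rfl)

/-- The values of the comultiplication on the generators. -/
def comulGen : UGen → UT2
  | .E => tm UT.E 1 + tm 1 UT.E
  | .F => tm UT.F UT.T + tm 1 UT.F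
  | .T => tm UT.T UT.T
  | .Tinv => tm UT.Tinv UT.Tinv

lemma comulGen_rel ⦃a b : FreeAlgebra ℤ UGen⦄ (h : URel a b) :
    FreeAlgebra.lift ℤ comulGen a = FreeAlgebra.lift ℤ comulGen b := by
  have o : (1 : UT) ∈ UT.deg 0 := SetLike.GradedOne.one_mem
  have hE := UT.E_mem
  have hF := UT.F_mem
  have hT := UT.T_mem
  have hTi := UT.Tinv_mem
  rcases h with _ | _ | _ | _ | _ | _ | _ <;>
    simp only [map_mul, map_add, map_sub, map_one, map_zero, FreeAlgebra.lift_ι_apply, comulGen,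
      add_mul, mul_add]
  · rw [tm_mul_even _ _ o hE (by simp), tm_mul_even _ _ o o (by simp),
      tm_mul_odd _ _ hE hE (by decide), tm_mul_even _ _ hE o (by simp), UT.E_mul_E]
    simp only [mul_one, one_mul, zero_tm, tm_zero]
    abel
  · rw [tm_mul_even _ _ hT hF (by simp), tm_mul_even _ _ hT o (by simp),
      tm_mul_odd _ _ hF hF (by decide), tm_mul_even _ _ hF o (by simp), UT.F_mul_F]
    simp only [mul_one, one_mul, zero_tm, tm_zero, UT.F_mul_T]
    abel
  · rw [tm_mul_even _ _ o hF (by simp), tm_mul_even _ _ o o (by simp),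
      tm_mul_odd _ _ hE hF (by decide), tm_mul_even _ _ hE o (by simp),
      tm_mul_even _ _ hT hE (by simp), tm_mul_even _ _ hT o (by simp),
      tm_mul_odd _ _ hF hE (by decide), tm_mul_even _ _ hF o (by simp)]
    simp only [mul_one, one_mul, UT.E_mul_T]
    have h1 : tm (UT.E * UT.F) UT.T + tm (UT.F * UT.E) UT.T = tm 1 UT.T - tm UT.T UT.T := by
      rw [← add_tm, UT.EF_add_FE, eq_sub_iff_add_eq, ← add_tm, sub_add_cancel]
    have h2 : tm 1 (UT.E * UT.F) + tm 1 (UT.F * UT.E) = 1 - tm 1 UT.T := by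
      rw [← tm_add, UT.EF_add_FE, eq_sub_iff_add_eq, ← tm_add, sub_add_cancel, tm_one_one]
    refine Eq.trans ?_ ((congr (congrArg HAdd.hAdd h1) h2).trans ?_) <;> abel
  · rw [tm_mul_even _ _ o hT (by simp), tm_mul_even _ _ hE hT (by simp),
      tm_mul_even _ _ hT hE (by simp), tm_mul_even _ _ hT o (by simp)]
    simp only [mul_one, one_mul, UT.E_mul_T]
  · rw [tm_mul_even _ _ hT hT (by simp), tm_mul_even _ _ hF hT (by simp),
      tm_mul_even _ _ hT hF (by simp), tm_mul_even _ _ hT o (by simp)]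
    simp only [mul_one, one_mul, UT.F_mul_T]
  · rw [tm_mul_even _ _ hT hTi (by simp), UT.T_mul_Tinv, tm_one_one]
  · rw [tm_mul_even _ _ hTi hT (by simp), UT.Tinv_mul_T, tm_one_one]

end UT2

/-- The comultiplication `Δ : U_T → U_T ⊗ U_T`, the ring homomorphism with
`Δ(E) = E ⊗ 1 + 1 ⊗ E`, `Δ(F) = F ⊗ T + 1 ⊗ F`, `Δ(T) = T ⊗ T`. -/
def comul : UT →ₐ[ℤ] UT2 :=
  RingQuot.liftAlgHom ℤ ⟨FreeAlgebra.lift ℤ UT2.comulGen, UT2.comulGen_rel⟩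

/-! ### Gradings -/

section Grading

variable {ι κ M N : Type} [DecidableEq ι] [DecidableEq κ] [AddCommGroup M] [AddCommGroup N]

lemma isInternal_mk (ℳ : ι → AddSubgroup M) (f : M →+ ⨁ i, ℳ i)
    (h1 : ∀ m, DirectSum.coeAddMonoidHom ℳ (f m) = m)
    (h2 : ∀ i (x : ℳ i), f x = DirectSum.of (fun i => ℳ i) i x) : DirectSum.IsInternal ℳ := by
  refine ⟨fun x y h => ?_, fun m => ⟨f m, h1 m⟩⟩
  have key : ∀ x, f (DirectSum.coeAddMonoidHom ℳ x) = x := fun x => by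
    induction x using DirectSum.induction_on with
    | zero => simp
    | of i x => rw [DirectSum.coeAddMonoidHom_of, h2]
    | add x y hx hy => rw [map_add, map_add, hx, hy]
  rw [← key x, h, key y]

lemma of_congr {ℳ : ι → AddSubgroup M} {i j : ι} (h : i = j) {x y : M} (hx : x ∈ ℳ i)
    (hy : y ∈ ℳ j) (hxy : x = y) :
    DirectSum.of (fun i => ℳ i) i ⟨x, hx⟩ = DirectSum.of (fun i => ℳ i) j ⟨y, hy⟩ := by
  subst h; subst hxy; rfl

variable {ℳ : ι → AddSubgroup M}

lemma internal_induction (h : DirectSum.IsInternal ℳ) {p : M → Prop} (hz : p 0) (hm : ∀ i, ∀ m ∈ ℳ i, p m)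
    (ha : ∀ x y, p x → p y → p (x + y)) (m : M) : p m := by
  obtain ⟨x, rfl⟩ := h.2 m
  induction x using DirectSum.induction_on with
  | zero => simpa using hz
  | of i x => rw [DirectSum.coeAddMonoidHom_of]; exact hm i x x.2
  | add x y hx hy => rw [map_add]; exact ha _ _ hx hy

lemma internal_bij (h : DirectSum.IsInternal ℳ) : Function.Bijective (DirectSum.coeAddMonoidHom ℳ) := h

/-- The composite of the decomposition of `M` with an additive map `M → N` which takes
degree `i` to degree `e i`. -/
def pushDec (h : DirectSum.IsInternal ℳ) (𝒩 : κ → AddSubgroup N) (e : ι → κ) (φ : M →+ N)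
    (hφ : ∀ i, ∀ m ∈ ℳ i, φ m ∈ 𝒩 (e i)) : M →+ ⨁ k, 𝒩 k :=
  (DirectSum.toAddMonoid fun i => (DirectSum.of (fun k => 𝒩 k) (e i)).comp
    ((φ.comp (ℳ i).subtype).codRestrict (𝒩 (e i)) fun m => hφ i m m.2)).comp
  (AddEquiv.ofBijective (DirectSum.coeAddMonoidHom ℳ) (internal_bij h)).symm.toAddMonoidHom

lemma pushDec_of (h : DirectSum.IsInternal ℳ) (𝒩 : κ → AddSubgroup N) (e : ι → κ) (φ : M →+ N)
    (hφ : ∀ i, ∀ m ∈ ℳ i, φ m ∈ 𝒩 (e i)) {i : ι} {m : M} (hm : m ∈ ℳ i) :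
    pushDec h 𝒩 e φ hφ m = DirectSum.of (fun k => 𝒩 k) (e i) ⟨φ m, hφ i m hm⟩ := by
  have : (AddEquiv.ofBijective (DirectSum.coeAddMonoidHom ℳ) (internal_bij h)).symm m =
      DirectSum.of (fun i => ℳ i) i ⟨m, hm⟩ := by
    rw [AddEquiv.symm_apply_eq]; simp
  simp only [pushDec, AddMonoidHom.comp_apply, AddEquiv.coe_toAddMonoidHom, this,
    DirectSum.toAddMonoid_of]
  rfl

lemma coe_pushDec (h : DirectSum.IsInternal ℳ) (𝒩 : κ → AddSubgroup N) (e : ι → κ) (φ : M →+ N)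
    (hφ : ∀ i, ∀ m ∈ ℳ i, φ m ∈ 𝒩 (e i)) (m : M) :
    DirectSum.coeAddMonoidHom 𝒩 (pushDec h 𝒩 e φ hφ m) = φ m := by
  refine internal_induction h (p := fun m => DirectSum.coeAddMonoidHom 𝒩 (pushDec h 𝒩 e φ hφ m) = φ m)
    (by simp only [map_zero]) (fun i m hm => ?_) (fun x y hx hy => ?_) m
  · rw [pushDec_of h 𝒩 e φ hφ hm, DirectSum.coeAddMonoidHom_of]
  · rw [map_add, map_add, map_add, hx, hy]

lemma isInternal_reindex (h : DirectSum.IsInternal ℳ) (e : κ ≃ ι) : DirectSum.IsInternal fun k => ℳ (e k) := by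
  have hf : ∀ i, ∀ m ∈ ℳ i, AddMonoidHom.id M m ∈ ℳ (e (e.symm i)) :=
    fun i m hm => (e.apply_symm_apply i).symm ▸ hm
  refine isInternal_mk _ (pushDec h (fun k => ℳ (e k)) e.symm (AddMonoidHom.id M) hf)
    (fun m => coe_pushDec ..) (fun k x => ?_)
  rw [pushDec_of h (fun k => ℳ (e k)) e.symm _ hf x.2]
  exact of_congr (ℳ := fun k => ℳ (e k)) (e.symm_apply_apply k) _ _ rfl

lemma isInternal_prod (h : DirectSum.IsInternal ℳ) {𝒩 : ι → AddSubgroup N} (h' : DirectSum.IsInternal 𝒩) :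
    DirectSum.IsInternal fun i => (ℳ i).prod (𝒩 i) := by
  have hf : ∀ i, ∀ m ∈ ℳ i, AddMonoidHom.inl M N m ∈ (ℳ (id i)).prod (𝒩 (id i)) :=
    fun i m hm => AddSubgroup.mem_prod.2 ⟨hm, zero_mem _⟩
  have hg : ∀ i, ∀ n ∈ 𝒩 i, AddMonoidHom.inr M N n ∈ (ℳ (id i)).prod (𝒩 (id i)) :=
    fun i m hm => AddSubgroup.mem_prod.2 ⟨zero_mem _, hm⟩
  refine isInternal_mk _
    ((pushDec h (fun i => (ℳ i).prod (𝒩 i)) id _ hf).comp (AddMonoidHom.fst M N) +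
      (pushDec h' (fun i => (ℳ i).prod (𝒩 i)) id _ hg).comp (AddMonoidHom.snd M N))
    (fun m => ?_) (fun i x => ?_)
  · simp only [AddMonoidHom.add_apply, AddMonoidHom.comp_apply, map_add]
    rw [coe_pushDec, coe_pushDec]
    simp
  · obtain ⟨⟨x, y⟩, hxy⟩ := x
    obtain ⟨hx, hy⟩ := AddSubgroup.mem_prod.1 hxy
    simp only at hx hy
    simp only [AddMonoidHom.add_apply, AddMonoidHom.comp_apply, AddMonoidHom.coe_fst,
      AddMonoidHom.coe_snd]
    rw [pushDec_of h _ _ _ hf hx, pushDec_of h' _ _ _ hg hy]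
    simp only [id]
    rw [← map_add]
    congr 1
    exact Subtype.ext (by simp)

lemma isInternal_pi {G : Type} [Fintype G] [DecidableEq G] {X : G → Type}
    [∀ g, AddCommGroup (X g)] {𝒳 : ∀ g, ι → AddSubgroup (X g)}
    (hX : ∀ g, DirectSum.IsInternal (𝒳 g)) :
    DirectSum.IsInternal fun i => AddSubgroup.pi Set.univ fun g => 𝒳 g i := by
  have hf : ∀ g i, ∀ m ∈ 𝒳 g i,
      AddMonoidHom.single X g m ∈ AddSubgroup.pi Set.univ fun g => 𝒳 g (id i) := by
    intro g i m hm g' _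
    change Pi.single g m g' ∈ 𝒳 g' i
    by_cases hg : g' = g
    · subst hg
      rwa [Pi.single_eq_same]
    · rw [Pi.single_eq_of_ne hg]
      exact zero_mem _
  refine isInternal_mk _ (∑ g, (pushDec (hX g)
    (fun i => AddSubgroup.pi Set.univ fun g => 𝒳 g i) id _ (hf g)).comp
      (Pi.evalAddMonoidHom X g)) (fun m => ?_) (fun i x => ?_)
  · simp only [AddMonoidHom.finsetSum_apply, AddMonoidHom.comp_apply, map_sum]
    refine (Finset.sum_congr rfl fun g _ => coe_pushDec ..).trans ?_
    exact Finset.univ_sum_single m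
  · simp only [AddMonoidHom.finsetSum_apply, AddMonoidHom.comp_apply]
    have hx : ∀ g, (Pi.evalAddMonoidHom X g) (x : ∀ g, X g) ∈ 𝒳 g i := fun g => x.2 g trivial
    rw [Finset.sum_congr rfl fun g _ => pushDec_of (hX g) (fun i => AddSubgroup.pi Set.univ
      fun g => 𝒳 g i) id _ (hf g) (hx g)]
    simp only [id]
    rw [← map_sum]
    refine congrArg (DirectSum.of (fun i => AddSubgroup.pi Set.univ fun g => 𝒳 g i) i)
      (Subtype.ext ?_)
    rw [AddSubgroup.val_finsetSum]
    exact Finset.univ_sum_single (x : ∀ g, X g)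

end Grading

/-! ### DG modules and their homotopy category

`R` is an algebra over the field with two elements with a grading `𝒜` by `ℤ × Λ` (cohomological
degree and internal degree), regarded as a DG algebra with zero differential.  No signs occur, the
characteristic being two. -/

section DG

variable {Λ : Type} [AddCommGroup Λ] [DecidableEq Λ] {R : Type} [Ring R] [Algebra (ZMod 2) R]

/-- A `Λ`-graded DG left module over the graded algebra `R` with zero differential. -/
structure DGMod (𝒜 : ℤ × Λ → Submodule (ZMod 2) R) where
  carrier : Type
  [grp : AddCommGroup carrier]
  [mod : Module R carrier]
  deg : ℤ × Λ → AddSubgroup carrier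
  isInternal : DirectSum.IsInternal deg
  smul_mem : ∀ {i j : ℤ × Λ} {a : R} {m : carrier}, a ∈ 𝒜 i → m ∈ deg j → a • m ∈ deg (i + j)
  d : carrier →ₗ[R] carrier
  d_mem : ∀ {i : ℤ × Λ} {m : carrier}, m ∈ deg i → d m ∈ deg (i + (1, 0))
  d_d : ∀ m, d (d m) = 0

namespace DGMod

attribute [instance] DGMod.grp DGMod.mod

variable {𝒜 : ℤ × Λ → Submodule (ZMod 2) R}

instance : CoeSort (DGMod 𝒜) Type := ⟨DGMod.carrier⟩

lemma add_self (M : DGMod 𝒜) (m : M) : m + m = 0 := by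
  have h2 : (2 : R) = 0 := by
    rw [← map_ofNat (algebraMap (ZMod 2) R) 2, show (OfNat.ofNat 2 : ZMod 2) = 0 from rfl, map_zero]
  rw [← two_smul R m, h2, zero_smul]

/-- Closed morphisms of degree zero. -/
def Z0 (M N : DGMod 𝒜) : AddSubgroup (M →ₗ[R] N) where
  carrier := {f | (∀ i, ∀ m ∈ M.deg i, f m ∈ N.deg i) ∧ ∀ m, f (M.d m) = N.d (f m)}
  zero_mem' := ⟨fun _ _ _ => zero_mem _, fun m => by simp⟩
  add_mem' hf hg := ⟨fun i m hm => add_mem (hf.1 i m hm) (hg.1 i m hm),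
    fun m => by simp [hf.2 m, hg.2 m]⟩
  neg_mem' hf := ⟨fun i m hm => neg_mem (hf.1 i m hm), fun m => by simp [hf.2 m]⟩

instance (M N : DGMod 𝒜) : CoeFun (Z0 M N) fun _ => M → N := ⟨fun f => f.1⟩

/-- The closed morphisms of degree zero of the form `d h + h d` with `h` of degree `(-1, 0)`. -/
def B0 (M N : DGMod 𝒜) : AddSubgroup (Z0 M N) where
  carrier := {f | ∃ h : M →ₗ[R] N, (∀ i, ∀ m ∈ M.deg i, h m ∈ N.deg (i - (1, 0))) ∧
    ∀ m, f m = N.d (h m) + h (M.d m)}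
  zero_mem' := ⟨0, fun _ _ _ => zero_mem _, fun m => by simp⟩
  add_mem' := by
    rintro f g ⟨h, hh, hf⟩ ⟨k, hk, hg⟩
    refine ⟨h + k, fun i m hm => add_mem (hh i m hm) (hk i m hm), fun m => ?_⟩
    have : (f + g) m = f m + g m := rfl
    rw [this, hf, hg]
    simp only [LinearMap.add_apply, map_add]
    abel
  neg_mem' := by
    rintro f ⟨h, hh, hf⟩
    refine ⟨-h, fun i m hm => neg_mem (hh i m hm), fun m => ?_⟩
    have : (-f) m = -(f m) := rfl
    rw [this, hf]
    simp only [LinearMap.neg_apply, map_neg]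
    abel

/-- The morphisms in the zeroth homology category of the DG category of DG modules. -/
def HHom (M N : DGMod 𝒜) : Type := Z0 M N ⧸ B0 M N

instance (M N : DGMod 𝒜) : AddCommGroup (HHom M N) :=
  inferInstanceAs (AddCommGroup (Z0 M N ⧸ B0 M N))

/-- The class of a closed morphism. -/
def clsHom (M N : DGMod 𝒜) : Z0 M N →+ HHom M N := QuotientAddGroup.mk' (B0 M N)

lemma clsHom_surjective (M N : DGMod 𝒜) : Function.Surjective (clsHom M N) :=
  QuotientAddGroup.mk'_surjective _

/-- The identity as a closed morphism. -/
def idZ (M : DGMod 𝒜) : Z0 M M := ⟨LinearMap.id, fun _ _ h => h, fun _ => rfl⟩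

/-- Composition of closed morphisms. -/
def compZ {M N P : DGMod 𝒜} (f : Z0 M N) (g : Z0 N P) : Z0 M P :=
  ⟨g.1.comp f.1, fun i m hm => g.2.1 i _ (f.2.1 i m hm), fun m => by simp [f.2.2, g.2.2]⟩

/-- Precomposition with a closed morphism. -/
def precompZ {M N : DGMod 𝒜} (P : DGMod 𝒜) (f : Z0 M N) : Z0 N P →+ Z0 M P where
  toFun g := compZ f g
  map_zero' := rfl
  map_add' _ _ := rfl

lemma precompZ_le {M N : DGMod 𝒜} (P : DGMod 𝒜) (f : Z0 M N) :
    B0 N P ≤ (B0 M P).comap (precompZ P f) := by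
  rintro g ⟨h, hh, hg⟩
  change compZ f g ∈ B0 M P
  exact ⟨h.comp f.1, fun i m hm => hh i _ (f.2.1 i m hm), fun m => by
    simpa [compZ, f.2.2] using hg (f m)⟩

/-- Composition in the homotopy category. -/
def compH (M N P : DGMod 𝒜) : HHom M N →+ HHom N P →+ HHom M P :=
  QuotientAddGroup.lift (B0 M N)
    { toFun := fun f => QuotientAddGroup.map (B0 N P) (B0 M P) (precompZ P f) (precompZ_le P f)
      map_zero' := by
        ext ⟨g, hg⟩
        exact congrArg (clsHom M P) (Subtype.ext (LinearMap.ext fun m => map_zero g))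
      map_add' := fun f f' => by
        ext ⟨g, hg⟩
        exact congrArg (clsHom M P) (Subtype.ext (LinearMap.ext fun m => map_add g _ _)) }
    (by
      rintro f ⟨h, hh, hf⟩
      refine AddMonoidHom.ext fun g => ?_
      obtain ⟨g, rfl⟩ := clsHom_surjective N P g
      change clsHom M P (compZ f g) = 0
      refine (QuotientAddGroup.eq_zero_iff (N := B0 M P) (compZ f g)).2 ⟨g.1.comp h, fun i m hm => g.2.1 _ _ (hh i m hm),
        fun m => ?_⟩
      have : (compZ f g) m = g (f m) := rfl
      exact this.trans (by rw [hf m, map_add, g.2.2]; rfl))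

/-- The homotopy category of DG modules, the zeroth homology category of the DG category of
DG modules. -/
instance : Category (DGMod 𝒜) where
  Hom M N := HHom M N
  id M := clsHom M M (idZ M)
  comp f g := compH _ _ _ f g
  id_comp := by
    intro M N f
    obtain ⟨f, rfl⟩ := clsHom_surjective M N f
    rfl
  comp_id := by
    intro M N f
    obtain ⟨f, rfl⟩ := clsHom_surjective M N f
    rfl
  assoc := by
    intro M N P Q f g h
    obtain ⟨f, rfl⟩ := clsHom_surjective M N f
    obtain ⟨g, rfl⟩ := clsHom_surjective N P g
    obtain ⟨h, rfl⟩ := clsHom_surjective P Q h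
    rfl

instance (M N : DGMod 𝒜) : AddCommGroup (M ⟶ N) := inferInstanceAs (AddCommGroup (HHom M N))

instance : Preadditive (DGMod 𝒜) where
  homGroup _ _ := inferInstance
  add_comp M N P f f' g := congrArg (fun φ => φ g) (map_add (compH M N P) f f')
  comp_add M N P f g g' := map_add (compH M N P f) g g'

/-- The homotopy class of a closed morphism of degree zero. -/
def cls {M N : DGMod 𝒜} (f : Z0 M N) : M ⟶ N := clsHom M N f

lemma cls_surjective {M N : DGMod 𝒜} (f : M ⟶ N) : ∃ g : Z0 M N, cls g = f :=
  clsHom_surjective M N f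

lemma cls_comp {M N P : DGMod 𝒜} (f : Z0 M N) (g : Z0 N P) : cls f ≫ cls g = cls (compZ f g) := rfl

lemma cls_id (M : DGMod 𝒜) : cls (idZ M) = 𝟙 M := rfl

lemma cls_eq_zero {M N : DGMod 𝒜} {f : Z0 M N} (h : f ∈ B0 M N) : cls f = 0 :=
  (QuotientAddGroup.eq_zero_iff _).2 h

/-- The grading shift: `M[n]{l}` is `M.shift (n, l)`, with `M[n]{l}` in degree `i` equal to `M` in
degree `i + (n, l)`. -/
@[simps carrier deg d] def shift (M : DGMod 𝒜) (s : ℤ × Λ) : DGMod 𝒜 where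
  carrier := M
  deg i := M.deg (i + s)
  isInternal := isInternal_reindex M.isInternal (Equiv.addRight s)
  smul_mem ha hm := by rw [add_assoc]; exact M.smul_mem ha hm
  d := M.d
  d_mem hm := by rw [add_right_comm]; exact M.d_mem hm
  d_d := M.d_d

/-- The shift of a closed morphism. -/
def shiftZ (s : ℤ × Λ) (M N : DGMod 𝒜) : Z0 M N →+ Z0 (M.shift s) (N.shift s) where
  toFun f := ⟨f.1, fun i m hm => f.2.1 (i + s) m hm, f.2.2⟩
  map_zero' := rfl
  map_add' _ _ := rfl

/-- The shift of a homotopy class. -/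
def shiftH (s : ℤ × Λ) (M N : DGMod 𝒜) : (M ⟶ N) →+ (M.shift s ⟶ N.shift s) :=
  QuotientAddGroup.map _ _ (shiftZ s M N) (by
    rintro f ⟨h, hh, hf⟩
    refine ⟨h, fun i m hm => ?_, hf⟩
    have := hh (i + s) m hm
    rwa [add_sub_right_comm] at this)

/-- The shift functor. -/
def shiftF (s : ℤ × Λ) : DGMod 𝒜 ⥤ DGMod 𝒜 where
  obj M := M.shift s
  map {M N} f := shiftH s M N f
  map_id _ := rfl
  map_comp {M N P} f g := by
    obtain ⟨f, rfl⟩ := cls_surjective f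
    obtain ⟨g, rfl⟩ := cls_surjective g
    rfl

/-- The identity of `M`, seen as a morphism between two shifts by the same amount. -/
def reZ (M : DGMod 𝒜) {s t : ℤ × Λ} (h : s = t) : Z0 (M.shift s) (M.shift t) :=
  ⟨(LinearMap.id : M →ₗ[R] M), fun _ _ hm => h ▸ hm, fun _ => rfl⟩

lemma eqToHom_shift (M N : DGMod 𝒜) {s t : ℤ × Λ} (h : s = t) (h' : M.shift s = M.shift t)
    (g : M.shift t ⟶ N) : cls (M.reZ h) ≫ g = eqToHom h' ≫ g := by
  subst h
  exact congrArg (fun f => f ≫ g) (eqToHom_refl (M.shift s) h').symm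

/-- The identity of `M`, as a morphism `M[0] → M`. -/
def zeroZ (M : DGMod 𝒜) : Z0 (M.shift (0, 0)) M :=
  ⟨(LinearMap.id : M →ₗ[R] M), fun i m hm => by
    have : m ∈ M.deg (i + 0) := hm
    rwa [add_zero] at this, fun _ => rfl⟩

/-- The identity of `M`, as a morphism `M → M[0]`. -/
def zeroZ' (M : DGMod 𝒜) : Z0 M (M.shift (0, 0)) :=
  ⟨(LinearMap.id : M →ₗ[R] M), fun i m hm => by
    change m ∈ M.deg (i + 0)
    rwa [add_zero], fun _ => rfl⟩

lemma shift_add_deg (M : DGMod 𝒜) (a b : ℤ) (i : ℤ × Λ) :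
    (M.shift (a + b, 0)).deg i = ((M.shift (a, 0)).shift (b, 0)).deg i := by
  change M.deg _ = M.deg _
  congr 1
  ext <;> simp [add_comm, add_left_comm]

/-- The identity of `M`, as a morphism `M[a + b] → M[a][b]`. -/
def addZ (M : DGMod 𝒜) (a b : ℤ) : Z0 (M.shift (a + b, 0)) ((M.shift (a, 0)).shift (b, 0)) :=
  ⟨(LinearMap.id : M →ₗ[R] M), fun i m hm => by
    rw [← shift_add_deg]; exact hm, fun _ => rfl⟩

/-- The identity of `M`, as a morphism `M[a][b] → M[a + b]`. -/
def addZ' (M : DGMod 𝒜) (a b : ℤ) : Z0 ((M.shift (a, 0)).shift (b, 0)) (M.shift (a + b, 0)) :=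
  ⟨(LinearMap.id : M →ₗ[R] M), fun i m hm => by
    rw [shift_add_deg]; exact hm, fun _ => rfl⟩

/-- The isomorphism of functors `[0] ≅ id`. -/
def shiftZeroIso : shiftF (𝒜 := 𝒜) (0, 0) ≅ 𝟭 _ :=
  NatIso.ofComponents
    (fun M => { hom := cls M.zeroZ, inv := cls M.zeroZ', hom_inv_id := rfl, inv_hom_id := rfl })
    (by
      intro M N f
      obtain ⟨f, rfl⟩ := cls_surjective f
      rfl)

/-- The isomorphism of functors `[a + b] ≅ [a][b]`. -/
def shiftAddIso (a b : ℤ) : shiftF (𝒜 := 𝒜) (a + b, 0) ≅ shiftF (a, 0) ⋙ shiftF (b, 0) :=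
  NatIso.ofComponents
    (fun M => { hom := cls (M.addZ a b), inv := cls (M.addZ' a b),
                hom_inv_id := rfl, inv_hom_id := rfl })
    (by
      intro M N f
      obtain ⟨f, rfl⟩ := cls_surjective f
      rfl)

instance : HasShift (DGMod 𝒜) ℤ := hasShiftMk _ _
  { F := fun n => shiftF (n, 0)
    zero := shiftZeroIso
    add := shiftAddIso
    assoc_hom_app := fun a b c M => by
      change cls (M.addZ (a + b) c) ≫ cls (shiftZ (c, 0) _ _ (M.addZ a b)) =
        eqToHom _ ≫ cls (M.addZ a (b + c)) ≫ cls ((M.shift (a, 0)).addZ b c)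
      refine Eq.trans ?_ (eqToHom_shift M _ (show (a + b + c, (0 : Λ)) = (a + (b + c), 0) by rw [add_assoc]) _ _)
      rfl
    zero_add_hom_app := fun n M => by
      change cls (M.addZ 0 n) = eqToHom _ ≫ cls (shiftZ (n, 0) _ _ M.zeroZ')
      refine Eq.trans ?_ (eqToHom_shift M _ (show (0 + n, (0 : Λ)) = (n, 0) by rw [zero_add]) _ _)
      rfl
    add_zero_hom_app := fun n M => by
      change cls (M.addZ n 0) = eqToHom _ ≫ cls (M.shift (n, 0)).zeroZ'
      refine Eq.trans ?_ (eqToHom_shift M _ (show (n + 0, (0 : Λ)) = (n, 0) by rw [add_zero]) _ _)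
      rfl }

instance (n : ℤ) : (shiftFunctor (DGMod 𝒜) n).Additive where
  map_add {M N f g} := map_add (shiftH (n, 0) M N) f g

/-- The mapping cone of a closed morphism of degree zero: `M[1] ⊕ N` with the differential
`(m, n) ↦ (d m, f m + d n)`. -/
@[simps carrier deg d] def cone {M N : DGMod 𝒜} (f : Z0 M N) : DGMod 𝒜 where
  carrier := M × N
  deg i := ((M.shift (1, 0)).deg i).prod (N.deg i)
  isInternal := isInternal_prod (M.shift (1, 0)).isInternal N.isInternal
  smul_mem ha hm := ⟨(M.shift (1, 0)).smul_mem ha hm.1, N.smul_mem ha hm.2⟩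
  d := (M.d.comp (LinearMap.fst R M N)).prod (f.1.comp (LinearMap.fst R M N) +
    N.d.comp (LinearMap.snd R M N))
  d_mem hm := ⟨(M.shift (1, 0)).d_mem hm.1, add_mem (f.2.1 _ _ hm.1) (N.d_mem hm.2)⟩
  d_d m := by
    refine Prod.ext (M.d_d m.1) ?_
    have : f (M.d m.1) + N.d (f m.1 + N.d m.2) = 0 := by
      rw [map_add, N.d_d, f.2.2, add_zero, N.add_self]
    exact this

/-- The inclusion `N → cone f`. -/
def coneInr {M N : DGMod 𝒜} (f : Z0 M N) : Z0 N (cone f) :=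
  ⟨LinearMap.inr R M N, fun _ _ hm => ⟨zero_mem _, hm⟩, fun m => by
    refine Prod.ext ?_ ?_
    · exact (map_zero M.d).symm
    · change N.d m = f 0 + N.d m
      rw [map_zero, zero_add]⟩

/-- The projection `cone f → M[1]`. -/
def coneFst {M N : DGMod 𝒜} (f : Z0 M N) : Z0 (cone f) (M.shift (1, 0)) :=
  ⟨LinearMap.fst R M N, fun _ _ hm => hm.1, fun _ => rfl⟩

/-- The standard triangle `M → N → cone f → M[1]`. -/
def coneTriangle {M N : DGMod 𝒜} (f : Z0 M N) : Triangle (DGMod 𝒜) :=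
  Triangle.mk (cls f) (cls (coneInr f)) (show cone f ⟶ M⟦(1 : ℤ)⟧ from cls (coneFst f))

/-- The cone of an identity is a zero object of the homotopy category. -/
lemma isZero_cone_id (M : DGMod 𝒜) : Limits.IsZero (cone M.idZ) := by
  rw [Limits.IsZero.iff_id_eq_zero]
  refine cls_eq_zero ⟨(LinearMap.snd R M M).prod 0, fun i m hm => ⟨?_, zero_mem _⟩, fun m => ?_⟩
  · have : m.2 ∈ M.deg i := hm.2
    change m.2 ∈ M.deg (i - (1, 0) + (1, 0))
    rwa [sub_add_cancel]
  · obtain ⟨m, n⟩ := m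
    have h : M.d n + (m + M.d n) = m := by
      rw [add_left_comm, M.add_self, add_zero]
    refine Prod.ext ?_ ?_
    · exact h.symm
    · change n = (n + M.d 0) + 0
      simp

end DGMod

open DGMod

variable {𝒜 : ℤ × Λ → Submodule (ZMod 2) R}

/-- The objects of the smallest full subcategory of the category of DG modules which contains the
DG modules `P v` and is closed under isomorphisms, grading shifts and mapping cones. -/
inductive IsDGP {V : Type} (P : V → DGMod 𝒜) : ObjectProperty (DGMod 𝒜)
  | proj (v : V) : IsDGP P (P v)
  | shift {M : DGMod 𝒜} (s : ℤ × Λ) (hM : IsDGP P M) : IsDGP P (M.shift s)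
  | cone {M N : DGMod 𝒜} (f : Z0 M N) (hM : IsDGP P M) (hN : IsDGP P N) : IsDGP P (cone f)
  | iso {M N : DGMod 𝒜} (f : Z0 M N) (g : Z0 N M) (hfg : ∀ m, g (f m) = m)
      (hgf : ∀ n, f (g n) = n) (hM : IsDGP P M) : IsDGP P N

/-- The zeroth homology category of the DG category generated by the DG modules `P v`. -/
abbrev HP {V : Type} (P : V → DGMod 𝒜) : Type 1 := (IsDGP P).FullSubcategory

section HP

variable {V : Type} (P : V → DGMod 𝒜)

instance : (IsDGP P).IsStableUnderShift ℤ where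
  isStableUnderShiftBy n := ⟨fun _ hM => IsDGP.shift (n, 0) hM⟩

instance [Nonempty V] : (IsDGP P).ContainsZero where
  exists_zero := ⟨_, isZero_cone_id (P (Classical.arbitrary V)), .cone _ (.proj _) (.proj _)⟩

/-- The triangles in `HP P` which are isomorphic to a mapping cone triangle. -/
def coneTriangles : Set (Triangle (HP P)) :=
  {T | ∃ (M N : DGMod 𝒜) (f : Z0 M N),
    Nonempty ((IsDGP P).ι.mapTriangle.obj T ≅ coneTriangle f)}

end HP

/-! ### DG bimodules and tensor products -/

variable {Λ' : Type} [AddCommGroup Λ'] [DecidableEq Λ'] {R' : Type} [Ring R']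
  [Algebra (ZMod 2) R'] {ℬ : ℤ × Λ' → Submodule (ZMod 2) R'}

open MulOpposite in
/-- A `Λ'`-graded DG bimodule, with `R'` acting on the left and `R` on the right, where the right
action of an element of degree `(n, l)` has degree `(n, φ l)`.  The right action of `a` is the
action of `op a`. -/
structure DGBimod (ℬ : ℤ × Λ' → Submodule (ZMod 2) R') (𝒜 : ℤ × Λ → Submodule (ZMod 2) R)
    (φ : Λ →+ Λ') extends DGMod ℬ where
  [rmod : Module Rᵐᵒᵖ carrier]
  [comm : SMulCommClass R' Rᵐᵒᵖ carrier]
  rsmul_mem : ∀ {i : ℤ × Λ} {j : ℤ × Λ'} {a : R} {s : carrier}, a ∈ 𝒜 i → s ∈ deg j →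
    op a • s ∈ deg (j + (i.1, φ i.2))
  d_rsmul : ∀ (a : R) (s : carrier), d (op a • s) = op a • d s

namespace DGBimod

attribute [instance] DGBimod.rmod DGBimod.comm

open MulOpposite

variable {φ : Λ →+ Λ'} (S : DGBimod ℬ 𝒜 φ)

instance : CoeSort (DGBimod ℬ 𝒜 φ) Type := ⟨fun S => S.carrier⟩

/-- The relations `s a ⊗ m = s ⊗ a m`. -/
def rel (M : DGMod 𝒜) : Submodule R' (S ⊗[ℤ] M) :=
  Submodule.span R' {x | ∃ (s : S) (a : R) (m : M), x = (op a • s) ⊗ₜ[ℤ] m - s ⊗ₜ[ℤ] (a • m)}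

/-- The tensor product `S ⊗_R M`, as a left `R'`-module. -/
abbrev Tens (M : DGMod 𝒜) : Type := (S ⊗[ℤ] M) ⧸ S.rel M

/-- The class of `s ⊗ m` in `S ⊗_R M`. -/
def tm {M : DGMod 𝒜} (s : S) (m : M) : S.Tens M := Submodule.Quotient.mk (s ⊗ₜ[ℤ] m)

variable {S}

lemma tm_add {M : DGMod 𝒜} (s : S) (m m' : M) : S.tm s (m + m') = S.tm s m + S.tm s m' :=
  congrArg Submodule.Quotient.mk (TensorProduct.tmul_add s m m')

lemma add_tm {M : DGMod 𝒜} (s s' : S) (m : M) : S.tm (s + s') m = S.tm s m + S.tm s' m :=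
  congrArg Submodule.Quotient.mk (TensorProduct.add_tmul s s' m)

lemma smul_tm {M : DGMod 𝒜} (b : R') (s : S) (m : M) : b • S.tm s m = S.tm (b • s) m := rfl

lemma tm_balanced {M : DGMod 𝒜} (s : S) (a : R) (m : M) : S.tm (op a • s) m = S.tm s (a • m) :=
  (Submodule.Quotient.eq _).2 (Submodule.subset_span ⟨s, a, m, rfl⟩)

lemma tm_induction {M : DGMod 𝒜} {p : S.Tens M → Prop} (h0 : p 0) (ht : ∀ s m, p (S.tm s m))
    (ha : ∀ x y, p x → p y → p (x + y)) (x : S.Tens M) : p x := by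
  obtain ⟨x, rfl⟩ := Submodule.Quotient.mk_surjective _ x
  induction x using TensorProduct.induction_on with
  | zero => exact h0
  | tmul s m => exact ht s m
  | add x y hx hy => exact ha _ _ hx hy

variable (S)

/-- The total degree of `s ⊗ m`. -/
def tdeg (φ : Λ →+ Λ') (i : ℤ × Λ') (k : ℤ × Λ) : ℤ × Λ' := i + (k.1, φ k.2)

/-- The grading on `S ⊗_R M`: the degree of `s ⊗ m` is `deg s + (n, φ l)` if `m` has degree
`(n, l)`. -/
def tensDeg (M : DGMod 𝒜) (j : ℤ × Λ') : AddSubgroup (S.Tens M) :=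
  AddSubgroup.closure {x | ∃ (i : ℤ × Λ') (k : ℤ × Λ), tdeg φ i k = j ∧
    ∃ s ∈ S.deg i, ∃ m ∈ M.deg k, x = S.tm s m}

variable {S}

lemma tm_mem {M : DGMod 𝒜} {i : ℤ × Λ'} {k : ℤ × Λ} {s : S} {m : M} (hs : s ∈ S.deg i)
    (hm : m ∈ M.deg k) : S.tm s m ∈ S.tensDeg M (tdeg φ i k) :=
  AddSubgroup.subset_closure ⟨i, k, rfl, s, hs, m, hm, rfl⟩

/-- An additive map out of the tensor product. -/
def liftTens {M : DGMod 𝒜} {X : Type} [AddCommGroup X] (β : S →+ M →+ X)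
    (hβ : ∀ (s : S) (a : R) (m : M), β (op a • s) m = β s (a • m)) : S.Tens M →+ X :=
  QuotientAddGroup.lift (S.rel M).toAddSubgroup
    (TensorProduct.liftAddHom β fun r s m => by
      rw [map_zsmul, map_zsmul, AddMonoidHom.smul_apply])
    (by
      intro x hx
      suffices h : ∀ b : R', TensorProduct.liftAddHom β (fun r s m => by
          rw [map_zsmul, map_zsmul, AddMonoidHom.smul_apply]) (b • x) = 0 by
        simpa using h 1
      refine Submodule.span_induction (p := fun x _ => ∀ b : R', TensorProduct.liftAddHom β _
        (b • x) = 0) ?_ (fun b => ?_) (fun x y _ _ hx hy b => ?_) (fun c x _ hx b => ?_) hx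
      · rintro _ ⟨s, a, m, rfl⟩ b
        rw [smul_sub, map_sub, TensorProduct.smul_tmul', TensorProduct.smul_tmul',
          TensorProduct.liftAddHom_tmul, TensorProduct.liftAddHom_tmul, smul_comm, hβ, sub_self]
      · rw [smul_zero, map_zero]
      · rw [smul_add, map_add, hx, hy, add_zero]
      · rw [smul_smul]; exact hx _)

lemma liftTens_tm {M : DGMod 𝒜} {X : Type} [AddCommGroup X] (β : S →+ M →+ X)
    (hβ : ∀ (s : S) (a : R) (m : M), β (op a • s) m = β s (a • m)) (s : S) (m : M) :
    liftTens β hβ (S.tm s m) = β s m := rfl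

/-- For `s` fixed, the map `m ↦ s ⊗ m`. -/
def tmHom (M : DGMod 𝒜) (s : S) : M →+ S.Tens M where
  toFun m := S.tm s m
  map_zero' := by
    refine congrArg Submodule.Quotient.mk (TensorProduct.tmul_zero _ s)
  map_add' := tm_add s

lemma tmHom_mem {M : DGMod 𝒜} {i : ℤ × Λ'} {s : S} (hs : s ∈ S.deg i) :
    ∀ k, ∀ m ∈ M.deg k, tmHom M s m ∈ S.tensDeg M (tdeg φ i k) := fun _ _ hm => tm_mem hs hm

/-- The homogeneous components of `s ⊗ m`, for `s` homogeneous of degree `i`. -/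
def decS (M : DGMod 𝒜) (i : ℤ × Λ') : S.deg i →+ M →+ ⨁ j, S.tensDeg M j where
  toFun s := pushDec M.isInternal (S.tensDeg M) (tdeg φ i) (tmHom M s.1) (tmHom_mem s.2)
  map_zero' := by
    refine AddMonoidHom.ext (internal_induction M.isInternal ?_ (fun k m hm => ?_)
      (fun x y hx hy => ?_))
    · rw [map_zero, map_zero]
    · rw [pushDec_of M.isInternal _ _ _ (tmHom_mem (0 : S.deg i).2) hm]
      exact (congrArg _ (Subtype.ext
        (congrArg Submodule.Quotient.mk (TensorProduct.zero_tmul _ m)))).trans (map_zero _)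
    · rw [map_add, map_add, hx, hy]
  map_add' s t := by
    refine AddMonoidHom.ext (internal_induction M.isInternal ?_ (fun k m hm => ?_)
      (fun x y hx hy => ?_))
    · rw [map_zero, map_zero]
    · rw [AddMonoidHom.add_apply, pushDec_of M.isInternal _ _ _ (tmHom_mem (s + t).2) hm,
        pushDec_of M.isInternal _ _ _ (tmHom_mem s.2) hm,
        pushDec_of M.isInternal _ _ _ (tmHom_mem t.2) hm, ← map_add]
      exact congrArg _ (Subtype.ext (add_tm _ _ m))
    · rw [map_add, map_add, hx, hy]

/-- The homogeneous components of `s ⊗ m`. -/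
def decBil (M : DGMod 𝒜) : S →+ M →+ ⨁ j, S.tensDeg M j :=
  (DirectSum.toAddMonoid (decS M)).comp (AddEquiv.ofBijective (DirectSum.coeAddMonoidHom S.deg)
    (internal_bij S.isInternal)).symm.toAddMonoidHom

lemma decBil_of {M : DGMod 𝒜} {i : ℤ × Λ'} {k : ℤ × Λ} {s : S} {m : M} (hs : s ∈ S.deg i)
    (hm : m ∈ M.deg k) : decBil M s m =
      DirectSum.of (fun j => S.tensDeg M j) (tdeg φ i k) ⟨S.tm s m, tm_mem hs hm⟩ := by
  have : (AddEquiv.ofBijective (DirectSum.coeAddMonoidHom S.deg)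
      (internal_bij S.isInternal)).symm s = DirectSum.of (fun i => S.deg i) i ⟨s, hs⟩ := by
    rw [AddEquiv.symm_apply_eq]; simp
  simp only [decBil, AddMonoidHom.comp_apply, AddEquiv.coe_toAddMonoidHom, this,
    DirectSum.toAddMonoid_of]
  exact pushDec_of M.isInternal _ _ _ (tmHom_mem hs) hm

section Balanced

variable [GradedAlgebra 𝒜]

lemma decBil_balanced₁ (M : DGMod 𝒜) {j : ℤ × Λ'} {k : ℤ × Λ} {s : S} (hs : s ∈ S.deg j) {m : M}
    (hm : m ∈ M.deg k) (a : R) : decBil M (op a • s) m = decBil M s (a • m) := by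
  refine DirectSum.Decomposition.inductionOn 𝒜
    (motive := fun a : R => decBil M (op a • s) m = decBil M s (a • m)) ?_ (fun {i} a => ?_)
    (fun a b ha hb => ?_) a
  · rw [MulOpposite.op_zero, zero_smul, zero_smul, map_zero, map_zero]; rfl
  · rw [decBil_of (S.rsmul_mem a.2 hs) hm, decBil_of hs (M.smul_mem a.2 hm)]
    refine of_congr ?_ _ _ (tm_balanced _ _ _)
    ext <;> simp [tdeg, add_assoc]
  · rw [MulOpposite.op_add, add_smul, add_smul, map_add, map_add, AddMonoidHom.add_apply, ha, hb]

lemma decBil_balanced₂ (M : DGMod 𝒜) {j : ℤ × Λ'} {s : S} (hs : s ∈ S.deg j) (m : M) (a : R) :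
    decBil M (op a • s) m = decBil M s (a • m) := by
  refine internal_induction M.isInternal
    (p := fun m => decBil M (op a • s) m = decBil M s (a • m)) ?_
    (fun k m hm => decBil_balanced₁ M hs hm a) (fun x y hx hy => ?_) m
  · rw [smul_zero, map_zero, map_zero]
  · have h : a • (x + y) = a • x + a • y := smul_add _ _ _
    rw [h, map_add, map_add, hx, hy]

lemma decBil_balanced (M : DGMod 𝒜) (s : S) (a : R) (m : M) :
    decBil M (op a • s) m = decBil M s (a • m) := by
  refine internal_induction S.isInternal
    (p := fun s => decBil M (op a • s) m = decBil M s (a • m)) ?_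
    (fun j s hs => decBil_balanced₂ M hs m a) (fun x y hx hy => ?_) s
  · rw [smul_zero, map_zero]; rfl
  · have h : op a • (x + y) = op a • x + op a • y := smul_add _ _ _
    rw [h, map_add, map_add, AddMonoidHom.add_apply, AddMonoidHom.add_apply, hx, hy]

lemma tens_isInternal (M : DGMod 𝒜) : DirectSum.IsInternal (S.tensDeg M) := by
  have hmem : ∀ j, ∀ x (hx : x ∈ S.tensDeg M j), liftTens (decBil M) (decBil_balanced M) x =
      DirectSum.of (fun j => S.tensDeg M j) j ⟨x, hx⟩ := by
    intro j x hx
    refine AddSubgroup.closure_induction (p := fun x hx =>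
      liftTens (decBil M) (decBil_balanced M) x =
        DirectSum.of (fun j => S.tensDeg M j) j ⟨x, hx⟩) ?_ ?_ ?_ ?_ hx
    · rintro _ ⟨i, k, rfl, s, hs, m, hm, rfl⟩
      rw [liftTens_tm, decBil_of hs hm]
    · rw [map_zero]; exact (map_zero _).symm
    · intro x y hx hy h1 h2
      rw [map_add, h1, h2, ← map_add]; rfl
    · intro x hx h1
      rw [map_neg, h1, ← map_neg]; rfl
  refine isInternal_mk _ (liftTens (decBil M) (decBil_balanced M)) (fun x => ?_)
    (fun j x => hmem j x x.2)
  refine tm_induction (p := fun x => DirectSum.coeAddMonoidHom (S.tensDeg M)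
    (liftTens (decBil M) (decBil_balanced M) x) = x) ?_ (fun s m => ?_) (fun x y hx hy => ?_) x
  · rw [map_zero, map_zero]
  · rw [liftTens_tm]
    refine internal_induction S.isInternal (p := fun s => DirectSum.coeAddMonoidHom
      (S.tensDeg M) (decBil M s m) = S.tm s m) ?_ (fun j s hs => ?_) (fun x y hx hy => ?_) s
    · rw [map_zero, AddMonoidHom.zero_apply, map_zero]
      exact (congrArg Submodule.Quotient.mk (TensorProduct.zero_tmul _ m)).symm
    · refine internal_induction M.isInternal (p := fun m => DirectSum.coeAddMonoidHom
        (S.tensDeg M) (decBil M s m) = S.tm s m) ?_ (fun k m hm => ?_) (fun x y hx hy => ?_) m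
      · rw [map_zero, map_zero]
        exact ((tmHom M s).map_zero).symm
      · rw [decBil_of hs hm, DirectSum.coeAddMonoidHom_of]
      · rw [map_add, map_add, hx, hy, tm_add]
    · rw [map_add, AddMonoidHom.add_apply, map_add, hx, hy, add_tm]
  · rw [map_add, map_add, hx, hy]

end Balanced

/-- The map `x ⊗ m ↦ f x ⊗ g m` on tensor products over the integers. -/
abbrev tmap {M N : DGMod 𝒜} (f : S →ₗ[R'] S) (g : M →ₗ[R] N) : S ⊗[ℤ] M →ₗ[R'] S ⊗[ℤ] N :=
  TensorProduct.AlgebraTensorModule.map f g.toAddMonoidHom.toIntLinearMap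

lemma tmap_le {M N : DGMod 𝒜} (f : S →ₗ[R'] S) (hf : ∀ (a : R) (s : S), f (op a • s) = op a • f s)
    (g : M →ₗ[R] N) : S.rel M ≤ (S.rel N).comap (tmap f g) := by
  refine Submodule.span_le.2 ?_
  rintro _ ⟨s, a, m, rfl⟩
  refine Submodule.subset_span ⟨f s, a, g m, ?_⟩
  rw [map_sub, TensorProduct.AlgebraTensorModule.map_tmul,
    TensorProduct.AlgebraTensorModule.map_tmul, hf]
  congr 2
  exact map_smul g a m

/-- The map `s ⊗ m ↦ f s ⊗ g m` on tensor products, for a bimodule endomorphism `f`. -/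
def qmap {M N : DGMod 𝒜} (f : S →ₗ[R'] S) (hf : ∀ (a : R) (s : S), f (op a • s) = op a • f s)
    (g : M →ₗ[R] N) : S.Tens M →ₗ[R'] S.Tens N :=
  Submodule.mapQ (S.rel M) (S.rel N) (tmap f g) (tmap_le f hf g)

lemma qmap_tm {M N : DGMod 𝒜} (f : S →ₗ[R'] S)
    (hf : ∀ (a : R) (s : S), f (op a • s) = op a • f s) (g : M →ₗ[R] N) (s : S) (m : M) :
    qmap f hf g (S.tm s m) = S.tm (f s) (g m) := rfl

/-- The differential on `S ⊗_R M`: `d (s ⊗ m) = d s ⊗ m + s ⊗ d m`. -/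
def tensD (M : DGMod 𝒜) : S.Tens M →ₗ[R'] S.Tens M :=
  qmap S.d S.d_rsmul (LinearMap.id : M →ₗ[R] M) + qmap LinearMap.id (fun _ _ => rfl) M.d

lemma tensD_tm (M : DGMod 𝒜) (s : S) (m : M) :
    tensD M (S.tm s m) = S.tm (S.d s) m + S.tm s (M.d m) := rfl

lemma zero_tm {M : DGMod 𝒜} (m : M) : S.tm 0 m = 0 :=
  congrArg Submodule.Quotient.mk (TensorProduct.zero_tmul _ m)

lemma tm_zero {M : DGMod 𝒜} (s : S) : S.tm s (0 : M) = 0 := (tmHom M s).map_zero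

lemma tens_ext {M : DGMod 𝒜} {X : Type} [AddCommGroup X] [Module R' X] {f g : S.Tens M →ₗ[R'] X}
    (h : ∀ s m, f (S.tm s m) = g (S.tm s m)) : f = g :=
  LinearMap.ext (tm_induction ((map_zero f).trans (map_zero g).symm) h
    fun x y hx hy => by rw [map_add, map_add, hx, hy])

lemma tensDeg_map {M N : DGMod 𝒜} (f : S.Tens M →+ S.Tens N) {c : ℤ × Λ'}
    (hf : ∀ i, ∀ s ∈ S.deg i, ∀ k, ∀ m ∈ M.deg k, f (S.tm s m) ∈ S.tensDeg N (tdeg φ i k + c))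
    {j : ℤ × Λ'} {x : S.Tens M} (hx : x ∈ S.tensDeg M j) : f x ∈ S.tensDeg N (j + c) := by
  refine AddSubgroup.closure_induction (p := fun x _ => f x ∈ S.tensDeg N (j + c)) ?_ ?_ ?_ ?_ hx
  · rintro _ ⟨i, k, rfl, s, hs, m, hm, rfl⟩
    exact hf i s hs k m hm
  · rw [map_zero]; exact zero_mem _
  · intro x y _ _ h1 h2
    rw [map_add]; exact add_mem h1 h2
  · intro x _ h1
    rw [map_neg]; exact neg_mem h1

/-- The map induced on tensor products by an `R`-linear map. -/
def idTens {M N : DGMod 𝒜} (g : M →ₗ[R] N) : S.Tens M →ₗ[R'] S.Tens N :=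
  qmap LinearMap.id (fun _ _ => rfl) g

lemma idTens_tm {M N : DGMod 𝒜} (g : M →ₗ[R] N) (s : S) (m : M) :
    idTens g (S.tm s m) = S.tm s (g m) := rfl

variable (S) [GradedAlgebra 𝒜]

/-- The DG module `S ⊗_R M`. -/
@[simps carrier deg d] def tensor (M : DGMod 𝒜) : DGMod ℬ where
  carrier := S.Tens M
  deg := S.tensDeg M
  isInternal := tens_isInternal M
  smul_mem {i j a x} ha hx := by
    rw [add_comm]
    refine tensDeg_map (DistribSMul.toAddMonoidHom (S.Tens M) a) (fun j s hs k m hm => ?_) hx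
    have h := tm_mem (S.smul_mem ha hs) hm
    have e : tdeg φ (i + j) k = tdeg φ j k + i := by
      simp only [tdeg]; abel
    rwa [e] at h
  d := tensD M
  d_mem hx := by
    refine tensDeg_map (tensD M).toAddMonoidHom (fun j s hs k m hm => ?_) hx
    have h1 := tm_mem (S.d_mem hs) hm
    have h2 := tm_mem hs (M.d_mem hm)
    have e1 : tdeg φ (j + (1, 0)) k = tdeg φ j k + (1, 0) := by
      simp only [tdeg]; abel
    have e2 : tdeg φ j (k + (1, 0)) = tdeg φ j k + (1, 0) := by
      ext <;> simp [tdeg, add_assoc]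
    rw [e1] at h1
    rw [e2] at h2
    exact add_mem h1 h2
  d_d x := by
    refine tm_induction (p := fun x => tensD M (tensD M x) = 0) ?_ (fun s m => ?_)
      (fun x y hx hy => ?_) x
    · rw [map_zero, map_zero]
    · have h : S.tm (S.d s) (M.d m) + S.tm (S.d s) (M.d m) = 0 := by
        rw [← tm_add, M.add_self, tm_zero]
      rw [tensD_tm, map_add, tensD_tm, tensD_tm, S.d_d, M.d_d, zero_tm, tm_zero, zero_add, add_zero,
        h]
    · rw [map_add, map_add, hx, hy, add_zero]

/-- The map `S ⊗_R f` for a closed morphism `f` of degree zero. -/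
def tensorZ (M N : DGMod 𝒜) : Z0 M N →+ Z0 (S.tensor M) (S.tensor N) where
  toFun f := ⟨idTens f.1, fun j x hx => by
    have := tensDeg_map (c := 0) (idTens (S := S) f.1).toAddMonoidHom (fun i s hs k m hm => by
      rw [add_zero]
      exact tm_mem hs (f.2.1 k m hm)) hx
    rwa [add_zero] at this, fun x => by
      refine tm_induction (p := fun x => idTens f.1 (tensD M x) = tensD N (idTens f.1 x)) ?_
        (fun s m => ?_) (fun x y hx hy => ?_) x
      · simp only [map_zero]
      · rw [tensD_tm, map_add, idTens_tm, idTens_tm, idTens_tm, tensD_tm, f.2.2]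
      · rw [map_add, map_add, map_add, map_add, hx, hy]⟩
  map_zero' := Subtype.ext (tens_ext (S := S) fun s _ => tm_zero s)
  map_add' f g := Subtype.ext (tens_ext (S := S) fun s _ => tm_add s _ _)

lemma tensorZ_le (M N : DGMod 𝒜) :
    B0 M N ≤ (B0 (S.tensor M) (S.tensor N)).comap (S.tensorZ M N) := by
  rintro f ⟨h, hh, hf⟩
  change S.tensorZ M N f ∈ B0 (S.tensor M) (S.tensor N)
  refine ⟨idTens h, fun j x hx => ?_, fun x => ?_⟩
  · have := tensDeg_map (c := -(1, 0)) (idTens (S := S) h).toAddMonoidHom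
      (fun i s hs k m hm => by
        have h1 := tm_mem hs (hh k m hm)
        have e : tdeg φ i (k - (1, 0)) = tdeg φ i k + -(1, 0) := by
          ext <;> simp [tdeg, sub_eq_add_neg, add_assoc]
        rwa [e] at h1) hx
    rwa [← sub_eq_add_neg] at this
  · refine tm_induction (p := fun x => idTens f.1 x = tensD N (idTens h x) + idTens h (tensD M x))
      ?_ (fun s m => ?_) (fun x y hx hy => ?_) x
    · simp only [map_zero, add_zero]
    · have e : S.tm (S.d s) (h m) + S.tm (S.d s) (h m) = 0 := by
        rw [← tm_add, N.add_self, tm_zero]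
      have e' : f.1 m = N.d (h m) + h (M.d m) := hf m
      rw [tensD_tm, map_add, idTens_tm, idTens_tm, idTens_tm, idTens_tm, tensD_tm, e', tm_add,
        add_add_add_comm, e, zero_add]
    · rw [map_add, map_add, map_add, map_add, map_add, hx, hy]
      abel

/-- The functor `S ⊗_R -` between homotopy categories of DG modules. -/
def tensorF : DGMod 𝒜 ⥤ DGMod ℬ where
  obj M := S.tensor M
  map {M N} f := (QuotientAddGroup.map (B0 M N) (B0 (S.tensor M) (S.tensor N)) (S.tensorZ M N)
    (S.tensorZ_le M N) : HHom M N →+ HHom (S.tensor M) (S.tensor N)) f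
  map_id M := congrArg cls (Subtype.ext (tens_ext (S := S) fun _ _ => rfl))
  map_comp {M N P} f g := by
    obtain ⟨f, rfl⟩ := cls_surjective f
    obtain ⟨g, rfl⟩ := cls_surjective g
    exact congrArg cls (Subtype.ext (tens_ext (S := S) fun _ _ => rfl))

end DGBimod

end DG

/-! ### Grothendieck groups -/

section K0

universe u v u' v'

variable (C : Type u) [Category.{v} C] [Preadditive C] [Limits.HasZeroObject C] [HasShift C ℤ]
  [∀ n : ℤ, (shiftFunctor C n).Additive] [Pretriangulated C]
  {D : Type u'} [Category.{v'} D] [Preadditive D] [Limits.HasZeroObject D] [HasShift D ℤ]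
  [∀ n : ℤ, (shiftFunctor D n).Additive] [Pretriangulated D]

/-- The relations `[Y] = [X] + [Z]` for the distinguished triangles `X → Y → Z → X[1]`. -/
def K0Rel : AddSubgroup (FreeAbelianGroup C) :=
  AddSubgroup.closure {x | ∃ T ∈ distTriang C,
    x = FreeAbelianGroup.of T.obj₂ - (FreeAbelianGroup.of T.obj₁ + FreeAbelianGroup.of T.obj₃)}

/-- The Grothendieck group of a triangulated category. -/
def K0 : Type u := FreeAbelianGroup C ⧸ K0Rel C

instance : AddCommGroup (K0 C) := inferInstanceAs (AddCommGroup (FreeAbelianGroup C ⧸ K0Rel C))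

variable {C}

/-- The class of an object in the Grothendieck group. -/
def K0.of (X : C) : K0 C := QuotientAddGroup.mk' (K0Rel C) (FreeAbelianGroup.of X)

/-- The map induced by an exact functor on Grothendieck groups. -/
def K0.map (G : C ⥤ D) [G.CommShift ℤ] [G.IsTriangulated] : K0 C →+ K0 D :=
  QuotientAddGroup.map (K0Rel C) (K0Rel D) (FreeAbelianGroup.map G.obj) (by
    refine (AddSubgroup.closure_le _).2 ?_
    rintro _ ⟨T, hT, rfl⟩
    refine AddSubgroup.subset_closure ⟨_, G.map_distinguished T hT, ?_⟩
    simp)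

lemma K0.map_of (G : C ⥤ D) [G.CommShift ℤ] [G.IsTriangulated] (X : C) :
    K0.map G (K0.of X) = K0.of (G.obj X) :=
  congrArg (QuotientAddGroup.mk' (K0Rel D)) (FreeAbelianGroup.map_of_apply X)

end K0

/-! ### Projective modules -/

section Proj

lemma mul_eq_self_of_mem_span {R : Type} [Ring R] {e x : R} (he : e * e = e) (hx : x ∈ Submodule.span R {e}) :
    x * e = x := by
  obtain ⟨r, rfl⟩ := Submodule.mem_span_singleton.1 hx
  rw [smul_eq_mul, mul_assoc, he]

variable {Λ : Type} [AddCommGroup Λ] [DecidableEq Λ] {R : Type} [Ring R] [Algebra (ZMod 2) R]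
  (𝒜 : ℤ × Λ → Submodule (ZMod 2) R) [GradedAlgebra 𝒜]

lemma alg_isInternal : DirectSum.IsInternal fun i => (𝒜 i).toAddSubgroup :=
  DirectSum.Decomposition.isInternal 𝒜

/-- The DG module `R e` with zero differential, for an idempotent `e` of degree zero. -/
@[simps carrier deg d] def projMod (e : R) (he0 : e ∈ 𝒜 0) (he : e * e = e) : DGMod 𝒜 where
  carrier := Submodule.span R {e}
  deg i := (𝒜 i).toAddSubgroup.comap (Submodule.span R {e}).subtype.toAddMonoidHom
  isInternal := by
    let q : R →+ Submodule.span R {e} :=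
      { toFun := fun x => ⟨x * e, Submodule.mem_span_singleton.2 ⟨x, rfl⟩⟩
        map_zero' := Subtype.ext (zero_mul e)
        map_add' := fun x y => Subtype.ext (add_mul x y e) }
    have hq : ∀ i, ∀ x ∈ (𝒜 i).toAddSubgroup, q x ∈
        (𝒜 (id i)).toAddSubgroup.comap (Submodule.span R {e}).subtype.toAddMonoidHom := by
      intro i x hx
      have h : x * e ∈ 𝒜 (i + 0) := SetLike.GradedMul.mul_mem hx he0
      rwa [add_zero] at h
    have hself : ∀ x : Submodule.span R {e}, q x = x :=
      fun x => Subtype.ext (mul_eq_self_of_mem_span he x.2)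
    refine isInternal_mk _ ((pushDec (alg_isInternal 𝒜) (fun i => (𝒜 i).toAddSubgroup.comap
      (Submodule.span R {e}).subtype.toAddMonoidHom) id q hq).comp
        (Submodule.span R {e}).subtype.toAddMonoidHom) (fun x => ?_) (fun i x => ?_)
    · exact (coe_pushDec (alg_isInternal 𝒜) (fun i => (𝒜 i).toAddSubgroup.comap
        (Submodule.span R {e}).subtype.toAddMonoidHom) id q hq _).trans (hself x)
    · exact (pushDec_of (alg_isInternal 𝒜) (fun i => (𝒜 i).toAddSubgroup.comap
        (Submodule.span R {e}).subtype.toAddMonoidHom) id q hq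
          (show x.1.1 ∈ (𝒜 i).toAddSubgroup from x.2)).trans
        (of_congr (ℳ := fun i => (𝒜 i).toAddSubgroup.comap
          (Submodule.span R {e}).subtype.toAddMonoidHom) rfl _ _ (hself x.1))
  smul_mem ha hm := SetLike.GradedMul.mul_mem ha hm
  d := 0
  d_mem _ := zero_mem _
  d_d _ := rfl

end Proj

/-! ### The algebra `A` -/

/-- The set of basis vectors `I, E, F, EF` of `U_T` over `ℤ[T, T⁻¹]`. -/
inductive Bas
  | I | E | F | EF
  deriving DecidableEq

instance : Fintype Bas := ⟨{.I, .E, .F, .EF}, fun x => by cases x <;> decide⟩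

instance : Nonempty Bas := ⟨.I⟩

/-- The element of `U_T` corresponding to a basis vector. -/
def Bas.toUT : Bas → UT
  | I => 1
  | E => UT.E
  | F => UT.F
  | EF => UT.E * UT.F

/-- The generators of `A`. -/
inductive AGen
  | e (γ : Bas)
  | rhoIEF
  | rhoEFI

namespace AGen

/-- A generator, as an element of the free algebra. -/
abbrev v (x : AGen) : FreeAlgebra (ZMod 2) AGen := FreeAlgebra.ι (ZMod 2) x

/-- The degree `(deg_h, deg_t)` of the generators. -/
def wt : AGen → ℤ × ℤ
  | e _ => (0, 0)
  | rhoIEF => (0, 0)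
  | rhoEFI => (1, 1)

end AGen

open AGen in
/-- The defining relations of `A`. -/
inductive ARel : FreeAlgebra (ZMod 2) AGen → FreeAlgebra (ZMod 2) AGen → Prop
  | one : ARel (∑ γ, v (e γ)) 1
  | idem (γ : Bas) : ARel (v (e γ) * v (e γ)) (v (e γ))
  | orth (γ γ' : Bas) (h : γ ≠ γ') : ARel (v (e γ) * v (e γ')) 0
  | src_IEF : ARel (v (e .I) * v rhoIEF) (v rhoIEF)
  | tgt_IEF : ARel (v rhoIEF * v (e .EF)) (v rhoIEF)
  | src_EFI : ARel (v (e .EF) * v rhoEFI) (v rhoEFI)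
  | tgt_EFI : ARel (v rhoEFI * v (e .I)) (v rhoEFI)
  | rho_rho : ARel (v rhoIEF * v rhoEFI) 0

lemma ARel.homogeneous : Homogeneous AGen.wt ARel := by
  have g := fun x : AGen => freeDeg_gen (k := ZMod 2) AGen.wt x
  have m := fun x y : AGen => freeDeg_mul (k := ZMod 2) AGen.wt (g x) (g y)
  rintro _ _ (_ | γ | ⟨γ, γ', h⟩ | _ | _ | _ | _ | _)
  · exact ⟨0, Submodule.sum_mem _ fun γ _ => g (.e γ), freeDeg_one _⟩
  · exact ⟨_, m _ _, g (.e γ)⟩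
  · exact ⟨_, m _ _, zero_mem _⟩
  · exact ⟨_, m _ _, g .rhoIEF⟩
  · exact ⟨_, m _ _, g .rhoIEF⟩
  · exact ⟨_, m _ _, g .rhoEFI⟩
  · exact ⟨_, m _ _, g .rhoEFI⟩
  · exact ⟨_, m _ _, zero_mem _⟩

/-- The `t`-graded algebra `A` over the field with two elements. -/
def AlgA : Type := RingQuot ARel

instance : Ring AlgA := inferInstanceAs (Ring (RingQuot ARel))

instance : Algebra (ZMod 2) AlgA := inferInstanceAs (Algebra (ZMod 2) (RingQuot ARel))

namespace AlgA

/-- The quotient map from the free algebra onto `A`. -/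
def mk : FreeAlgebra (ZMod 2) AGen →ₐ[ZMod 2] AlgA := RingQuot.mkAlgHom (ZMod 2) ARel

lemma mk_rel {a b : FreeAlgebra (ZMod 2) AGen} (h : ARel a b) : mk a = mk b :=
  RingQuot.mkAlgHom_rel (ZMod 2) h

/-- The grading `(deg_h, deg_t)` of `A`. -/
def deg : ℤ × ℤ → Submodule (ZMod 2) AlgA := presDeg AGen.wt ARel

instance : GradedAlgebra deg := presGraded AGen.wt ARel ARel.homogeneous

/-- The idempotent `e(γ)` of `A`. -/
def e (γ : Bas) : AlgA := mk (AGen.v (.e γ))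

lemma e_mem (γ : Bas) : e γ ∈ deg 0 := gen_mem AGen.wt ARel (.e γ)

lemma e_mul_e (γ : Bas) : e γ * e γ = e γ := by
  simpa only [map_mul, e] using mk_rel (ARel.idem γ)

/-- The projective DG module `P(γ) = A e(γ)`. -/
def P (γ : Bas) : DGMod deg := projMod deg (e γ) (e_mem γ) (e_mul_e γ)

end AlgA

/-! ### The algebra `B` -/

/-- The arrows of the quiver of `B`; its vertices are the pairs `γ₁ ⊗ γ₂` of elements of `Bas`. -/
inductive BArr
  /-- `I ⊗ γ → EF ⊗ γ` -/
  | upL (γ : Bas)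
  /-- `EF ⊗ γ → I ⊗ γ` -/
  | downL (γ : Bas)
  /-- `γ ⊗ I → γ ⊗ EF` -/
  | upR (γ : Bas)
  /-- `γ ⊗ EF → γ ⊗ I` -/
  | downR (γ : Bas)
  /-- `E ⊗ I → I ⊗ E` -/
  | EI_IE
  /-- `E ⊗ F → I ⊗ EF` -/
  | EF_IEF
  /-- `EF ⊗ I → F ⊗ E` -/
  | EFI_FE
  /-- `I ⊗ F → F ⊗ I` -/
  | IF_FI

namespace BArr

/-- The source of an arrow. -/
def src : BArr → Bas × Bas
  | upL γ => (.I, γ)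
  | downL γ => (.EF, γ)
  | upR γ => (γ, .I)
  | downR γ => (γ, .EF)
  | EI_IE => (.E, .I)
  | EF_IEF => (.E, .F)
  | EFI_FE => (.EF, .I)
  | IF_FI => (.I, .F)

/-- The target of an arrow. -/
def tgt : BArr → Bas × Bas
  | upL γ => (.EF, γ)
  | downL γ => (.I, γ)
  | upR γ => (γ, .EF)
  | downR γ => (γ, .I)
  | EI_IE => (.I, .E)
  | EF_IEF => (.I, .EF)
  | EFI_FE => (.F, .E)
  | IF_FI => (.F, .I)

/-- The degree `(deg_h; deg_{t₁}, deg_{t₂})` of an arrow. -/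
def wt : BArr → ℤ × ℤ × ℤ
  | upL _ => (0, 0, 0)
  | downL _ => (1, 1, 0)
  | upR _ => (0, 0, 0)
  | downR _ => (1, 0, 1)
  | EI_IE => (1, 0, 0)
  | EF_IEF => (1, 0, 0)
  | EFI_FE => (0, 0, 0)
  | IF_FI => (1, 0, 1)

end BArr

/-- The generators of `B`: the idempotents `e(γ₁ ⊗ γ₂)` and the arrows. -/
inductive BGen
  | e (p : Bas × Bas)
  | rho (a : BArr)

namespace BGen

/-- The idempotent at a vertex, as an element of the free algebra. -/
abbrev ev (p : Bas × Bas) : FreeAlgebra (ZMod 2) BGen := FreeAlgebra.ι (ZMod 2) (e p)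

/-- An arrow, as an element of the free algebra. -/
abbrev rv (a : BArr) : FreeAlgebra (ZMod 2) BGen := FreeAlgebra.ι (ZMod 2) (rho a)

/-- The degree of the generators. -/
def wt : BGen → ℤ × ℤ × ℤ
  | e _ => (0, 0, 0)
  | rho a => a.wt

end BGen

open BGen BArr in
/-- The defining relations of `B`. -/
inductive BRel : FreeAlgebra (ZMod 2) BGen → FreeAlgebra (ZMod 2) BGen → Prop
  | one : BRel (∑ p, ev p) 1
  | idem (p : Bas × Bas) : BRel (ev p * ev p) (ev p)
  | orth (p q : Bas × Bas) (h : p ≠ q) : BRel (ev p * ev q) 0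
  | src_mul (a : BArr) : BRel (ev a.src * rv a) (rv a)
  | mul_tgt (a : BArr) : BRel (rv a * ev a.tgt) (rv a)
  | upL_downL (γ : Bas) : BRel (rv (upL γ) * rv (downL γ)) 0
  | upR_downR (γ : Bas) : BRel (rv (upR γ) * rv (downR γ)) 0
  | downR_EI_IE : BRel (rv (downR .E) * rv EI_IE) 0
  | EI_IE_upL : BRel (rv EI_IE * rv (upL .E)) 0
  | comm₁ : BRel (rv (upR .I) * rv (upL .EF)) (rv (upL .I) * rv (upR .EF))
  | comm₂ : BRel (rv (downR .I) * rv (upL .I)) (rv (upL .EF) * rv (downR .EF))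
  | comm₃ : BRel (rv (downL .I) * rv (upR .I)) (rv (upR .EF) * rv (downL .EF))
  | comm₄ : BRel (rv (downL .EF) * rv (downR .I)) (rv (downR .EF) * rv (downL .I))
  | EF_IEF_upL : BRel (rv EF_IEF * rv (upL .EF)) 0
  | downR_EFI_FE : BRel (rv (downR .EF) * rv EFI_FE) 0
  | downL_IF_FI : BRel (rv (downL .F) * rv IF_FI) 0
  | IF_FI_upR : BRel (rv IF_FI * rv (upR .F)) 0

lemma BRel.homogeneous : Homogeneous BGen.wt BRel := by
  have g := fun x : BGen => freeDeg_gen (k := ZMod 2) BGen.wt x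
  have m := fun x y : BGen => freeDeg_mul (k := ZMod 2) BGen.wt (g x) (g y)
  have m' := fun (x y : BGen) (i : ℤ × ℤ × ℤ) (h : x.wt + y.wt = i) => h ▸ m x y
  rintro _ _ (_ | p | ⟨p, q, h⟩ | a | a | γ | γ | _ | _ | _ | _ | _ | _ | _ | _ | _ | _)
  · exact ⟨0, Submodule.sum_mem _ fun p _ => g (.e p), freeDeg_one _⟩
  · exact ⟨_, m _ _, g (.e p)⟩
  · exact ⟨_, m _ _, zero_mem _⟩
  · exact ⟨_, m' (.e a.src) (.rho a) _ (zero_add _), g (.rho a)⟩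
  · exact ⟨_, m' (.rho a) (.e a.tgt) _ (add_zero _), g (.rho a)⟩
  · exact ⟨_, m _ _, zero_mem _⟩
  · exact ⟨_, m _ _, zero_mem _⟩
  · exact ⟨_, m _ _, zero_mem _⟩
  · exact ⟨_, m _ _, zero_mem _⟩
  · exact ⟨0, m' _ _ _ rfl, m' _ _ _ rfl⟩
  · exact ⟨(1, 0, 1), m' _ _ _ rfl, m' _ _ _ rfl⟩
  · exact ⟨(1, 1, 0), m' _ _ _ rfl, m' _ _ _ rfl⟩
  · exact ⟨(2, 1, 1), m' _ _ _ rfl, m' _ _ _ rfl⟩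
  · exact ⟨_, m _ _, zero_mem _⟩
  · exact ⟨_, m _ _, zero_mem _⟩
  · exact ⟨_, m _ _, zero_mem _⟩
  · exact ⟨_, m _ _, zero_mem _⟩

/-- The `(t₁, t₂)`-graded algebra `B` over the field with two elements. -/
def AlgB : Type := RingQuot BRel

instance : Ring AlgB := inferInstanceAs (Ring (RingQuot BRel))

instance : Algebra (ZMod 2) AlgB := inferInstanceAs (Algebra (ZMod 2) (RingQuot BRel))

namespace AlgB

/-- The quotient map from the free algebra onto `B`. -/
def mk : FreeAlgebra (ZMod 2) BGen →ₐ[ZMod 2] AlgB := RingQuot.mkAlgHom (ZMod 2) BRel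

lemma mk_rel {a b : FreeAlgebra (ZMod 2) BGen} (h : BRel a b) : mk a = mk b :=
  RingQuot.mkAlgHom_rel (ZMod 2) h

/-- The grading `(deg_h; deg_{t₁}, deg_{t₂})` of `B`. -/
def deg : ℤ × ℤ × ℤ → Submodule (ZMod 2) AlgB := presDeg BGen.wt BRel

instance : GradedAlgebra deg := presGraded BGen.wt BRel BRel.homogeneous

/-- The idempotent `e(γ₁ ⊗ γ₂)` of `B`. -/
def e (p : Bas × Bas) : AlgB := mk (BGen.ev p)

/-- The generator of `B` given by an arrow. -/
def rho (a : BArr) : AlgB := mk (BGen.rv a)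

lemma e_mem (p : Bas × Bas) : e p ∈ deg 0 := gen_mem BGen.wt BRel (.e p)

lemma rho_mem (a : BArr) : rho a ∈ deg a.wt := gen_mem BGen.wt BRel (.rho a)

lemma e_mul_e (p : Bas × Bas) : e p * e p = e p := by
  simpa only [map_mul, e] using mk_rel (BRel.idem p)

lemma rho_mul_e (a : BArr) : rho a * e a.tgt = rho a := by
  simpa only [map_mul, e, rho] using mk_rel (BRel.mul_tgt a)

/-- The projective DG module `P(γ₁ ⊗ γ₂) = B e(γ₁ ⊗ γ₂)`. -/
def P (p : Bas × Bas) : DGMod deg := projMod deg (e p) (e_mem p) (e_mul_e p)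

end AlgB

/-! ### The bimodule `S` -/

/-- The generators over `B` of the module `S = S(I) ⊕ S(E) ⊕ S(F) ⊕ S(EF)`. -/
inductive SGen
  /-- `m(I ⊗ I)` in `S(I)` -/
  | I_II
  /-- `m(E ⊗ I)` in `S(E)` -/
  | E_EI
  /-- `m(I ⊗ E)` in `S(E)` -/
  | E_IE
  /-- `m(I ⊗ F)` in `S(F)` -/
  | F_IF
  /-- `m(F ⊗ I)` in `S(F)` -/
  | F_FI
  /-- `m(E ⊗ F)` in `S(EF)` -/
  | EF_EF
  /-- `m(I ⊗ EF)` in `S(EF)` -/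
  | EF_IEF
  /-- `m(EF ⊗ I)` in `S(EF)` -/
  | EF_EFI
  /-- `m(F ⊗ E)` in `S(EF)` -/
  | EF_FE
  deriving DecidableEq

namespace SGen

instance : Fintype SGen :=
  ⟨{I_II, E_EI, E_IE, F_IF, F_FI, EF_EF, EF_IEF, EF_EFI, EF_FE}, fun x => by cases x <;> decide⟩

/-- The `γ` for which a generator lies in `S(γ)`. -/
def comp : SGen → Bas
  | I_II => .I
  | E_EI | E_IE => .E
  | F_IF | F_FI => .F
  | EF_EF | EF_IEF | EF_EFI | EF_FE => .EF

/-- The vertex `γ₁ ⊗ γ₂` for which a generator generates a summand `P(γ₁ ⊗ γ₂)`. -/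
def vertex : SGen → Bas × Bas
  | I_II => (.I, .I)
  | E_EI => (.E, .I)
  | E_IE => (.I, .E)
  | F_IF => (.I, .F)
  | F_FI => (.F, .I)
  | EF_EF => (.E, .F)
  | EF_IEF => (.I, .EF)
  | EF_EFI => (.EF, .I)
  | EF_FE => (.F, .E)

/-- The shift of the summand of a generator: `0`, or `{0,1}` for `P(F ⊗ I)` in `S(F)` and for
`P(EF ⊗ I)` in `S(EF)`, or `{0,1}[-1]` for `P(F ⊗ E)` in `S(EF)`. -/
def shift : SGen → ℤ × ℤ × ℤ
  | I_II | E_EI | E_IE | F_IF | EF_EF | EF_IEF => (0, 0, 0)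
  | F_FI | EF_EFI => (0, 0, 1)
  | EF_FE => (-1, 0, 1)

end SGen

namespace S

open SGen BArr AlgB MulOpposite

/-- The summand of a generator. -/
abbrev Summand (g : SGen) : DGMod deg := (P g.vertex).shift g.shift

/-- The left `B`-module `S`. -/
abbrev Car : Type := ∀ g, Summand g

/-- The grading of `S`. -/
def grad (i : ℤ × ℤ × ℤ) : AddSubgroup Car :=
  AddSubgroup.pi Set.univ fun g => (Summand g).deg i

lemma grad_isInternal : DirectSum.IsInternal grad :=
  isInternal_pi fun g => (Summand g).isInternal

/-- The element of `B` given by an element of a summand. -/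
def coe (g : SGen) : Summand g →ₗ[AlgB] AlgB := (Submodule.span AlgB {e g.vertex}).subtype

/-- The generator `m(γ₁ ⊗ γ₂)` of a summand. -/
def m (g : SGen) : Summand g :=
  (⟨e g.vertex, Submodule.mem_span_singleton_self _⟩ : Submodule.span AlgB {e g.vertex})

lemma coe_m (g : SGen) : coe g (m g) = e g.vertex := rfl

lemma coe_inj (g : SGen) : Function.Injective (coe g) := Subtype.val_injective

lemma coe_mul_e (g : SGen) (x : Summand g) : coe g x * e g.vertex = coe g x :=
  mul_eq_self_of_mem_span (e_mul_e _)
    (show coe g x ∈ Submodule.span AlgB {e g.vertex} from Subtype.prop _)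

lemma mem_deg (g : SGen) (i : ℤ × ℤ × ℤ) (x : Summand g) :
    x ∈ (Summand g).deg i ↔ coe g x ∈ deg (i + g.shift) := Iff.rfl

lemma mem_grad (i : ℤ × ℤ × ℤ) (x : Car) : x ∈ grad i ↔ ∀ g, coe g (x g) ∈ deg (i + g.shift) :=
  ⟨fun h g => h g trivial, fun h g _ => h g⟩

lemma car_ext {x y : Car} (h : ∀ g, coe g (x g) = coe g (y g)) : x = y :=
  funext fun g => coe_inj g (h g)

/-- The `B`-linear map `S → S` which sends the generator `m g` to `b • m g'` and all other
generators to zero (for `b` in `e (vertex g) B`). -/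
def el (g g' : SGen) (b : AlgB) : Module.End AlgB Car :=
  LinearMap.single AlgB (fun g => Summand g) g' ∘ₗ
    LinearMap.toSpanSingleton AlgB (Summand g') (b • m g') ∘ₗ
      coe g ∘ₗ LinearMap.proj (φ := fun g => Summand g) g

lemma el_apply (g g' : SGen) (b : AlgB) (x : Car) :
    el g g' b x = Pi.single g' (coe g (x g) • b • m g') := rfl

lemma coe_el (g g' : SGen) (b : AlgB) (x : Car) (h : SGen) :
    coe h (el g g' b x h) = if h = g' then coe g (x g) * (b * e g'.vertex) else 0 := by
  rw [el_apply]
  split_ifs with hh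
  · subst hh
    rw [Pi.single_eq_same, map_smul, map_smul, coe_m]
    rfl
  · rw [Pi.single_eq_of_ne hh, map_zero]

/-- The projection of `S` onto `S(γ)`. -/
def proj (γ : Bas) : Module.End AlgB Car :=
  LinearMap.pi fun g => if g.comp = γ then LinearMap.proj (φ := fun g => Summand g) g else 0

lemma coe_proj (γ : Bas) (x : Car) (h : SGen) :
    coe h (proj γ x h) = if h.comp = γ then coe h (x h) else 0 := by
  have : proj γ x h = (if h.comp = γ then LinearMap.proj (φ := fun g => Summand g) h else 0) x := rfl
  rw [this]
  split_ifs <;> rfl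

lemma el_mul_el (g h h' : SGen) (b c : AlgB) (hc : e h.vertex * c = c) :
    el h h' c * el g h b = el g h' (b * c) := by
  refine LinearMap.ext fun x => car_ext fun k => ?_
  rw [Module.End.mul_apply, coe_el, coe_el, if_pos rfl, coe_el]
  split_ifs
  · rw [mul_assoc, mul_assoc b, ← mul_assoc (e _), hc, mul_assoc b]
  · rfl

lemma el_mul_el_of_ne (g : SGen) {g' h : SGen} (h' : SGen) (b c : AlgB) (hh : h ≠ g') :
    el h h' c * el g g' b = 0 := by
  refine LinearMap.ext fun x => car_ext fun k => ?_
  rw [Module.End.mul_apply, coe_el, coe_el, if_neg hh, zero_mul, ite_self]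
  rfl

lemma el_zero (g g' : SGen) : el g g' 0 = 0 :=
  LinearMap.ext fun x => car_ext fun k => by
    rw [coe_el, zero_mul, mul_zero, ite_self]; rfl

lemma proj_mul_el (γ : Bas) (g g' : SGen) (b : AlgB) :
    proj γ * el g g' b = if g'.comp = γ then el g g' b else 0 := by
  refine LinearMap.ext fun x => car_ext fun k => ?_
  rw [Module.End.mul_apply, coe_proj, coe_el]
  by_cases hh : k = g'
  · subst hh
    rw [if_pos rfl]
    split_ifs
    · rw [coe_el, if_pos rfl]
    · rfl
  · rw [if_neg hh, ite_self]
    split_ifs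
    · rw [coe_el, if_neg hh]
    · rfl

lemma el_mul_proj (γ : Bas) (g g' : SGen) (b : AlgB) :
    el g g' b * proj γ = if g.comp = γ then el g g' b else 0 := by
  refine LinearMap.ext fun x => car_ext fun k => ?_
  rw [Module.End.mul_apply, coe_el, coe_proj]
  by_cases hh : g.comp = γ
  · rw [if_pos hh, if_pos hh, coe_el]
  · rw [if_neg hh, if_neg hh, zero_mul, ite_self]
    rfl

lemma proj_mul_proj (γ γ' : Bas) : proj γ * proj γ' = if γ = γ' then proj γ else 0 := by
  refine LinearMap.ext fun x => car_ext fun k => ?_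
  rw [Module.End.mul_apply, coe_proj, coe_proj]
  by_cases hh : γ = γ'
  · subst hh
    rw [if_pos rfl, coe_proj]
    split_ifs <;> rfl
  · rw [if_neg hh]
    split_ifs with h1 h2
    · exact absurd (h1.symm.trans h2) hh
    · rfl
    · rfl

lemma sum_proj : ∑ γ, proj γ = 1 := by
  refine LinearMap.ext fun x => car_ext fun k => ?_
  rw [LinearMap.sum_apply, Finset.sum_apply, map_sum, Finset.sum_congr rfl fun γ _ => coe_proj γ x k,
    Finset.sum_ite_eq, if_pos (Finset.mem_univ _)]
  rfl

lemma el_mem {g g' : SGen} {b : AlgB} {c j w : ℤ × ℤ × ℤ} (hb : b ∈ deg w)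
    (hw : c + g'.shift = w + g.shift) {x : Car} (hx : x ∈ grad j) : el g g' b x ∈ grad (j + c) := by
  refine (mem_grad _ _).2 fun k => ?_
  rw [coe_el]
  split_ifs with hh
  · subst hh
    have h1 : coe g (x g) * (b * e k.vertex) ∈
        deg ((j + g.shift) + (w + 0)) :=
      SetLike.GradedMul.mul_mem ((mem_grad _ _).1 hx g) (SetLike.GradedMul.mul_mem hb (e_mem _))
    have e1 : (j + g.shift) + (w + 0) = j + c + k.shift := by
      rw [add_zero, add_assoc j c, hw]
      abel
    rwa [e1] at h1
  · exact zero_mem _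

lemma proj_mem (γ : Bas) {j : ℤ × ℤ × ℤ} {x : Car} (hx : x ∈ grad j) : proj γ x ∈ grad j := by
  refine (mem_grad _ _).2 fun k => ?_
  rw [coe_proj]
  split_ifs
  · exact (mem_grad _ _).1 hx k
  · exact zero_mem _

/-- The differential of `S`. -/
def d : Module.End AlgB Car :=
  el E_EI E_IE (rho EI_IE) +
  el F_IF F_FI (rho IF_FI) +
  (el EF_EF EF_IEF (rho BArr.EF_IEF) +
    el EF_IEF EF_EFI (rho (upL .EF) * rho (downR .EF)) +
    el EF_EFI EF_FE (rho EFI_FE))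

lemma e_mul_rho (a : BArr) {p : Bas × Bas} (h : a.src = p) : e p * rho a = rho a := by
  subst h
  simpa only [map_mul, e, rho] using mk_rel (BRel.src_mul a)

lemma e_mul_rho_mul (a : BArr) {p : Bas × Bas} (h : a.src = p) (b : AlgB) :
    e p * (rho a * b) = rho a * b := by
  rw [← mul_assoc, e_mul_rho a h]

lemma rel_comm₁ : rho (upR .I) * rho (upL .EF) = rho (upL .I) * rho (upR .EF) := by
  simpa only [map_mul, rho] using mk_rel BRel.comm₁

lemma rel_comm₄ : rho (downL .EF) * rho (downR .I) = rho (downR .EF) * rho (downL .I) := by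
  simpa only [map_mul, rho] using mk_rel BRel.comm₄

lemma rel_upL_downL (γ : Bas) : rho (upL γ) * rho (downL γ) = 0 := by
  simpa only [map_mul, map_zero, rho] using mk_rel (BRel.upL_downL γ)

lemma rel_upR_downR (γ : Bas) : rho (upR γ) * rho (downR γ) = 0 := by
  simpa only [map_mul, map_zero, rho] using mk_rel (BRel.upR_downR γ)

lemma rel_EF_IEF_upL : rho BArr.EF_IEF * rho (upL .EF) = 0 := by
  simpa only [map_mul, map_zero, rho] using mk_rel BRel.EF_IEF_upL

lemma rel_downR_EFI_FE : rho (downR .EF) * rho EFI_FE = 0 := by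
  simpa only [map_mul, map_zero, rho] using mk_rel BRel.downR_EFI_FE

lemma d_mul_d : d * d = 0 := by
  have h1 : el EF_IEF EF_EFI (rho (upL .EF) * rho (downR .EF)) *
      el EF_EF EF_IEF (rho BArr.EF_IEF) = 0 := by
    rw [el_mul_el _ _ _ _ _ (e_mul_rho_mul (upL .EF) rfl _), ← mul_assoc, rel_EF_IEF_upL, zero_mul, el_zero]
  have h2 : el EF_EFI EF_FE (rho EFI_FE) *
      el EF_IEF EF_EFI (rho (upL .EF) * rho (downR .EF)) = 0 := by
    rw [el_mul_el _ _ _ _ _ (e_mul_rho _ rfl), mul_assoc, rel_downR_EFI_FE, mul_zero, el_zero]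
  simp [d, add_mul, mul_add, h1, h2, el_mul_el_of_ne]

lemma d_mem {i : ℤ × ℤ × ℤ} {x : Car} (hx : x ∈ grad i) : d x ∈ grad (i + (1, 0)) := by
  have h : rho (upL .EF) * rho (downR .EF) ∈ deg ((upL .EF).wt + (downR .EF).wt) :=
    SetLike.GradedMul.mul_mem (rho_mem _) (rho_mem _)
  have h1 := el_mem (c := (1, 0)) (g := E_EI) (g' := E_IE) (rho_mem EI_IE) (by decide) hx
  have h2 := el_mem (c := (1, 0)) (g := F_IF) (g' := F_FI) (rho_mem IF_FI) (by decide) hx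
  have h3 := el_mem (c := (1, 0)) (g := EF_EF) (g' := EF_IEF) (rho_mem .EF_IEF) (by decide) hx
  have h4 := el_mem (c := (1, 0)) (g := EF_IEF) (g' := EF_EFI) h (by decide) hx
  have h5 := el_mem (c := (1, 0)) (g := EF_EFI) (g' := EF_FE) (rho_mem EFI_FE) (by decide) hx
  exact add_mem (add_mem h1 h2) (add_mem (add_mem h3 h4) h5)

instance (g : SGen) : Module (ZMod 2) (Summand g) :=
  Module.compHom _ (algebraMap (ZMod 2) AlgB)

instance (g : SGen) : IsScalarTower (ZMod 2) AlgB (Summand g) where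
  smul_assoc c b x := by
    rw [Algebra.smul_def, mul_smul]; rfl

instance (g : SGen) : SMulCommClass AlgB (ZMod 2) (Summand g) where
  smul_comm b c x := by
    change b • (algebraMap (ZMod 2) AlgB c) • x = (algebraMap (ZMod 2) AlgB c) • b • x
    rw [← mul_smul, ← mul_smul, Algebra.commutes]

/-- The right multiplication by a generator of `A`. -/
def rgen : AGen → Module.End AlgB Car
  | .e γ => proj γ
  | .rhoIEF => el I_II EF_IEF (rho (upR .I))
  | .rhoEFI => el EF_EFI I_II (rho (downL .I))

lemma rgen_rel ⦃a b : FreeAlgebra (ZMod 2) AGen⦄ (h : ARel a b) :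
    FreeAlgebra.lift (ZMod 2) (fun x => op (rgen x)) a =
      FreeAlgebra.lift (ZMod 2) (fun x => op (rgen x)) b := by
  rcases h with _ | γ | ⟨γ, γ', h⟩ | _ | _ | _ | _ | _ <;>
    simp only [map_sum, map_mul, map_one, map_zero, FreeAlgebra.lift_ι_apply, ← op_mul]
  · rw [← Finset.op_sum]; exact congrArg op sum_proj
  · exact congrArg op ((proj_mul_proj γ γ).trans (if_pos rfl))
  · exact congrArg op ((proj_mul_proj γ' γ).trans (if_neg (Ne.symm h)))
  · exact congrArg op ((el_mul_proj ..).trans (if_pos rfl))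
  · exact congrArg op ((proj_mul_el ..).trans (if_pos rfl))
  · exact congrArg op ((el_mul_proj ..).trans (if_pos rfl))
  · exact congrArg op ((proj_mul_el ..).trans (if_pos rfl))
  · exact congrArg op (el_mul_el_of_ne _ _ _ _ (by decide))

/-- The right action of `A` on `S`. -/
def ract : AlgA →ₐ[ZMod 2] (Module.End AlgB Car)ᵐᵒᵖ :=
  RingQuot.liftAlgHom (ZMod 2) ⟨FreeAlgebra.lift (ZMod 2) fun x => op (rgen x), rgen_rel⟩

lemma ract_mk (a : FreeAlgebra (ZMod 2) AGen) :
    ract (AlgA.mk a) = FreeAlgebra.lift (ZMod 2) (fun x => op (rgen x)) a :=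
  RingQuot.liftAlgHom_mkAlgHom_apply ..

lemma ract_gen (x : AGen) : ract (AlgA.mk (FreeAlgebra.ι _ x)) = op (rgen x) :=
  (ract_mk _).trans (FreeAlgebra.lift_ι_apply _ _)

instance : Module AlgAᵐᵒᵖ Car where
  smul a x := (ract a.unop).unop x
  one_smul x := by
    change (ract 1).unop x = x
    rw [map_one]; rfl
  mul_smul a b x := by
    change (ract (b.unop * a.unop)).unop x = (ract a.unop).unop ((ract b.unop).unop x)
    rw [map_mul]; rfl
  smul_zero a := map_zero _
  smul_add a := map_add _
  add_smul a b x := by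
    change (ract (a.unop + b.unop)).unop x = (ract a.unop).unop x + (ract b.unop).unop x
    rw [map_add]; rfl
  zero_smul x := by
    change (ract 0).unop x = 0
    rw [map_zero]; rfl

lemma op_smul_def (a : AlgA) (x : Car) : op a • x = (ract a).unop x := rfl

instance : SMulCommClass AlgB AlgAᵐᵒᵖ Car where
  smul_comm b a x := ((ract a.unop).unop.map_smul b x).symm

lemma d_mul_rgen (x : AGen) : d * rgen x = rgen x * d := by
  rcases x with γ | _ | _
  · change d * proj γ = proj γ * d
    simp only [d, add_mul, mul_add, el_mul_proj, proj_mul_el]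
    rfl
  · change d * el I_II EF_IEF (rho (upR .I)) = el I_II EF_IEF (rho (upR .I)) * d
    have h : el EF_IEF EF_EFI (rho (upL .EF) * rho (downR .EF)) *
        el I_II EF_IEF (rho (upR .I)) = 0 := by
      rw [el_mul_el _ _ _ _ _ (e_mul_rho_mul (upL .EF) rfl _), ← mul_assoc, rel_comm₁, mul_assoc,
        rel_upR_downR, mul_zero, el_zero]
    simp [d, add_mul, mul_add, h, el_mul_el_of_ne]
  · change d * el EF_EFI I_II (rho (downL .I)) = el EF_EFI I_II (rho (downL .I)) * d
    have h : el EF_EFI I_II (rho (downL .I)) *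
        el EF_IEF EF_EFI (rho (upL .EF) * rho (downR .EF)) = 0 := by
      rw [el_mul_el _ _ _ _ _ (e_mul_rho _ rfl), mul_assoc, ← rel_comm₄, ← mul_assoc,
        rel_upL_downL, zero_mul, el_zero]
    simp [d, add_mul, mul_add, h, el_mul_el_of_ne]

lemma d_ract (a : AlgA) : d * (ract a).unop = (ract a).unop * d := by
  obtain ⟨a, rfl⟩ := RingQuot.mkAlgHom_surjective (ZMod 2) ARel a
  change d * (ract (AlgA.mk a)).unop = (ract (AlgA.mk a)).unop * d
  induction a using FreeAlgebra.induction with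
  | grade0 r =>
    rw [AlgHom.commutes, AlgHom.commutes]
    exact (Algebra.commutes r d).symm
  | grade1 x => rw [ract_gen]; exact d_mul_rgen x
  | mul a b ha hb =>
    rw [map_mul, map_mul, unop_mul, ← mul_assoc, hb, mul_assoc, ha, mul_assoc]
  | add a b ha hb => rw [map_add, map_add, MulOpposite.unop_add, mul_add, add_mul, ha, hb]

/-- The homomorphism `t ↦ (t, t)` by which the degrees in `A` act on the degrees in `S`. -/
def φ : ℤ →+ ℤ × ℤ := (AddMonoidHom.id ℤ).prod (AddMonoidHom.id ℤ)

lemma rgen_mem (x : AGen) {j : ℤ × ℤ × ℤ} {s : Car} (hs : s ∈ grad j) :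
    rgen x s ∈ grad (j + (x.wt.1, φ x.wt.2)) := by
  rcases x with γ | _ | _
  · have h := proj_mem γ hs
    rw [← add_zero j] at h
    exact h
  · exact el_mem (rho_mem (upR .I)) (by decide) hs
  · exact el_mem (rho_mem (downL .I)) (by decide) hs

lemma ract_mem {i : ℤ × ℤ} {j : ℤ × ℤ × ℤ} {a : AlgA} {s : Car} (ha : a ∈ AlgA.deg i)
    (hs : s ∈ grad j) : op a • s ∈ grad (j + (i.1, φ i.2)) := by
  obtain ⟨a, ha, rfl⟩ := ha
  change (ract (AlgA.mk a)).unop s ∈ _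
  refine Submodule.span_induction (p := fun a _ => (ract (AlgA.mk a)).unop s ∈
    grad (j + (i.1, φ i.2))) ?_ ?_ (fun a b _ _ h1 h2 => ?_) (fun c a _ h => ?_) ha
  · rintro _ ⟨l, rfl, rfl⟩
    clear ha
    induction l generalizing j s with
    | nil =>
      have e : AlgA.mk (List.map (FreeAlgebra.ι (ZMod 2)) ([] : List AGen)).prod = 1 := map_one _
      rw [e, map_one]
      have h := hs
      rw [← add_zero j] at h
      exact h
    | cons x l ih =>
      have e : AlgA.mk (List.map (FreeAlgebra.ι (ZMod 2)) (x :: l)).prod =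
          AlgA.mk (FreeAlgebra.ι _ x) * AlgA.mk (List.map (FreeAlgebra.ι (ZMod 2)) l).prod :=
        (congrArg AlgA.mk List.prod_cons).trans (map_mul _ _ _)
      have e' : (List.map AGen.wt (x :: l)).sum = x.wt + (List.map AGen.wt l).sum := List.sum_cons
      rw [e, e', map_mul, ract_gen]
      have h := ih (rgen_mem x hs)
      have e'' : (x.wt.1, φ x.wt.2) +
          ((List.map AGen.wt l).sum.1, φ (List.map AGen.wt l).sum.2) =
          ((x.wt + (List.map AGen.wt l).sum).1, φ (x.wt + (List.map AGen.wt l).sum).2) :=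
        Prod.ext rfl (map_add φ _ _).symm
      rw [add_assoc, e''] at h
      exact h
  · rw [map_zero, map_zero]; exact zero_mem _
  · rw [map_add, map_add]; exact add_mem h1 h2
  · rcases (show c = 0 ∨ c = 1 by revert c; decide) with rfl | rfl
    · rw [zero_smul, map_zero, map_zero]; exact zero_mem _
    · rwa [one_smul]

end S

/-- The DG `(B, A)`-bimodule `S`. -/
def S : DGBimod AlgB.deg AlgA.deg S.φ where
  carrier := S.Car
  deg := S.grad
  isInternal := S.grad_isInternal
  smul_mem {i j a x} ha hx := (S.mem_grad _ _).2 fun g => by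
    have h : a * S.coe g (x g) ∈ AlgB.deg (i + (j + g.shift)) :=
      SetLike.GradedMul.mul_mem ha ((S.mem_grad _ _).1 hx g)
    rwa [← add_assoc] at h
  d := S.d
  d_mem := S.d_mem
  d_d x := LinearMap.congr_fun S.d_mul_d x
  rsmul_mem := S.ract_mem
  d_rsmul a x := LinearMap.congr_fun (S.d_ract a) x

/-! ### The categories `HP(A)`, `HP(B)` and the functor `δ` -/

section HPObj

variable {Λ : Type} [AddCommGroup Λ] [DecidableEq Λ] {R : Type} [Ring R] [Algebra (ZMod 2) R]
  {𝒜 : ℤ × Λ → Submodule (ZMod 2) R} {V : Type} {P : V → DGMod 𝒜}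

/-- The object `P v` of `HP P`. -/
def HP.gen (P : V → DGMod 𝒜) (v : V) : HP P := ⟨P v, .proj v⟩

/-- The object `M{l}` of `HP P`. -/
def HP.twist (M : HP P) (l : Λ) : HP P := ⟨M.obj.shift (0, l), .shift (0, l) M.property⟩

end HPObj

/-- The zeroth homology category of `DGP(A)`. -/
abbrev HPA : Type 1 := HP AlgA.P

/-- The zeroth homology category of `DGP(B)`. -/
abbrev HPB : Type 1 := HP AlgB.P

/-- The functor `δ = S ⊗_A -` from `HP(A)` to `HP(B)`, once `S ⊗_A -` is known to take the objects
of `HP(A)` to objects of `HP(B)`. -/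
def delta (hS : ∀ M : HPA, IsDGP AlgB.P (S.tensor M.obj)) : HPA ⥤ HPB :=
  (IsDGP AlgB.P).lift ((IsDGP AlgA.P).ι ⋙ S.tensorF) hS

end UTCat

end

noncomputable section

set_option linter.unusedSimpArgs false

namespace UTCat

/-! ### The triangulated structure on the homotopy category of DG modules -/

section DGTriangulated

/-! Both Grothendieck groups turn out to be free on the classes of the shifted projectives, and the
functor `δ` is then determined by its values on the four modules `P(γ)`.

The homotopy category of DG modules is triangulated by mapping cones. The usual proofs apply, with
explicit homotopy equivalences and without signs, since the characteristic is two. The objects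
generated by the projectives form a triangulated subcategory because they are closed under shifts
and cones.

For `K₀`, the relations `[cone f] = [N] - [M]` and `[M[n]] = (-1)^n [M]` show that the classes
`[P(v){l}]` span (`HP.cl_mem_closure`). For independence, each vertex `v` has a character of the
algebra with values in the field of two elements; it is one on `e(v)` and zero on the other
idempotents and on all nonzero degrees. It defines a one-dimensional module `simple`. The Euler
characteristic of the morphisms into the shifts of this module is additive on triangles
(`euler_add`), and on the classes `[P(w){m}]` it takes the values of a dual basis (`coord_of`). Only
idempotents and characters enter, so `A` and `B` are treated alike by `K0Basis`.

On the algebra side, `U_T` has the basis `T^l γ`: these elements span by rewriting with the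
relations, and they are independent because the left regular representation can be written down on a
free module (`UT.rep`). Matching bases gives the isomorphisms with `U_T` and `U_T ⊗ U_T`;
compatibility with the twists extends from generators to all objects by `HP.map_cl_shift`.

Tensoring with a DG bimodule commutes with shifts and cones, hence is exact. Moreover `S ⊗_A A e(γ)`
is `S(γ)`, and the differential of `S(γ)` is a chain of arrows between its summands, so `S(γ)` is an
iterated cone and its class is the sum of the classes of the summands (`hasModel_gens`,
`cl_tensor_P`). These sums are the values `Δ(γ)` (`comul_toUT`): in `Δ(EF)` the sign of `(1 ⊗ E)(F ⊗
T) = -F ⊗ ET` is the shift `[-1]` of `P(F ⊗ E)`. Since `δ` takes `{l}` to `{l, l}` and `Δ(T^l) = T^l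
⊗ T^l`, the two homomorphisms agree on a spanning set. -/

lemma isInternal_of_subsingleton {ι M : Type} [DecidableEq ι] [AddCommGroup M] [Subsingleton M]
    (ℳ : ι → AddSubgroup M) : DirectSum.IsInternal ℳ :=
  isInternal_mk _ 0 (fun _ => Subsingleton.elim _ _) fun i x => by
    rw [Subsingleton.elim x 0, map_zero, AddMonoidHom.zero_apply]

variable {Λ : Type} [AddCommGroup Λ] [DecidableEq Λ] {R : Type} [Ring R] [Algebra (ZMod 2) R]
  {𝒜 : ℤ × Λ → Submodule (ZMod 2) R}

namespace DGMod

/-! ### Homotopies in characteristic two -/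

lemma neg_eq_self (M : DGMod 𝒜) (m : M) : -m = m := neg_eq_of_add_eq_zero_left (M.add_self m)

lemma add_self_left (M : DGMod 𝒜) (m n : M) : m + (m + n) = n := by
  rw [← add_assoc, M.add_self, zero_add]

/-- The sum `f + g` stands for the difference `f - g`, which is the same in characteristic two. This
keeps every verification below free of signs. -/
lemma cls_eq_of_homotopy {M N : DGMod 𝒜} {f g : Z0 M N} (h : M →ₗ[R] N)
    (hh : ∀ i, ∀ m ∈ M.deg i, h m ∈ N.deg (i - (1, 0)))
    (H : ∀ m, f m + g m = N.d (h m) + h (M.d m)) : cls f = cls g := by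
  rw [← sub_eq_zero]
  refine (map_sub (clsHom M N) f g).symm.trans (cls_eq_zero ⟨h, hh, fun m => ?_⟩)
  rw [← H]
  change f m - g m = _
  rw [sub_eq_add_neg, N.neg_eq_self]

lemma exists_homotopy {M N : DGMod 𝒜} {f g : Z0 M N} (H : cls f = cls g) : ∃ h : M →ₗ[R] N,
    (∀ i, ∀ m ∈ M.deg i, h m ∈ N.deg (i - (1, 0))) ∧
      ∀ m, f m + g m = N.d (h m) + h (M.d m) := by
  have h0 : clsHom M N (f + g) = 0 := by
    rw [map_add]
    change cls f + cls g = 0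
    rw [H]
    refine (map_add (clsHom M N) g g).symm.trans ?_
    have : g + g = 0 := Subtype.ext (LinearMap.ext fun m => N.add_self _)
    rw [this, map_zero]
  exact (QuotientAddGroup.eq_zero_iff (N := B0 M N) (f + g)).1 h0

lemma cls_congr {M N : DGMod 𝒜} {f g : Z0 M N} (H : ∀ m, f m = g m) : cls f = cls g :=
  congrArg cls (Subtype.ext (LinearMap.ext H))

/-- Signs in rotated triangles are therefore invisible, and the morphism groups are vector spaces
over the field with two elements. -/
lemma neg_hom {M N : DGMod 𝒜} (f : M ⟶ N) : -f = f := by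
  obtain ⟨f, rfl⟩ := cls_surjective f
  refine (map_neg (clsHom M N) f).symm.trans (cls_congr fun m => ?_)
  exact N.neg_eq_self _

/-- A homotopy equivalence, as an isomorphism. -/
def isoOfZ {M N : DGMod 𝒜} (f : Z0 M N) (g : Z0 N M) (hfg : cls (compZ f g) = 𝟙 M)
    (hgf : cls (compZ g f) = 𝟙 N) : M ≅ N where
  hom := cls f
  inv := cls g
  hom_inv_id := hfg
  inv_hom_id := hgf

/-! ### Coherence of the shifts -/

/-- A closed morphism between shifts of `M` which is the identity on underlying modules. -/
def addZh (M : DGMod 𝒜) {a b c : ℤ} (h : a + b = c) :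
    Z0 (M.shift (c, 0)) ((M.shift (a, 0)).shift (b, 0)) :=
  ⟨(LinearMap.id : M →ₗ[R] M), fun i m hm => by
    subst h; rw [← shift_add_deg]; exact hm, fun _ => rfl⟩

/-- The inverse of `addZh`. -/
def addZh' (M : DGMod 𝒜) {a b c : ℤ} (h : a + b = c) :
    Z0 ((M.shift (a, 0)).shift (b, 0)) (M.shift (c, 0)) :=
  ⟨(LinearMap.id : M →ₗ[R] M), fun i m hm => by
    subst h; rw [shift_add_deg]; exact hm, fun _ => rfl⟩

/-- Unwinds the abstract shift isomorphism to the identity of the underlying module. The sum is kept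
as an equation `a + b = c` so that the case `-1 + 1 = 0`, needed for the inverse rotation, is
covered. -/
lemma shiftFunctorAdd'_hom_app (M : DGMod 𝒜) {a b c : ℤ} (h : a + b = c) :
    (shiftFunctorAdd' (DGMod 𝒜) a b c h).hom.app M = cls (M.addZh h) := by
  subst h
  rw [shiftFunctorAdd'_eq_shiftFunctorAdd]
  rfl

lemma shiftFunctorAdd'_inv_app (M : DGMod 𝒜) {a b c : ℤ} (h : a + b = c) :
    (shiftFunctorAdd' (DGMod 𝒜) a b c h).inv.app M = cls (M.addZh' h) := by
  subst h
  rw [shiftFunctorAdd'_eq_shiftFunctorAdd]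
  rfl

lemma counit_inv_app (M : DGMod 𝒜) :
    (shiftEquiv (DGMod 𝒜) (1 : ℤ)).counitIso.inv.app M =
      cls (compZ M.zeroZ' (M.addZh (neg_add_cancel (1 : ℤ)))) := by
  change (shiftFunctorCompIsoId (DGMod 𝒜) (-1 : ℤ) 1 _).inv.app M = _
  rw [shiftFunctorCompIsoId]
  simp only [Iso.trans_inv, Iso.symm_inv, NatTrans.comp_app, shiftFunctorAdd'_hom_app]
  rfl

lemma unit_inv_app (M : DGMod 𝒜) :
    (shiftEquiv (DGMod 𝒜) (1 : ℤ)).unitIso.inv.app M =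
      cls (compZ (M.addZh' (add_neg_cancel (1 : ℤ))) M.zeroZ) := by
  change (shiftFunctorCompIsoId (DGMod 𝒜) (1 : ℤ) (-1) _).hom.app M = _
  rw [shiftFunctorCompIsoId]
  simp only [Iso.trans_hom, Iso.symm_hom, NatTrans.comp_app, shiftFunctorAdd'_inv_app]
  rfl

/-- The cone of the identity of any DG module would serve; the zero module is merely one that always
exists. -/
instance : Limits.HasZeroObject (DGMod 𝒜) :=
  ⟨⟨_, isZero_cone_id
    { carrier := PUnit
      deg := fun _ => ⊥
      isInternal := isInternal_of_subsingleton _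
      smul_mem := fun _ _ => rfl
      d := 0
      d_mem := fun _ => rfl
      d_d := fun _ => rfl }⟩⟩

/-! #### Rotation -/

variable {M N K : DGMod 𝒜}

/-- The homotopy equivalence `cone (coneInr f) → M[1]`. -/
def rotZ (f : Z0 M N) : Z0 (cone (coneInr f)) (M.shift (1, 0)) :=
  ⟨LinearMap.fst R M N ∘ₗ LinearMap.snd R N (M × N), fun _ _ hm => hm.2.1, fun x => by
    obtain ⟨n', m, n⟩ := x
    change 0 + M.d m = M.d m
    rw [zero_add]⟩

/-- The homotopy inverse of `rotZ`. -/
def rotZ' (f : Z0 M N) : Z0 (M.shift (1, 0)) (cone (coneInr f)) :=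
  ⟨f.1.prod (LinearMap.inl R M N), fun i m hm => ⟨f.2.1 _ _ hm, hm, zero_mem _⟩, fun (m : M) => by
    change (f (M.d m), M.d m, (0 : N)) = (N.d (f m), 0 + M.d m, f m + (f m + N.d 0))
    rw [f.2.2, zero_add, map_zero, add_zero, N.add_self]⟩

/-- The cone of `N → cone f` is `N[1] ⊕ M[1] ⊕ N`, and its differential contains the identity from
`N[1]` to `N`. The homotopy inverts that identity, which contracts the two copies of `N` and leaves
`M[1]`. -/
lemma rot_homotopy (f : Z0 M N) : cls (compZ (rotZ f) (rotZ' f)) = 𝟙 (cone (coneInr f)) := by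
  refine cls_eq_of_homotopy
    (((LinearMap.snd R M N).comp (LinearMap.snd R N (M × N))).prod 0)
    (fun i x hx => ⟨?_, zero_mem _⟩) (fun x => ?_)
  · have : x.2.2 ∈ N.deg i := hx.2.2
    change x.2.2 ∈ N.deg (i - (1, 0) + (1, 0))
    rwa [sub_add_cancel]
  · obtain ⟨n', m, n⟩ := x
    change (f m + n', m + m, 0 + n) =
      (N.d n + (n' + (f m + N.d n)), 0 + M.d 0 + 0, n + (f 0 + N.d 0) + 0)
    simp only [map_zero, add_zero, zero_add, M.add_self, N.add_self_left, N.add_self,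
      add_assoc, add_comm, add_left_comm]


lemma rot_homotopy' (f : Z0 M N) : cls (compZ (rotZ' f) (rotZ f)) = 𝟙 (M.shift (1, 0)) := rfl

/-- The projection `(cone f)[-1] → M`. -/
def invRotBase (f : Z0 M N) : Z0 ((cone f).shift (-1, 0)) M :=
  ⟨LinearMap.fst R M N, fun i m hm => by
    have : m.1 ∈ M.deg (i + (-1, 0) + (1, 0)) := hm.1
    rwa [add_assoc, show ((-1, 0) + (1, 0) : ℤ × Λ) = 0 from Prod.ext (by simp) (by simp),
      add_zero] at this, fun _ => rfl⟩

/-- The homotopy equivalence `cone (invRotBase f) → N`. -/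
def invRotZ (f : Z0 M N) : Z0 (cone (invRotBase f)) N :=
  ⟨(LinearMap.snd R M N).coprod f.1, fun i x hx => by
    have : x.1.2 ∈ N.deg (i + (1, 0) + (-1, 0)) := hx.1.2
    rw [add_assoc, show ((1, 0) + (-1, 0) : ℤ × Λ) = 0 from Prod.ext (by simp) (by simp),
      add_zero] at this
    exact add_mem this (f.2.1 _ _ hx.2), fun x => by
    obtain ⟨⟨m, n⟩, m'⟩ := x
    change f m + N.d n + f (m + M.d m') = N.d (n + f m')
    rw [map_add, map_add, f.2.2]
    simp only [N.add_self_left, N.add_self, add_assoc, add_comm, add_left_comm]⟩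

/-- The homotopy inverse of `invRotZ`. -/
def invRotZ' (f : Z0 M N) : Z0 N (cone (invRotBase f)) :=
  ⟨(LinearMap.inr R M N).prod 0, fun i m hm => ⟨⟨zero_mem _, by
    change m ∈ N.deg (i + (1, 0) + (-1, 0))
    rwa [add_assoc, show ((1, 0) + (-1, 0) : ℤ × Λ) = 0 from Prod.ext (by simp) (by simp),
      add_zero]⟩, zero_mem _⟩, fun n => by
    change (((0 : M), N.d n), (0 : M)) = ((M.d 0, f 0 + N.d n), (0 : M) + M.d 0)
    simp only [map_zero, zero_add]⟩

/-- Here the two copies of `M` cancel: the differential contains the identity from the copy of `M`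
inside `cone f` to the target, and the homotopy sends the target back. -/
lemma invRot_homotopy (f : Z0 M N) :
    cls (compZ (invRotZ f) (invRotZ' f)) = 𝟙 (cone (invRotBase f)) := by
  refine cls_eq_of_homotopy
    (((LinearMap.inl R M N).comp (LinearMap.snd R (M × N) M)).prod 0)
    (fun i x hx => ⟨⟨?_, zero_mem _⟩, zero_mem _⟩) (fun x => ?_)
  · have : x.2 ∈ M.deg i := hx.2
    change x.2 ∈ M.deg (i - (1, 0) + (1, 0) + (-1, 0) + (1, 0))
    rwa [sub_add_cancel, add_assoc,
      show ((-1, 0) + (1, 0) : ℤ × Λ) = 0 from Prod.ext (by simp) (by simp), add_zero]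
  · obtain ⟨⟨m, n⟩, m'⟩ := x
    change ((0 + m, n + f m' + n), 0 + m') =
      ((M.d m' + (m + M.d m'), f m' + N.d 0 + 0), (m' + M.d 0) + 0)
    simp only [map_zero, add_zero, zero_add, M.add_self, N.add_self_left, N.add_self,
      M.add_self_left, add_assoc, add_comm, add_left_comm]

lemma invRot_homotopy' (f : Z0 M N) : cls (compZ (invRotZ' f) (invRotZ f)) = 𝟙 N :=
  cls_congr fun n => by
    change n + f 0 = n
    rw [map_zero, add_zero]

variable (𝒜) in
/-- The triangles isomorphic to a mapping cone triangle. -/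
def coneTri : Set (Triangle (DGMod 𝒜)) :=
  {T | ∃ (M N : DGMod 𝒜) (f : Z0 M N), Nonempty (T ≅ coneTriangle f)}

lemma rotate_mem (f : Z0 M N) : (coneTriangle f).rotate ∈ coneTri 𝒜 := by
  refine ⟨_, _, coneInr f, ⟨Iso.symm (Triangle.isoMk (coneTriangle (coneInr f)) (coneTriangle f).rotate (Iso.refl _) (Iso.refl _)
    (isoOfZ (rotZ f) (rotZ' f) (rot_homotopy f) (rot_homotopy' f)) ?_ ?_ ?_)⟩⟩
  · exact (Category.comp_id _).trans (Category.id_comp _).symm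
  · exact (show cls (compZ (coneInr (coneInr f)) (rotZ f)) = cls (coneFst f) from rfl).trans
      (Category.id_comp _).symm
  -- Against `rotZ` this square commutes only up to homotopy, whereas against the inverse `rotZ'` it
  -- commutes strictly. The sign of the rotated triangle is removed by `neg_hom`.
  · rw [← Iso.inv_comp_eq]
    exact Eq.trans (b := cls (shiftZ (1, 0) _ _ f)) rfl (neg_hom _).symm

lemma invRotate_mem (f : Z0 M N) : (coneTriangle f).invRotate ∈ coneTri 𝒜 := by
  refine ⟨_, _, invRotBase f, ⟨Iso.symm (Triangle.isoMk (coneTriangle (invRotBase f))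
    (coneTriangle f).invRotate (Iso.refl _) (Iso.refl _)
    (isoOfZ (invRotZ f) (invRotZ' f) (invRot_homotopy f) (invRot_homotopy' f)) ?_ ?_ ?_)⟩⟩
  · refine (Category.comp_id _).trans (Eq.trans ?_ (Category.id_comp _).symm)
    change cls (invRotBase f) = -(cls (coneFst f))⟦(-1 : ℤ)⟧' ≫ 
      (shiftEquiv (DGMod 𝒜) (1 : ℤ)).unitIso.inv.app M
    rw [unit_inv_app, neg_hom]
    rfl
  · refine Eq.trans (cls_congr fun m => ?_) (Category.id_comp _).symm
    exact zero_add _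
  -- Again the square is strict only for the homotopy inverse `invRotZ'`.
  · rw [← Iso.inv_comp_eq]
    exact Eq.trans (b := cls (compZ (coneInr f) (compZ (cone f).zeroZ'
      ((cone f).addZh (neg_add_cancel (1 : ℤ)))))) rfl
      (congrArg (fun x => cls (coneInr f) ≫ x) (counit_inv_app (cone f)).symm)

/-! ### Maps of cones and the octahedral axiom -/

/-- The map of cones given by a square which commutes up to a homotopy. -/
def coneMap {M' N' : DGMod 𝒜} (f : Z0 M N) (g : Z0 M' N') (a : Z0 M M') (b : Z0 N N')
    (h : M →ₗ[R] N') (hh : ∀ i, ∀ m ∈ M.deg i, h m ∈ N'.deg (i - (1, 0)))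
    (H : ∀ m, b (f m) + g (a m) = N'.d (h m) + h (M.d m)) : Z0 (cone f) (cone g) :=
  ⟨(a.1.comp (LinearMap.fst R M N)).prod (h.coprod b.1), fun i x hx => ⟨a.2.1 _ _ hx.1, by
    have := hh _ _ hx.1
    rw [add_sub_cancel_right] at this
    exact add_mem this (b.2.1 _ _ hx.2)⟩, fun x => by
    obtain ⟨m, n⟩ := x
    have e : b (f m) = N'.d (h m) + h (M.d m) + g (a m) := by
      rw [← H, add_assoc, N'.add_self, add_zero]
    change (a (M.d m), h (M.d m) + b (f m + N.d n)) =
      (M'.d (a m), g (a m) + N'.d (h m + b n))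
    rw [a.2.2, map_add, map_add, b.2.2, e]
    simp only [N'.add_self_left, N'.add_self, add_assoc, add_comm, add_left_comm]⟩

/-- The map `cone f → cone (g ∘ f)`. -/
def octZ₁ (f : Z0 M N) (g : Z0 N K) : Z0 (cone f) (cone (compZ f g)) :=
  coneMap f (compZ f g) (idZ M) g 0 (fun _ _ _ => zero_mem _) fun m => by
    change g (f m) + g (f m) = K.d 0 + 0
    rw [K.add_self, map_zero, add_zero]

/-- The map `cone (g ∘ f) → cone g`. -/
def octZ₃ (f : Z0 M N) (g : Z0 N K) : Z0 (cone (compZ f g)) (cone g) :=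
  coneMap (compZ f g) g f (idZ K) 0 (fun _ _ _ => zero_mem _) fun m => by
    change g (f m) + g (f m) = K.d 0 + 0
    rw [K.add_self, map_zero, add_zero]

/-- The homotopy equivalence `cone (octZ₁ f g) → cone g`. -/
def octZ (f : Z0 M N) (g : Z0 N K) : Z0 (cone (octZ₁ f g)) (cone g) :=
  ⟨((LinearMap.snd R M N).comp (LinearMap.fst R _ (M × K)) +
      f.1.comp ((LinearMap.fst R M K).comp (LinearMap.snd R (M × N) _))).prod
    ((LinearMap.snd R M K).comp (LinearMap.snd R (M × N) _)),
    fun i x hx => ⟨add_mem hx.1.2 (f.2.1 _ _ hx.2.1), hx.2.2⟩, fun x => by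
    obtain ⟨⟨m, n⟩, m', k⟩ := x
    change (f m + N.d n + f (m + M.d m'), 0 + g n + (g (f m') + K.d k)) =
      (N.d (n + f m'), g (n + f m') + K.d k)
    rw [map_add, map_add, map_add, f.2.2]
    simp only [N.add_self_left, N.add_self, zero_add, add_assoc, add_comm, add_left_comm]⟩

/-- The homotopy inverse of `octZ`. -/
def octZ' (f : Z0 M N) (g : Z0 N K) : Z0 (cone g) (cone (octZ₁ f g)) :=
  ⟨(LinearMap.prodMap (LinearMap.inr R M N) (LinearMap.inr R M K) :
      N × K →ₗ[R] (M × N) × (M × K)),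
    fun i x hx => ⟨⟨zero_mem _, hx.1⟩, ⟨zero_mem _, hx.2⟩⟩, fun x => by
    obtain ⟨n, k⟩ := x
    change (((0 : M), N.d n), ((0 : M), g n + K.d k)) =
      ((M.d 0, f 0 + N.d n), (0 + M.d 0, (0 + g n) + (g (f 0) + K.d k)))
    simp only [map_zero, zero_add]⟩

/-- The homotopy `((m, n), (m', k)) ↦ ((m', 0), (0, 0))`. -/
def octH (f : Z0 M N) (g : Z0 N K) :
    (cone (octZ₁ f g)).carrier →ₗ[R] (cone f).carrier :=
  (LinearMap.inl R M N).comp ((LinearMap.fst R M K).comp (LinearMap.snd R (M × N) (M × K)))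

/-- The cone of `cone f → cone (g ∘ f)` contains two copies of `M` joined by the identity, one from
each cone. Cancelling them leaves `N[1] ⊕ K`, which is `cone g`; `octH` is the inverse of the
cancelled identity. -/
lemma oct_homotopy (f : Z0 M N) (g : Z0 N K) :
    cls (compZ (octZ f g) (octZ' f g)) = 𝟙 (cone (octZ₁ f g)) := by
  refine cls_eq_of_homotopy ((octH f g).prod 0)
    (fun i x hx => ⟨⟨?_, zero_mem _⟩, zero_mem _⟩) (fun x => ?_)
  · have : x.2.1 ∈ M.deg (i + (1, 0)) := hx.2.1
    change x.2.1 ∈ M.deg (i - (1, 0) + (1, 0) + (1, 0))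
    rwa [sub_add_cancel]
  · obtain ⟨⟨m, n⟩, m', k⟩ := x
    change ((0 + m, n + f m' + n), (0 + m', k + k)) =
      ((M.d m' + (m + M.d m'), f m' + N.d 0 + 0),
        (m' + M.d 0 + 0, 0 + g 0 + (g (f 0) + K.d 0) + 0))
    simp only [map_zero, add_zero, zero_add, M.add_self, N.add_self_left, N.add_self, K.add_self,
      M.add_self_left, add_assoc, add_comm, add_left_comm]

lemma oct_homotopy' (f : Z0 M N) (g : Z0 N K) :
    cls (compZ (octZ' f g) (octZ f g)) = 𝟙 (cone g) :=
  cls_congr fun x => by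
    obtain ⟨n, k⟩ := x
    change (n + f 0, k) = (n, k)
    rw [map_zero, add_zero]

lemma oct_mem (f : Z0 M N) (g : Z0 N K) :
    Triangle.mk (cls (octZ₁ f g)) (cls (octZ₃ f g))
      ((coneTriangle g).mor₃ ≫ (coneTriangle f).mor₂⟦(1 : ℤ)⟧') ∈ coneTri 𝒜 := by
  refine ⟨_, _, octZ₁ f g, ⟨Iso.symm (Triangle.isoMk (coneTriangle (octZ₁ f g)) _ (Iso.refl _)
    (Iso.refl _) (isoOfZ (octZ f g) (octZ' f g) (oct_homotopy f g) (oct_homotopy' f g))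
      ?_ ?_ ?_)⟩⟩
  · exact (Category.comp_id _).trans (Category.id_comp _).symm
  · refine Eq.trans (cls_congr fun x => ?_) (Category.id_comp _).symm
    obtain ⟨m', k⟩ := x
    change ((0 : N) + f m', k) = (f m', 0 + k)
    rw [zero_add, zero_add]
  · rw [← Iso.inv_comp_eq]
    rfl

/-- A square of homotopy classes commutes by virtue of some homotopy, and that homotopy is the
off-diagonal entry of the map between the cones. -/
lemma exists_coneTriangle_map {M' N' : DGMod 𝒜} (f : Z0 M N) (f' : Z0 M' N')
    (a : (coneTriangle f).obj₁ ⟶ (coneTriangle f').obj₁)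
    (b : (coneTriangle f).obj₂ ⟶ (coneTriangle f').obj₂)
    (comm : (coneTriangle f).mor₁ ≫ b = a ≫ (coneTriangle f').mor₁) :
    ∃ c : (coneTriangle f).obj₃ ⟶ (coneTriangle f').obj₃,
      (coneTriangle f).mor₂ ≫ c = b ≫ (coneTriangle f').mor₂ ∧
        (coneTriangle f).mor₃ ≫ a⟦1⟧' = c ≫ (coneTriangle f').mor₃ := by
  obtain ⟨a, rfl⟩ := cls_surjective (M := M) (N := M') a
  obtain ⟨b, rfl⟩ := cls_surjective (M := N) (N := N') b
  obtain ⟨h, hh, H⟩ := exists_homotopy (f := compZ f b) (g := compZ a f') comm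
  refine ⟨cls (coneMap f f' a b h hh H), cls_congr fun n => ?_, rfl⟩
  change (a 0, h 0 + b n) = (0, b n)
  rw [map_zero, map_zero, zero_add]

/-! ### The triangulated structure -/

instance : Pretriangulated (DGMod 𝒜) where
  distinguishedTriangles := coneTri 𝒜
  isomorphic_distinguished T₁ h T₂ e := by
    obtain ⟨M, N, f, ⟨e'⟩⟩ := h
    exact ⟨M, N, f, ⟨e ≪≫ e'⟩⟩
  contractible_distinguished M := by
    refine ⟨M, M, idZ M, ⟨Triangle.isoMk _ _ (Iso.refl _) (Iso.refl _)
      ((Limits.isZero_zero _).iso (isZero_cone_id M)) rfl ?_ ?_⟩⟩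
    · exact (isZero_cone_id M).eq_of_tgt _ _
    · exact (Limits.isZero_zero _).eq_of_src _ _
  distinguished_cocone_triangle {M N} f := by
    obtain ⟨f, rfl⟩ := cls_surjective f
    exact ⟨_, _, _, _, _, f, ⟨Iso.refl _⟩⟩
  rotate_distinguished_triangle T := by
    constructor
    · rintro ⟨M, N, f, ⟨e⟩⟩
      obtain ⟨M', N', f', ⟨e'⟩⟩ := rotate_mem f
      exact ⟨M', N', f', ⟨(rotate _).mapIso e ≪≫ e'⟩⟩
    -- The triangle is recovered as the inverse rotation of its rotation, which is an inverse
    -- rotation of a cone triangle.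
    · rintro ⟨M, N, f, ⟨e⟩⟩
      obtain ⟨M', N', f', ⟨e'⟩⟩ := invRotate_mem f
      exact ⟨M', N', f', ⟨rotCompInvRot.app T ≪≫ (invRotate _).mapIso e ≪≫ e'⟩⟩
  complete_distinguished_triangle_morphism T₁ T₂ h₁ h₂ a b comm := by
    obtain ⟨M, N, f, ⟨e⟩⟩ := h₁
    obtain ⟨M', N', f', ⟨e'⟩⟩ := h₂
    obtain ⟨c, h2, h3⟩ := exists_coneTriangle_map f f' (e.inv.hom₁ ≫ a ≫ e'.hom.hom₁)
      (e.inv.hom₂ ≫ b ≫ e'.hom.hom₂) (by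
        rw [e.inv.comm₁_assoc, Category.assoc, Category.assoc, ← e'.hom.comm₁,
          reassoc_of% comm])
    -- The rest is a diagram chase which uses the two cone triangles only through their commuting
    -- squares.
    generalize coneTriangle f = S at *
    generalize coneTriangle f' = S' at *
    refine ⟨e.hom.hom₃ ≫ c ≫ e'.inv.hom₃, ?_, ?_⟩
    · rw [e.hom.comm₂_assoc, reassoc_of% h2, e'.inv.comm₂]
      simp
    · rw [Category.assoc, Category.assoc, ← e'.inv.comm₃, ← reassoc_of% h3,
        ← e.hom.comm₃_assoc]
      simp [← Functor.map_comp]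

/-- By `IsTriangulated.mk'` one octahedron for each composable pair, up to isomorphism, suffices. It
is built from closed representatives and their three cones. -/
instance : IsTriangulated (DGMod 𝒜) := by
  refine IsTriangulated.mk' fun M N K f g => ?_
  obtain ⟨f, rfl⟩ := cls_surjective f
  obtain ⟨g, rfl⟩ := cls_surjective g
  refine ⟨_, _, _, _, _, _, cls f, cls g, Iso.refl _, Iso.refl _, Iso.refl _,
    (Category.comp_id _).trans (Category.id_comp _).symm,
    (Category.comp_id _).trans (Category.id_comp _).symm,
    (coneTriangle f).mor₂, (coneTriangle f).mor₃, ⟨_, _, f, ⟨Iso.refl _⟩⟩,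
    (coneTriangle g).mor₂, (coneTriangle g).mor₃, ⟨_, _, g, ⟨Iso.refl _⟩⟩,
    (coneTriangle (compZ f g)).mor₂, (coneTriangle (compZ f g)).mor₃,
    ⟨_, _, compZ f g, ⟨Iso.refl _⟩⟩,
    ⟨{ m₁ := cls (octZ₁ f g), m₃ := cls (octZ₃ f g),
        comm₁ := ?_, comm₂ := ?_, comm₃ := ?_, comm₄ := ?_, mem := oct_mem f g }⟩⟩
  · refine cls_congr fun n => ?_
    change ((0 : M), (0 : K) + g n) = (0, g n)
    rw [zero_add]
  · rfl
  · refine cls_congr fun k => ?_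
    change (f 0, (0 : K) + k) = (0, k)
    rw [zero_add, map_zero]
  · rfl

lemma coneTriangle_mem (f : Z0 M N) : coneTriangle f ∈ distTriang (DGMod 𝒜) :=
  ⟨_, _, f, ⟨Iso.refl _⟩⟩

end DGMod

end DGTriangulated

end UTCat

namespace UTCat

section HPTriangulated

variable {Λ : Type} [AddCommGroup Λ] [DecidableEq Λ] {R : Type} [Ring R] [Algebra (ZMod 2) R]
  {𝒜 : ℤ × Λ → Submodule (ZMod 2) R} {V : Type} (P : V → DGMod 𝒜) [Nonempty V]

open DGMod

/-- `IsDGP` is closed by definition only under strict isomorphisms of DG modules. The third object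
is accordingly shown to be homotopy equivalent to an object with the property, namely the cone of a
representative of the first morphism. -/
instance : (IsDGP P).IsTriangulatedClosed₃ where
  ext₃' T hT h₁ h₂ := by
    obtain ⟨f, hf⟩ := cls_surjective T.mor₁
    refine ⟨cone f, .cone f h₁ h₂, ⟨Triangle.π₃.mapIso
      (isoTriangleOfIso₁₂ T (coneTriangle f) hT (coneTriangle_mem f) (Iso.refl _) (Iso.refl _) ?_)⟩⟩
    exact (Category.comp_id _).trans (hf.symm.trans (Category.id_comp _).symm)

instance : (IsDGP P).IsTriangulated where
  toIsTriangulatedClosed₂ := ObjectProperty.IsTriangulatedClosed₂.of_isTriangulatedClosed₃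

end HPTriangulated

/-! ### Tensor products with a DG bimodule are exact -/

section Tensor

open DGMod DGBimod

variable {Λ : Type} [AddCommGroup Λ] [DecidableEq Λ] {R : Type} [Ring R] [Algebra (ZMod 2) R]
  {𝒜 : ℤ × Λ → Submodule (ZMod 2) R}
  {Λ' : Type} [AddCommGroup Λ'] [DecidableEq Λ'] {R' : Type} [Ring R']
  [Algebra (ZMod 2) R'] {ℬ : ℤ × Λ' → Submodule (ZMod 2) R'} {φ : Λ →+ Λ'}

namespace DGBimod

lemma idTens_mem {S : DGBimod ℬ 𝒜 φ} {M N : DGMod 𝒜} (g : M →ₗ[R] N) (c : ℤ × Λ)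
    (c' : ℤ × Λ') (hc : c' = (c.1, φ c.2)) (hg : ∀ k, ∀ m ∈ M.deg k, g m ∈ N.deg (k + c))
    {j : ℤ × Λ'} {x : S.Tens M} (hx : x ∈ S.tensDeg M j) :
    idTens g x ∈ S.tensDeg N (j + c') := by
  refine tensDeg_map (idTens (S := S) g).toAddMonoidHom (fun i s hs k m hm => ?_) hx
  have h := tm_mem hs (hg k m hm)
  have e : tdeg φ i (k + c) = tdeg φ i k + c' := by
    rw [hc]
    ext <;> simp [tdeg, add_assoc]
  rwa [e] at h

variable (S : DGBimod ℬ 𝒜 φ) [GradedAlgebra 𝒜] (M N : DGMod 𝒜)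

/-- The identity of `S ⊗ M`, as a morphism `S ⊗ M{s} → (S ⊗ M){s'}`. -/
def shiftTensZ (s : ℤ × Λ) (s' : ℤ × Λ') (h : s' = (s.1, φ s.2)) :
    Z0 (S.tensor (M.shift s)) ((S.tensor M).shift s') :=
  ⟨idTens (S := S) (M := M.shift s) (N := M) LinearMap.id,
    fun _ _ hx => idTens_mem (S := S) (M := M.shift s) (N := M) _ s s' h (fun _ _ hm => hm) hx,
    fun x => tm_induction (S := S) (M := M.shift s)
      (p := fun x => idTens (S := S) (M := M.shift s) (N := M) LinearMap.id (tensD (M.shift s) x) =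
        tensD M (idTens (S := S) (M := M.shift s) (N := M) LinearMap.id x))
      (by simp only [map_zero]) (fun _ _ => rfl)
      (fun x y hx hy => by rw [map_add, map_add, map_add, map_add, hx, hy]) x⟩

/-- The identity of `S ⊗ M`, as a morphism `(S ⊗ M){s'} → S ⊗ M{s}`. -/
def shiftTensZ' (s : ℤ × Λ) (s' : ℤ × Λ') (h : s' = (s.1, φ s.2)) :
    Z0 ((S.tensor M).shift s') (S.tensor (M.shift s)) :=
  ⟨idTens (S := S) (M := M) (N := M.shift s) LinearMap.id, fun j x hx => by
    have := idTens_mem (S := S) (M := M) (N := M.shift s) LinearMap.id (-s) (-s')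
      (by rw [h]; ext <;> simp) (fun k m hm => by
        change m ∈ M.deg (k + -s + s)
        rwa [neg_add_cancel_right]) hx
    rwa [add_neg_cancel_right] at this,
    fun x => tm_induction (S := S) (M := M)
      (p := fun x => idTens (S := S) (M := M) (N := M.shift s) LinearMap.id (tensD M x) =
        tensD (M.shift s) (idTens (S := S) (M := M) (N := M.shift s) LinearMap.id x))
      (by simp only [map_zero]) (fun _ _ => rfl)
      (fun x y hx hy => by rw [map_add, map_add, map_add, map_add, hx, hy]) x⟩

variable {S M N} in
-- Pure tensors span, so the coherence conditions below reduce to evaluating both sides on `s ⊗ m`,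
-- where they agree by definition.
lemma Z0_tens_ext {N : DGMod ℬ} {f g : Z0 (S.tensor M) N}
    (h : ∀ (s : S) (m : M), f (S.tm s m) = g (S.tm s m)) : cls f = cls g :=
  congrArg cls (Subtype.ext (tens_ext (S := S) h))

/-- The isomorphism `S ⊗ M{s} ≅ (S ⊗ M){s'}`. -/
def shiftTensIso (s : ℤ × Λ) (s' : ℤ × Λ') (h : s' = (s.1, φ s.2)) :
    S.tensor (M.shift s) ≅ (S.tensor M).shift s' :=
  isoOfZ (S.shiftTensZ M s s' h) (S.shiftTensZ' M s s' h) (Z0_tens_ext fun _ _ => rfl)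
    (congrArg cls (Subtype.ext (tens_ext (S := S) (M := M) fun _ _ => rfl)))

/-- The compatibility of `S ⊗ -` with the shifts. -/
def tensorShiftIso (n : ℤ) : shiftFunctor (DGMod 𝒜) n ⋙ S.tensorF ≅
    S.tensorF ⋙ shiftFunctor (DGMod ℬ) n :=
  NatIso.ofComponents (fun M => S.shiftTensIso M (n, 0) (n, 0) (by rw [map_zero]))
    (by
      intro M N f
      obtain ⟨f, rfl⟩ := cls_surjective f
      exact Z0_tens_ext (S := S) (M := M.shift (n, 0))
        (f := compZ (S.tensorZ _ _ (shiftZ (n, 0) M N f)) (S.shiftTensZ N (n, 0) (n, 0) (by rw [map_zero])))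
        (g := compZ (S.shiftTensZ M (n, 0) (n, 0) (by rw [map_zero])) (shiftZ (n, 0) _ _ (S.tensorZ _ _ f)))
        fun _ _ => rfl)

/-- A shift changes only the grading, so all the comparison maps fix the pure tensors. -/
instance : S.tensorF.CommShift ℤ where
  commShiftIso := S.tensorShiftIso
  commShiftIso_zero := by
    ext M
    rw [Functor.CommShift.isoZero_hom_app]
    exact Z0_tens_ext (S := S) (M := M.shift (0, 0))
      (f := S.shiftTensZ M (0, 0) (0, 0) (by rw [map_zero]))
      (g := compZ (S.tensorZ _ _ M.zeroZ) (S.tensor M).zeroZ')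
      fun _ _ => rfl
  commShiftIso_add a b := by
    ext M
    rw [Functor.CommShift.isoAdd_hom_app]
    exact Z0_tens_ext (S := S) (M := M.shift (a + b, 0))
      (f := S.shiftTensZ M (a + b, 0) (a + b, 0) (by rw [map_zero]))
      (g := compZ (S.tensorZ _ _ (M.addZ a b)) (compZ
        (S.shiftTensZ (M.shift (a, 0)) (b, 0) (b, 0) (by rw [map_zero])) (compZ
          (shiftZ (b, 0) _ _ (S.shiftTensZ M (a, 0) (a, 0) (by rw [map_zero])))
          ((S.tensor M).addZ' a b))))
      fun _ _ => rfl

variable {M N}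

/-- The comparison map `S ⊗ cone f → cone (S ⊗ f)`. -/
def tensConeZ (f : Z0 M N) : Z0 (S.tensor (cone f)) (cone (S.tensorZ M N f)) :=
  ⟨(idTens (S := S) (M := cone f) (N := M) (LinearMap.fst R M N)).prod
      (idTens (S := S) (M := cone f) (N := N) (LinearMap.snd R M N)), fun i x hx =>
    ⟨idTens_mem (S := S) (M := cone f) (N := M) (LinearMap.fst R M N) (1, 0) (1, 0)
      (by rw [map_zero]) (fun k m hm => hm.1) hx, by
      have := idTens_mem (S := S) (M := cone f) (N := N) (LinearMap.snd R M N) 0 0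
        (by simp; rfl) (fun k m hm => by rw [add_zero]; exact hm.2) hx
      rwa [add_zero] at this⟩, by
    refine LinearMap.congr_fun (f := ((idTens (S := S) (M := cone f) (N := M) (LinearMap.fst R M N)).prod
      (idTens (S := S) (M := cone f) (N := N) (LinearMap.snd R M N))).comp (tensD (cone f)))
      (g := (cone (S.tensorZ M N f)).d.comp _) (tens_ext fun s x => ?_)
    obtain ⟨m, n⟩ := x
    change (S.tm (S.d s) m + S.tm s (M.d m), S.tm (S.d s) n + S.tm s (f m + N.d n)) =
      (S.tm (S.d s) m + S.tm s (M.d m), S.tm s (f m) + (S.tm (S.d s) n + S.tm s (N.d n)))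
    rw [tm_add, add_left_comm]⟩

/-- The map induced by the inclusion of `M` in the underlying module of `cone f`. -/
def tensInl (f : Z0 M N) : S.Tens M →ₗ[R'] S.Tens (cone f) :=
  idTens (S := S) (M := M) (N := cone f) (LinearMap.inl R M N)

/-- The map induced by the inclusion of `N` in the underlying module of `cone f`. -/
def tensInr (f : Z0 M N) : S.Tens N →ₗ[R'] S.Tens (cone f) :=
  idTens (S := S) (M := N) (N := cone f) (LinearMap.inr R M N)

/-- The inverse of `tensConeZ`. -/
def tensConeZ' (f : Z0 M N) : Z0 (cone (S.tensorZ M N f)) (S.tensor (cone f)) :=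
  ⟨(S.tensInl f).coprod
      (S.tensInr f), fun i x hx => by
    have h1 := idTens_mem (S := S) (M := M) (N := cone f) (LinearMap.inl R M N) (-(1, 0)) (-(1, 0))
      (by simp) (fun k m hm => ⟨by
        change m ∈ M.deg (k + -(1, 0) + (1, 0))
        rwa [neg_add_cancel_right], zero_mem _⟩) hx.1
    have h2 := idTens_mem (S := S) (M := N) (N := cone f) (LinearMap.inr R M N) 0 0
      (by simp; rfl) (fun k m hm => ⟨zero_mem _, by rw [add_zero]; exact hm⟩) hx.2
    rw [add_neg_cancel_right] at h1
    rw [add_zero] at h2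
    exact add_mem h1 h2, by
    have key1 : ∀ x : S.Tens M,
        S.tensInl f (tensD M x) +
          S.tensInr f (idTens f.1 x) =
        tensD (cone f) (S.tensInl f x) := by
      refine LinearMap.congr_fun (f := (S.tensInl f).comp (tensD M) +
        (S.tensInr f).comp (idTens f.1))
        (g := (tensD (cone f)).comp _) (tens_ext fun s m => ?_)
      change S.tm (M := cone f) (S.d s) ((m, 0) : M × N) + S.tm (M := cone f) s ((M.d m, 0) : M × N) +
        S.tm (M := cone f) s ((0, f m) : M × N) = S.tm (M := cone f) (S.d s) ((m, 0) : M × N) +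
          S.tm (M := cone f) s ((M.d m, f m + N.d 0) : M × N)
      have e : ((M.d m, f m + N.d 0) : M × N) = (M.d m, 0) + (0, f m) := by
        simp
      rw [e, add_assoc]
      exact congrArg _ (tm_add (M := cone f) s _ _).symm
    have key2 : ∀ x : S.Tens N,
        S.tensInr f (tensD N x) =
        tensD (cone f) (S.tensInr f x) := by
      refine LinearMap.congr_fun (f := (S.tensInr f).comp (tensD N))
        (g := (tensD (cone f)).comp _) (tens_ext fun s n => ?_)
      change S.tm (M := cone f) (S.d s) ((0, n) : M × N) + S.tm (M := cone f) s ((0, N.d n) : M × N) =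
        S.tm (M := cone f) (S.d s) ((0, n) : M × N) +
          S.tm (M := cone f) s ((M.d 0, f 0 + N.d n) : M × N)
      rw [map_zero, map_zero, zero_add]
    intro (p : S.Tens M × S.Tens N)
    change S.tensInl f (tensD M p.1) + S.tensInr f (idTens f.1 p.1 + tensD N p.2) =
      tensD (cone f) (S.tensInl f p.1 + S.tensInr f p.2)
    rw [map_add, map_add, ← key1, ← key2, add_assoc]⟩

/-- The underlying module of a cone is a direct sum, over which the tensor product distributes. The
comparison is thus a strict isomorphism of DG modules, as the closure property in `isDGP_tensor`
requires; a homotopy equivalence would not be enough there. -/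
lemma tensCone_left_inv (f : Z0 M N) (x : S.tensor (cone f)) :
    S.tensConeZ' f (S.tensConeZ f x) = x := by
  refine LinearMap.congr_fun (f := (S.tensConeZ' f).1.comp (S.tensConeZ f).1) (g := LinearMap.id)
    (tens_ext fun s x => ?_) x
  obtain ⟨m, n⟩ := x
  change S.tm (M := cone f) s ((m, 0) : M × N) + S.tm (M := cone f) s ((0, n) : M × N) =
    S.tm (M := cone f) s ((m, n) : M × N)
  have e : ((m, 0) : M × N) + (0, n) = (m, n) := by simp
  exact (tm_add (M := cone f) s _ _).symm.trans (congrArg (S.tm (M := cone f) s) e)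

lemma tensCone_right_inv (f : Z0 M N) (y : cone (S.tensorZ M N f)) :
    S.tensConeZ f (S.tensConeZ' f y) = y := by
  obtain ⟨x, y⟩ := y
  have h1 : ∀ x : S.Tens M, (S.tensConeZ f).1 (S.tensInl f x) =
      (x, 0) :=
    LinearMap.congr_fun (f := (S.tensConeZ f).1.comp (S.tensInl f))
      (g := LinearMap.inl R' _ _) (tens_ext fun s m => Prod.ext rfl (tm_zero s))
  have h2 : ∀ x : S.Tens N, (S.tensConeZ f).1 (S.tensInr f x) =
      (0, x) :=
    LinearMap.congr_fun (f := (S.tensConeZ f).1.comp (S.tensInr f))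
      (g := LinearMap.inr R' _ _) (tens_ext fun s m => Prod.ext (tm_zero s) rfl)
  refine (map_add (S.tensConeZ f).1 (S.tensInl f x) (S.tensInr f y)).trans ?_
  refine (congrArg₂ (· + ·) (h1 x) (h2 y)).trans ?_
  exact Prod.ext (add_zero _) (zero_add _)

instance : S.tensorF.IsTriangulated where
  map_distinguished T hT := by
    obtain ⟨M, N, f, ⟨e⟩⟩ := hT
    refine ⟨_, _, S.tensorZ M N f, ⟨S.tensorF.mapTriangle.mapIso e ≪≫
      Triangle.isoMk (S.tensorF.mapTriangle.obj (coneTriangle f)) (coneTriangle (S.tensorZ M N f))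
        (Iso.refl _) (Iso.refl _)
        (isoOfZ (S.tensConeZ f) (S.tensConeZ' f) (cls_congr (S.tensCone_left_inv f))
          (cls_congr (S.tensCone_right_inv f))) ?_ ?_ ?_⟩⟩
    · exact (Category.comp_id _).trans (Category.id_comp _).symm
    · refine Eq.trans ?_ (Category.id_comp _).symm
      exact Z0_tens_ext (S := S) (M := N)
        (f := compZ (S.tensorZ _ _ (coneInr f)) (S.tensConeZ f)) (g := coneInr (S.tensorZ M N f))
        fun s n => Prod.ext (tm_zero s) rfl
    · exact Z0_tens_ext (S := S) (M := cone f)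
        (f := compZ (compZ (S.tensorZ _ _ (coneFst f)) (S.shiftTensZ M (1, 0) (1, 0)
          (by rw [map_zero]))) (idZ _))
        (g := compZ (S.tensConeZ f) (coneFst (S.tensorZ M N f)))
        fun s n => rfl

/-- The tensor product takes the DG category generated by the `P v` to the one generated by the
`Q w`, if this is so for the generators. -/
lemma isDGP_tensor {V W : Type} (P : V → DGMod 𝒜) (Q : W → DGMod ℬ)
    (h : ∀ v, IsDGP Q (S.tensor (P v))) {M : DGMod 𝒜} (hM : IsDGP P M) :
    IsDGP Q (S.tensor M) := by
  induction hM with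
  | proj v => exact h v
  | @shift M s hM ih =>
    exact .iso (S.shiftTensZ' M s _ rfl) (S.shiftTensZ M s _ rfl)
      (LinearMap.congr_fun (f := LinearMap.comp (S.shiftTensZ M s _ rfl).1
        (S.shiftTensZ' M s _ rfl).1) (g := LinearMap.id) (tens_ext (S := S) (M := M) fun _ _ => rfl))
      (LinearMap.congr_fun (f := LinearMap.comp (S.shiftTensZ' M s _ rfl).1
        (S.shiftTensZ M s _ rfl).1) (g := LinearMap.id)
        (tens_ext (S := S) (M := M.shift s) fun _ _ => rfl)) (.shift _ ih)
  | @cone M N f hM hN ihM ihN =>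
    exact .iso (S.tensConeZ' f) (S.tensConeZ f) (S.tensCone_right_inv f) (S.tensCone_left_inv f)
      (.cone (S.tensorZ M N f) ihM ihN)
  | @iso M N f g hfg hgf hM ih =>
    exact .iso (S.tensorZ _ _ f) (S.tensorZ _ _ g)
      (LinearMap.congr_fun (f := LinearMap.comp (S.tensorZ _ _ g).1 (S.tensorZ _ _ f).1)
        (g := LinearMap.id) (tens_ext (S := S) (M := M) fun s m => congrArg (S.tm s) (hfg m)))
      (LinearMap.congr_fun (f := LinearMap.comp (S.tensorZ _ _ f).1 (S.tensorZ _ _ g).1)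
        (g := LinearMap.id) (tens_ext (S := S) (M := N) fun s m => congrArg (S.tm s) (hgf m))) ih

end DGBimod

end Tensor

end UTCat

namespace UTCat

/-! ### Relations in the Grothendieck group of `HP P` -/

section K0HP

open DGMod

variable {Λ : Type} [AddCommGroup Λ] [DecidableEq Λ] {R : Type} [Ring R] [Algebra (ZMod 2) R]
  {𝒜 : ℤ × Λ → Submodule (ZMod 2) R}

namespace DGMod

/-- The isomorphism `M{s}{t} ≅ M{s + t}`. -/
def shiftShiftIso (M : DGMod 𝒜) (s t u : ℤ × Λ) (h : s + t = u) :
    (M.shift s).shift t ≅ M.shift u :=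
  isoOfZ
    ⟨(LinearMap.id : M →ₗ[R] M), fun i m hm => by
      have : m ∈ M.deg (i + t + s) := hm
      rwa [add_assoc, add_comm t, h] at this, fun _ => rfl⟩
    ⟨(LinearMap.id : M →ₗ[R] M), fun i m hm => by
      change m ∈ M.deg (i + t + s)
      rwa [add_assoc, add_comm t, h], fun _ => rfl⟩ rfl rfl

/-- The isomorphism `(cone f){s} ≅ cone (f{s})`. -/
def coneShiftIso {M N : DGMod 𝒜} (f : Z0 M N) (s : ℤ × Λ) :
    (cone f).shift s ≅ cone (shiftZ s M N f) :=
  isoOfZ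
    ⟨(LinearMap.id : M × N →ₗ[R] M × N), fun i m hm => ⟨by
      have : m.1 ∈ M.deg (i + s + (1, 0)) := hm.1
      rwa [add_right_comm] at this, hm.2⟩, fun _ => rfl⟩
    ⟨(LinearMap.id : M × N →ₗ[R] M × N), fun i m hm => ⟨by
      have : m.1 ∈ M.deg (i + (1, 0) + s) := hm.1
      rwa [add_right_comm] at this, hm.2⟩, fun _ => rfl⟩ rfl rfl

/-- An isomorphism of DG modules, as an isomorphism in the homotopy category. -/
def isoOfInv {M N : DGMod 𝒜} (f : Z0 M N) (g : Z0 N M) (hfg : ∀ m, g (f m) = m)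
    (hgf : ∀ n, f (g n) = n) : M ≅ N :=
  isoOfZ f g (cls_congr hfg) (cls_congr hgf)

end DGMod

variable {V : Type} (P : V → DGMod 𝒜) [Nonempty V]

lemma comp_inv_comp_hom {C : Type*} [Category* C] {X Y Z : C} (c : X ⟶ Y) (e : Z ≅ Y) :
    (c ≫ e.inv) ≫ e.hom = c := by simp

lemma K0.of_distTriang {C : Type*} [Category* C] [Preadditive C] [Limits.HasZeroObject C]
    [HasShift C ℤ] [∀ n : ℤ, (shiftFunctor C n).Additive] [Pretriangulated C] {T : Triangle C}
    (hT : T ∈ distTriang C) : K0.of T.obj₂ = K0.of T.obj₁ + K0.of T.obj₃ := by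
  rw [← sub_eq_zero]
  refine ((map_sub (QuotientAddGroup.mk' (K0Rel C)) _ _).trans
    (congrArg (_ - ·) (map_add _ _ _))).symm.trans ?_
  exact (QuotientAddGroup.eq_zero_iff _).2 (AddSubgroup.subset_closure ⟨T, hT, rfl⟩)

lemma K0.induction {C : Type*} [Category* C] [Preadditive C] [Limits.HasZeroObject C]
    [HasShift C ℤ] [∀ n : ℤ, (shiftFunctor C n).Additive] [Pretriangulated C]
    {G : AddSubgroup (K0 C)} (h : ∀ X : C, K0.of X ∈ G) (x : K0 C) : x ∈ G := by
  obtain ⟨x, rfl⟩ := QuotientAddGroup.mk'_surjective _ x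
  induction x using FreeAbelianGroup.induction_on with
  | zero => exact zero_mem G
  | of X => exact h X
  | neg X hX => rw [map_neg]; exact neg_mem hX
  | add x y hx hy => rw [map_add]; exact add_mem hx hy

namespace HP

variable {P}

/-- Relations in `K₀` can now be read off from triangles of DG modules. The third morphism is
corrected by the comparison isomorphism between the shift of the full subcategory and that of the
ambient category. -/
lemma of_distTriang {X Y Z : HP P} (a : X.obj ⟶ Y.obj) (b : Y.obj ⟶ Z.obj)
    (c : Z.obj ⟶ X.obj⟦(1 : ℤ)⟧) (h : Triangle.mk a b c ∈ distTriang (DGMod 𝒜)) :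
    K0.of Y = K0.of X + K0.of Z := by
  let T : Triangle (HP P) := Triangle.mk ((IsDGP P).fullyFaithfulι.preimage a)
    ((IsDGP P).fullyFaithfulι.preimage b) ((IsDGP P).fullyFaithfulι.preimage
      (c ≫ ((IsDGP P).ι.commShiftIso (1 : ℤ)).inv.app X))
  refine K0.of_distTriang (T := T) (isomorphic_distinguished _ h _
    (Triangle.isoMk _ _ (Iso.refl _) (Iso.refl _) (Iso.refl _) ?_ ?_ ?_))
  · refine (Category.comp_id _).trans (Eq.trans ?_ (Category.id_comp _).symm)
    exact (IsDGP P).fullyFaithfulι.map_preimage a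
  · refine (Category.comp_id _).trans (Eq.trans ?_ (Category.id_comp _).symm)
    exact (IsDGP P).fullyFaithfulι.map_preimage b
  · refine (congrArg (_ ≫ ·) (CategoryTheory.Functor.map_id _ _)).trans
      ((Category.comp_id _).trans (Eq.trans ?_ (Category.id_comp _).symm))
    refine (congrArg (· ≫ _) ((IsDGP P).fullyFaithfulι.map_preimage _)).trans ?_
    exact comp_inv_comp_hom c (((IsDGP P).ι.commShiftIso (1 : ℤ)).app X)

/-- The class of a DG module in `K₀`. -/
abbrev cl {M : DGMod 𝒜} (hM : IsDGP P M) : K0 (HP P) := K0.of ⟨M, hM⟩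

lemma cl_cone {M N : DGMod 𝒜} (f : Z0 M N) (hM : IsDGP P M) (hN : IsDGP P N) :
    cl (.cone f hM hN) = cl hN - cl hM := by
  have h := of_distTriang (X := ⟨M, hM⟩) (Y := ⟨N, hN⟩) (Z := ⟨_, .cone f hM hN⟩) (cls f)
    (cls (coneInr f)) (coneTriangle f).mor₃ (coneTriangle_mem f)
  exact eq_sub_of_add_eq' h.symm

/-- A zero object may stand in the third place of the contractible triangle, so `M → M → M` is
distinguished and gives `[M] = [M] + [M]`. -/
lemma cl_zero {M : DGMod 𝒜} (hM : IsDGP P M) (h : Limits.IsZero M) : cl hM = 0 := by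
  have h := of_distTriang (X := ⟨M, hM⟩) (Y := ⟨M, hM⟩) (Z := ⟨M, hM⟩) (𝟙 M) 0 0
    (isomorphic_distinguished _ (contractible_distinguished M) _
      (Triangle.isoMk _ _ (Iso.refl _) (Iso.refl _) (h.iso (Limits.isZero_zero _))
        ((Category.comp_id _).trans (Category.id_comp _).symm)
        ((Limits.isZero_zero _).eq_of_tgt _ _) (h.eq_of_src _ _)))
  exact left_eq_add.1 h

/-- The group is presented by objects, not by isomorphism classes, so invariance needs a triangle `M
→ N → Z` with `Z` a zero object; `Z` is the cone of the identity of a generator. Isomorphism here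
means homotopy equivalence. -/
lemma cl_iso {M N : DGMod 𝒜} (hM : IsDGP P M) (hN : IsDGP P N) (e : M ≅ N) : cl hM = cl hN := by
  obtain ⟨v⟩ := ‹Nonempty V›
  have hZ : IsDGP P (cone (P v).idZ) := .cone _ (.proj v) (.proj v)
  have h := of_distTriang (X := ⟨M, hM⟩) (Y := ⟨N, hN⟩) (Z := ⟨_, hZ⟩) e.hom 0 0
    (isomorphic_distinguished _ (contractible_distinguished M) _
      (Triangle.isoMk _ _ (Iso.refl _) e.symm ((isZero_cone_id (P v)).iso (Limits.isZero_zero _))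
        (e.hom_inv_id.trans (Category.id_comp _).symm) ((Limits.isZero_zero _).eq_of_tgt _ _) ((isZero_cone_id (P v)).eq_of_src _ _)))
  exact (h.trans ((congrArg _ (cl_zero hZ (isZero_cone_id _))).trans (add_zero _))).symm

/-- Rotating the cone triangle of the identity gives `M → cone (id) → M[1]`, with a zero object in
the middle. -/
lemma cl_shift_one {M : DGMod 𝒜} (hM : IsDGP P M) : cl (.shift (1, 0) hM) = -cl hM := by
  have hZ : IsDGP P (cone M.idZ) := .cone _ hM hM
  have h := of_distTriang (X := ⟨M, hM⟩) (Y := ⟨_, hZ⟩) (Z := ⟨_, .shift (1, 0) hM⟩)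
    (cls (coneInr M.idZ)) (coneTriangle M.idZ).mor₃ (-(cls M.idZ)⟦(1 : ℤ)⟧')
    (rot_of_distTriang _ (coneTriangle_mem M.idZ))
  have h0 := cl_zero hZ (isZero_cone_id _)
  rw [cl] at h0
  rw [h0] at h
  exact (neg_eq_of_add_eq_zero_right h.symm).symm

/-- The internal shift `l` survives: only the homological part contributes a sign, one for each
step. -/
lemma cl_shift {M : DGMod 𝒜} (hM : IsDGP P M) (n : ℤ) (l : Λ) :
    cl (.shift (n, l) hM) = (n.negOnePow : ℤ) • cl (.shift (0, l) hM) := by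
  have step : ∀ n : ℤ, cl (.shift (n + 1, l) hM) = -cl (.shift (n, l) hM) := fun n => by
    rw [← cl_shift_one]
    exact cl_iso _ _ (M.shiftShiftIso (n, l) (1, 0) (n + 1, l) (by simp)).symm
  induction n using Int.induction_on with
  | zero => simp
  | succ n ih => rw [step, ih, Int.negOnePow_succ]; simp
  | pred n ih =>
    have h := step (-n - 1)
    rw [sub_add_cancel] at h
    rw [← neg_inj, ← h, ih, Int.negOnePow_sub]
    simp

/-- The elements `[P(v){l}]` generate the Grothendieck group. -/
lemma cl_mem_closure (G : AddSubgroup (K0 (HP P)))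
    (hG : ∀ v l, K0.of ((HP.gen P v).twist l) ∈ G) (x : K0 (HP P)) : x ∈ G := by
  -- The claim is made for all shifts of `M` at once, so that the shift case of the induction is
  -- only a change of parameter.
  have key : ∀ {M : DGMod 𝒜} (hM : IsDGP P M) (s : ℤ × Λ), cl (.shift s hM) ∈ G := by
    intro M hM
    induction hM with
    | proj v =>
      rintro ⟨n, l⟩
      rw [cl_shift (.proj v)]
      exact zsmul_mem (hG v l) _
    | @shift M s hM ih =>
      intro t
      rw [cl_iso (.shift t (.shift s hM)) (.shift (s + t) hM) (M.shiftShiftIso s t _ rfl)]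
      exact ih _
    | @cone M N f hM hN ihM ihN =>
      intro s
      rw [cl_iso (.shift s (.cone f hM hN)) (.cone (shiftZ s M N f) (.shift s hM) (.shift s hN))
        (coneShiftIso f s), cl_cone (shiftZ s M N f) (.shift s hM) (.shift s hN)]
      exact sub_mem (ihN s) (ihM s)
    | @iso M N f g hfg hgf hM ih =>
      intro s
      rw [← cl_iso (.shift s hM) (.shift s (.iso f g hfg hgf hM))
        ((shiftF s).mapIso (isoOfInv f g hfg hgf))]
      exact ih s
  refine K0.induction (fun X => ?_) x
  have h := cl_iso X.property (.shift (0, 0) X.property) (shiftZeroIso.app X.obj).symm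
  change cl X.property ∈ G
  rw [h]
  exact key X.property _

/-- An additive invariant `χ` with values in a module on which twists act is compatible with twists
if this is so for the shifts of the generators. -/
lemma map_cl_shift {X : Type*} [AddCommGroup X] (χ : K0 (HP P) →+ X) (τ : Λ → X →+ X)
    (h : ∀ v l l', χ (K0.of ((HP.gen P v).twist (l + l'))) =
      τ l' (χ (K0.of ((HP.gen P v).twist l)))) (M : HP P) (l : Λ) :
    χ (K0.of (M.twist l)) = τ l (χ (K0.of M)) := by
  -- As for spanning, the induction runs over all shifts simultaneously; the original `M` is
  -- recovered at the end as its shift by zero.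
  have key : ∀ {M : DGMod 𝒜} (hM : IsDGP P M) (s : ℤ × Λ),
      χ (cl (.shift (0, l) (.shift s hM))) = τ l (χ (cl (.shift s hM))) := by
    intro M hM
    induction hM with
    | proj v =>
      rintro ⟨n, l'⟩
      rw [cl_iso (.shift (0, l) (.shift (n, l') (.proj v))) (.shift (n, l' + l) (.proj v))
        (shiftShiftIso _ _ _ _ (by simp)), cl_shift (.proj v), cl_shift (.proj v) n l', map_zsmul,
        map_zsmul, map_zsmul]
      exact congrArg _ (h v l' l)
    | @shift M s hM ih =>
      intro t
      rw [cl_iso (.shift (0, l) (.shift t (.shift s hM))) (.shift (0, l) (.shift (s + t) hM))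
          ((shiftF _).mapIso (M.shiftShiftIso s t _ rfl)),
        cl_iso (.shift t (.shift s hM)) (.shift (s + t) hM) (M.shiftShiftIso s t _ rfl)]
      exact ih _
    | @cone M N f hM hN ihM ihN =>
      intro s
      rw [cl_iso (.shift (0, l) (.shift s (.cone f hM hN)))
          (.cone (shiftZ (0, l) _ _ (shiftZ s M N f)) (.shift _ (.shift s hM))
            (.shift _ (.shift s hN)))
          ((shiftF _).mapIso (coneShiftIso f s) ≪≫ coneShiftIso _ _),
        cl_iso (.shift s (.cone f hM hN)) (.cone (shiftZ s M N f) (.shift s hM) (.shift s hN))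
          (coneShiftIso f s), cl_cone (shiftZ (0, l) _ _ (shiftZ s M N f)) (.shift _ (.shift s hM))
            (.shift _ (.shift s hN)), cl_cone (shiftZ s M N f) (.shift s hM) (.shift s hN), map_sub, map_sub, map_sub, ihM, ihN]
    | @iso M N f g hfg hgf hM ih =>
      intro s
      rw [← cl_iso (.shift (0, l) (.shift s hM)) (.shift (0, l) (.shift s (.iso f g hfg hgf hM)))
          ((shiftF _).mapIso ((shiftF s).mapIso (isoOfInv f g hfg hgf))),
        ← cl_iso (.shift s hM) (.shift s (.iso f g hfg hgf hM))
          ((shiftF s).mapIso (isoOfInv f g hfg hgf))]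
      exact ih s
  have e := (shiftZeroIso.app M.obj).symm
  change χ (cl (.shift (0, l) M.property)) = τ l (χ (cl M.property))
  rw [cl_iso (.shift (0, l) M.property) (.shift (0, l) (.shift (0, 0) M.property))
    ((shiftF _).mapIso e), cl_iso M.property (.shift (0, 0) M.property) e]
  exact key M.property _

end HP

end K0HP

end UTCat

namespace UTCat

/-! ### Euler characteristics and a basis of the Grothendieck group -/

section Euler

open DGMod

/-- The alternating sum of a family of numbers. -/
def altSum (a : ℤ → ℕ) : ℤ := ∑ᶠ n, (n.negOnePow : ℤ) * a n

lemma altSum_support {a : ℤ → ℕ} (ha : a.support.Finite) :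
    (Function.support fun n => (n.negOnePow : ℤ) * a n).Finite :=
  ha.subset fun n hn h => hn (by simp [h])

/-- The additivity of the alternating sum of the dimensions in a long exact sequence, with `p`, `q`
and `r` the ranks of the maps. -/
lemma altSum_add {a b c p q r : ℤ → ℕ} (hb : ∀ n, b n = p n + q n) (ha : ∀ n, a n = q n + r n)
    (hc : ∀ n, c (n + 1) = r n + p (n + 1)) (fa : a.support.Finite) (fc : c.support.Finite) :
    altSum b = altSum a + altSum c := by
  -- A `finsum` is additive only for finite supports, and the ranks inherit theirs from the
  -- dimensions that bound them.
  have fp : p.support.Finite := fc.subset fun n hn h => hn (by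
    have := hc (n - 1)
    simp only [sub_add_cancel] at this
    omega)
  have fq : q.support.Finite := fa.subset fun n hn h => hn (by have := ha n; omega)
  have fr : r.support.Finite := fa.subset fun n hn h => hn (by have := ha n; omega)
  have fr' : (fun n => r (n - 1)).support.Finite := fc.subset fun n hn h => hn (by
    have := hc (n - 1)
    simp only [sub_add_cancel] at this
    change r (n - 1) = 0
    omega)
  have h1 : altSum b = altSum p + altSum q := by
    rw [altSum, altSum, altSum, ← finsum_add_distrib (altSum_support fp) (altSum_support fq)]
    exact finsum_congr fun n => by rw [hb]; push_cast; ring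
  have h2 : altSum a = altSum q + altSum r := by
    rw [altSum, altSum, altSum, ← finsum_add_distrib (altSum_support fq) (altSum_support fr)]
    exact finsum_congr fun n => by rw [ha]; push_cast; ring
  have h3 : altSum c = altSum (fun n => r (n - 1)) + altSum p := by
    rw [altSum, altSum, altSum, ← finsum_add_distrib (altSum_support fr') (altSum_support fp)]
    refine finsum_congr fun n => ?_
    have := hc (n - 1)
    simp only [sub_add_cancel] at this
    rw [this]; push_cast; ring
  -- Moving the index by one changes the sign, so the ranks of the connecting maps cancel between
  -- `a` and `c`.
  have h4 : altSum (fun n => r (n - 1)) = -altSum r := by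
    rw [altSum, altSum, ← finsum_neg_distrib,
      ← finsum_comp_equiv (Equiv.addRight (1 : ℤ))]
    refine finsum_congr fun n => ?_
    simp [Int.negOnePow_succ]
  rw [h1, h2, h3, h4]
  ring

variable {Λ : Type} [AddCommGroup Λ] [DecidableEq Λ] {R : Type} [Ring R] [Algebra (ZMod 2) R]
  {𝒜 : ℤ × Λ → Submodule (ZMod 2) R}

namespace DGMod

instance (M N : DGMod 𝒜) : Module (ZMod 2) (M ⟶ N) :=
  AddCommGroup.zmodModule fun f => by
    rw [two_nsmul]
    exact (neg_eq_iff_add_eq_zero).1 (neg_hom f)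

/-! ### The long exact sequence of morphisms into shifts -/

section LongExact

variable (T : Triangle (DGMod 𝒜)) (K : DGMod 𝒜) (n : ℤ) (l : Λ)

/-- Precomposition, as a linear map. -/
def precomp {M N : DGMod 𝒜} (f : M ⟶ N) (K : DGMod 𝒜) : (N ⟶ K) →ₗ[ZMod 2] (M ⟶ K) :=
  AddMonoidHom.toZModLinearMap 2 (Preadditive.leftComp K f)

lemma precomp_apply {M N : DGMod 𝒜} (f : M ⟶ N) {K : DGMod 𝒜} (g : N ⟶ K) :
    precomp f K g = f ≫ g := rfl

/-- The isomorphism `K[n]{l}[1] ≅ K[n + 1]{l}`. -/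
def shiftSuccIso : (K.shift (n, l))⟦(1 : ℤ)⟧ ≅ K.shift (n + 1, l) :=
  K.shiftShiftIso (n, l) (1, 0) (n + 1, l) (by simp)

/-- The connecting homomorphism. -/
def connecting : (T.obj₁ ⟶ K.shift (n, l)) →ₗ[ZMod 2] (T.obj₃ ⟶ K.shift (n + 1, l)) :=
  AddMonoidHom.toZModLinearMap 2
    { toFun := fun x => T.mor₃ ≫ x⟦(1 : ℤ)⟧' ≫ (K.shiftSuccIso n l).hom
      map_zero' := by simp
      map_add' := fun x y => by simp }

lemma connecting_apply (x : T.obj₁ ⟶ K.shift (n, l)) : connecting T K n l x =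
    T.mor₃ ≫ x⟦(1 : ℤ)⟧' ≫ (K.shiftSuccIso n l).hom := rfl

variable {T} (hT : T ∈ distTriang (DGMod 𝒜))

include hT in
lemma range_precomp_mor₂ (K : DGMod 𝒜) :
    LinearMap.range (precomp T.mor₂ K) = LinearMap.ker (precomp T.mor₁ K) := by
  ext x
  simp only [LinearMap.mem_range, LinearMap.mem_ker, precomp_apply]
  constructor
  · rintro ⟨y, rfl⟩
    rw [comp_distTriang_mor_zero₁₂_assoc _ hT, Limits.zero_comp]
  · intro h
    obtain ⟨y, hy⟩ := T.yoneda_exact₂ hT x h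
    exact ⟨y, hy.symm⟩

include hT in
lemma range_precomp_mor₁ :
    LinearMap.range (precomp T.mor₁ (K.shift (n, l))) = LinearMap.ker (connecting T K n l) := by
  ext x
  simp only [LinearMap.mem_range, LinearMap.mem_ker, precomp_apply, connecting_apply]
  constructor
  · rintro ⟨y, rfl⟩
    rw [CategoryTheory.Functor.map_comp, Category.assoc, comp_distTriang_mor_zero₃₁_assoc _ hT,
      Limits.zero_comp]
  · intro h
    rw [← Category.assoc] at h
    have h' := (Limits.zero_of_comp_mono _ h)
    obtain ⟨y, hy⟩ := T.rotate.yoneda_exact₃ (rot_of_distTriang _ hT) (x⟦(1 : ℤ)⟧') h'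
    -- Exactness of the rotated triangle gives a factorization after applying `[1]`; as `[1]` is
    -- fully faithful, it comes from a factorization of `x` itself.
    obtain ⟨z, rfl⟩ := (shiftFunctor (DGMod 𝒜) (1 : ℤ)).map_surjective y
    refine ⟨z, (shiftFunctor (DGMod 𝒜) (1 : ℤ)).map_injective ?_⟩
    refine (CategoryTheory.Functor.map_comp _ _ _).trans (Eq.trans ?_ hy.symm)
    exact (congrArg (· ≫ _) (neg_hom (T.mor₁⟦(1 : ℤ)⟧'))).symm

include hT in
lemma range_connecting :
    LinearMap.range (connecting T K n l) = LinearMap.ker (precomp T.mor₂ (K.shift (n + 1, l))) := by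
  ext x
  simp only [LinearMap.mem_range, LinearMap.mem_ker, precomp_apply, connecting_apply]
  constructor
  · rintro ⟨y, rfl⟩
    rw [comp_distTriang_mor_zero₂₃_assoc _ hT, Limits.zero_comp]
  · intro h
    obtain ⟨y, hy⟩ := T.yoneda_exact₃ hT x h
    obtain ⟨z, hz⟩ := (shiftFunctor (DGMod 𝒜) (1 : ℤ)).map_surjective
      (y ≫ (K.shiftSuccIso n l).inv)
    refine ⟨z, ?_⟩
    rw [hz, hy, Category.assoc, Iso.inv_hom_id, Category.comp_id]

end LongExact

/-! ### Euler characteristics -/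

/-- The dimension of the space of morphisms to a shift of `K`. -/
def hdim (K : DGMod 𝒜) (l : Λ) (M : DGMod 𝒜) (n : ℤ) : ℕ :=
  Module.finrank (ZMod 2) (M ⟶ K.shift (n, l))

/-- The morphisms to the shifts of `K` form a finite-dimensional space. -/
structure HomFinite (K : DGMod 𝒜) (l : Λ) (M : DGMod 𝒜) : Prop where
  finite : ∀ n, Module.Finite (ZMod 2) (M ⟶ K.shift (n, l))
  support : (hdim K l M).support.Finite

/-- The Euler characteristic of the morphisms to the shifts of `K`. -/
def euler (K : DGMod 𝒜) (l : Λ) (M : DGMod 𝒜) : ℤ := altSum (hdim K l M)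

variable {K : DGMod 𝒜} {l : Λ}

lemma hdim_iso {M N : DGMod 𝒜} (e : M ≅ N) : hdim K l M = hdim K l N := by
  funext n
  exact (LinearEquiv.ofLinearMap (precomp e.inv _) (precomp e.hom _)
    (LinearMap.ext fun x => by simp [precomp_apply])
    (LinearMap.ext fun x => by simp [precomp_apply])).finrank_eq

lemma HomFinite.of_iso {M N : DGMod 𝒜} (e : M ≅ N) (h : HomFinite K l M) : HomFinite K l N where
  finite n := by
    have := h.finite n
    refine Module.Finite.of_surjective (precomp e.inv (K.shift (n, l))) fun x => ⟨e.hom ≫ x, ?_⟩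
    simp [precomp_apply]
  support := by rw [← hdim_iso e]; exact h.support

section

variable {T : Triangle (DGMod 𝒜)} (hT : T ∈ distTriang (DGMod 𝒜))

include hT in
-- The morphisms from the third object in degree `n + 1` lie in the exact sequence between those
-- from the first in degree `n` and those from the second in degree `n + 1`. Both finiteness
-- conditions follow, with the support of the first moved by one.
lemma HomFinite.obj₃ (h₁ : HomFinite K l T.obj₁) (h₂ : HomFinite K l T.obj₂) :
    HomFinite K l T.obj₃ := by
  have fin : ∀ n, Module.Finite (ZMod 2) (T.obj₃ ⟶ K.shift (n + 1, l)) := fun n => by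
    have := h₁.finite n
    have := h₂.finite (n + 1)
    have := isNoetherian_of_range_eq_ker _ _ (range_connecting K n l hT)
    exact Module.IsNoetherian.finite _ _
  refine ⟨fun n => by
    have := fin (n - 1)
    rwa [sub_add_cancel] at this, ?_⟩
  refine ((h₁.support.image (· + 1)).union h₂.support).subset fun n hn => ?_
  by_contra hc
  simp only [Set.mem_union, Set.mem_image, not_or, not_exists, not_and] at hc
  obtain ⟨n, rfl⟩ : ∃ m, n = m + 1 := ⟨n - 1, by simp⟩
  have := fin n
  have := h₁.finite n
  have := h₂.finite (n + 1)
  have e := LinearMap.finrank_range_add_finrank_ker (precomp T.mor₂ (K.shift (n + 1, l)))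
  rw [← range_connecting K n l hT] at e
  have h1 := LinearMap.finrank_range_le (connecting T K n l)
  have h2 := Submodule.finrank_le (LinearMap.range (precomp T.mor₂ (K.shift (n + 1, l))))
  have a : hdim K l T.obj₁ n = 0 := by
    by_contra h
    exact hc.1 n h rfl
  have b : hdim K l T.obj₂ (n + 1) = 0 := by
    by_contra h
    exact hc.2 h
  have c : hdim K l T.obj₃ (n + 1) ≠ 0 := hn
  simp only [hdim] at a b c
  omega

include hT in
-- Rank and nullity at the three places of the long exact sequence are exactly the hypotheses of
-- `altSum_add`.
lemma euler_add (h₁ : HomFinite K l T.obj₁) (h₂ : HomFinite K l T.obj₂) :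
    euler K l T.obj₂ = euler K l T.obj₁ + euler K l T.obj₃ := by
  have h₃ := HomFinite.obj₃ hT h₁ h₂
  have := h₁.finite
  have := h₂.finite
  have := h₃.finite
  refine altSum_add
    (p := fun n => Module.finrank (ZMod 2) (LinearMap.range (precomp T.mor₂ (K.shift (n, l)))))
    (q := fun n => Module.finrank (ZMod 2) (LinearMap.range (precomp T.mor₁ (K.shift (n, l)))))
    (r := fun n => Module.finrank (ZMod 2) (LinearMap.range (connecting T K n l)))
    (fun n => ?_) (fun n => ?_) (fun n => ?_) h₁.support h₃.support
  · rw [range_precomp_mor₂ hT, add_comm]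
    exact (LinearMap.finrank_range_add_finrank_ker (precomp T.mor₁ (K.shift (n, l)))).symm
  · rw [range_precomp_mor₁ K n l hT, add_comm]
    exact (LinearMap.finrank_range_add_finrank_ker (connecting T K n l)).symm
  · have h := LinearMap.finrank_range_add_finrank_ker (precomp T.mor₂ (K.shift (n + 1, l)))
    rw [← range_connecting K n l hT, add_comm] at h
    exact h.symm

end

/-- Finiteness on all shifts of the generators is assumed because the induction again needs every
shift of `M`. -/
lemma homFinite_of_isDGP {V : Type} {P : V → DGMod 𝒜}
    (hP : ∀ v s, HomFinite K l ((P v).shift s)) {M : DGMod 𝒜} (hM : IsDGP P M) (s : ℤ × Λ) :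
    HomFinite K l (M.shift s) := by
  induction hM generalizing s with
  | proj v => exact hP v s
  | @shift M t hM ih => exact (ih (t + s)).of_iso (M.shiftShiftIso t s _ rfl).symm
  | @cone M N f hM hN ihM ihN =>
    exact (HomFinite.obj₃ (coneTriangle_mem (shiftZ s M N f)) (ihM s) (ihN s)).of_iso
      (coneShiftIso f s).symm
  | @iso M N f g hfg hgf hM ih =>
    exact (ih s).of_iso ((shiftF s).mapIso (isoOfInv f g hfg hgf))

/-- The Euler characteristic, as a homomorphism on `K₀`. -/
def eulerHom {V : Type} [Nonempty V] {P : V → DGMod 𝒜} (K : DGMod 𝒜) (l : Λ)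
    (hP : ∀ v s, HomFinite K l ((P v).shift s)) : K0 (HP P) →+ ℤ :=
  QuotientAddGroup.lift _ (FreeAbelianGroup.lift fun X : HP P => euler K l X.obj) (by
    rw [K0Rel, AddSubgroup.closure_le]
    rintro _ ⟨T, hT, rfl⟩
    have h := fun X : HP P => (homFinite_of_isDGP hP X.property (0, 0)).of_iso
      (shiftZeroIso.app X.obj)
    have e := euler_add ((IsDGP P).ι.map_distinguished T hT) (h T.obj₁) (h T.obj₂)
    change FreeAbelianGroup.lift _ _ = 0
    simp only [map_sub, map_add, FreeAbelianGroup.lift_apply_of]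
    exact sub_eq_zero.2 e)

lemma eulerHom_of {V : Type} [Nonempty V] {P : V → DGMod 𝒜}
    (hP : ∀ v s, HomFinite K l ((P v).shift s)) (X : HP P) :
    eulerHom K l hP (K0.of X) = euler K l X.obj := by
  refine (QuotientAddGroup.lift_mk' _ _ _).trans ?_
  exact FreeAbelianGroup.lift_apply_of _ _

/-! #### Simple modules -/

/-- The module given by a character of `R` which vanishes in nonzero degrees. -/
def simple (ε : R →ₐ[ZMod 2] ZMod 2) (hε : ∀ i, i ≠ 0 → ∀ a ∈ 𝒜 i, ε a = 0) : DGMod 𝒜 where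
  carrier := ZMod 2
  mod := Module.compHom (ZMod 2) (ε : R →+* ZMod 2)
  deg i := { carrier := {x | i ≠ 0 → x = 0}
             zero_mem' := fun _ => rfl
             add_mem' := fun {x y} hx hy h => by rw [hx h, hy h, add_zero]
             neg_mem' := fun {x} hx h => by rw [hx h, neg_zero] }
  isInternal := isInternal_mk _
    ((DirectSum.of _ (0 : ℤ × Λ)).comp
      ((AddMonoidHom.id (ZMod 2)).codRestrict _ fun _ h => absurd rfl h))
    (fun m => by
      rw [AddMonoidHom.comp_apply, DirectSum.coeAddMonoidHom_of]; rfl)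
    (fun i x => by
      by_cases hi : i = 0
      · subst hi; rfl
      · have hx : x = 0 := Subtype.ext (x.2 hi)
        rw [hx, map_zero]
        exact map_zero _)
  smul_mem {i j a m} ha hm h := by
    change ε a * m = 0
    by_cases hj : j = 0
    · rw [hε i (fun hi => h (by rw [hi, hj, add_zero])) a ha, zero_mul]
    · rw [hm hj, mul_zero]
  d := 0
  d_mem _ := zero_mem _
  d_d _ := rfl

lemma simple_smul {ε : R →ₐ[ZMod 2] ZMod 2} {hε : ∀ i, i ≠ 0 → ∀ a ∈ 𝒜 i, ε a = 0} {a : R}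
    (ha : ε a = 0) (x : simple ε hε) : a • x = 0 :=
  (show ∀ y : ZMod 2, ε a * y = 0 by simp [ha]) x

section Simple

variable [GradedAlgebra 𝒜] {e : R} {he0 : e ∈ 𝒜 0} {he : e * e = e} {ε : R →ₐ[ZMod 2] ZMod 2}
  {hε : ∀ i, i ≠ 0 → ∀ a ∈ 𝒜 i, ε a = 0}

/-- The generator of `Re`. -/
def projGen (he0 : e ∈ 𝒜 0) (he : e * e = e) : projMod 𝒜 e he0 he :=
  ⟨e, Submodule.mem_span_singleton_self e⟩

lemma projMod_smul (m : projMod 𝒜 e he0 he) : (m : Submodule.span R {e}).1 • projGen he0 he = m :=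
  Subtype.ext (mul_eq_self_of_mem_span he m.2)

/-- A closed morphism out of `Re` is determined by the image of the generator. -/
lemma Z0_projMod_ext {s : ℤ × Λ} {N : DGMod 𝒜} {f g : Z0 ((projMod 𝒜 e he0 he).shift s) N}
    (h : f (projGen he0 he) = g (projGen he0 he)) : f = g := by
  refine Subtype.ext (LinearMap.ext fun (m : projMod 𝒜 e he0 he) => ?_)
  rw [← projMod_smul m]
  exact (map_smul f.1 _ (projGen he0 he)).trans ((congrArg _ h).trans
    (map_smul g.1 _ (projGen he0 he)).symm)

/-- A morphism is determined by the image of the generator `e`. That generator has degree `-s`,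
while the target is concentrated in degree `-t`; moreover `e` fixes the generator but acts on the
target by `ε e`. -/
lemma hom_projMod_simple_eq_zero {s t : ℤ × Λ} (h : s ≠ t ∨ ε e = 0)
    (f : (projMod 𝒜 e he0 he).shift s ⟶ (simple ε hε).shift t) : f = 0 := by
  obtain ⟨f, rfl⟩ := cls_surjective f
  have hf : f = 0 := by
    refine Z0_projMod_ext ?_
    change f (projGen he0 he) = (0 : ZMod 2)
    rcases h with h | h
    · have h1 : projGen he0 he ∈ ((projMod 𝒜 e he0 he).shift s).deg (-s) := by
        change e ∈ 𝒜 (-s + s)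
        rwa [neg_add_cancel]
      have h2 : f (projGen he0 he) ∈ (simple ε hε).deg (-s + t) := f.2.1 _ _ h1
      exact h2 fun hc => h (neg_add_eq_zero.1 hc)
    · have h1 := map_smul f.1 e (projGen he0 he)
      have h2 : e • projGen he0 he = projGen he0 he := Subtype.ext he
      exact (congrArg f.1 h2).symm.trans (h1.trans (simple_smul (𝒜 := 𝒜) (hε := hε) h _))
  rw [hf]
  exact map_zero (clsHom _ _)

/-- The morphism from `Re` to the module of a character. -/
def toSimple (he0 : e ∈ 𝒜 0) (he : e * e = e) (hε : ∀ i, i ≠ 0 → ∀ a ∈ 𝒜 i, ε a = 0) (s : ℤ × Λ) :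
    Z0 ((projMod 𝒜 e he0 he).shift s) ((simple ε hε).shift s) :=
  ⟨{ toFun := fun (m : Submodule.span R {e}) => ε m.1
     map_add' := fun x y => map_add ε x.1 y.1
     map_smul' := fun a x => map_mul ε a x.1 }, fun _ _ hm h => hε _ h _ hm, fun _ => map_zero ε⟩

/-- Both differentials vanish, so only the zero morphism is null-homotopic, and a morphism is given
by the image of the generator, one bit. The nonzero one is the character itself. -/
lemma hom_projMod_simple_finrank (h : ε e = 1) (s : ℤ × Λ) :
    Module.finrank (ZMod 2) ((projMod 𝒜 e he0 he).shift s ⟶ (simple ε hε).shift s) = 1 := by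
  have key : ∀ f : Z0 ((projMod 𝒜 e he0 he).shift s) ((simple ε hε).shift s),
      cls f = 0 → (f (projGen he0 he) : ZMod 2) = 0 := by
    intro f hf
    obtain ⟨h, -, hh⟩ := (QuotientAddGroup.eq_zero_iff (N := B0 _ _) f).1 hf
    refine (hh (projGen he0 he)).trans ?_
    -- Both terms of `d h + h d` vanish, the differentials being zero.
    exact (zero_add _).trans (map_zero h)
  refine finrank_eq_one (cls (toSimple he0 he hε s)) (fun h0 => ?_) fun f => ?_
  · have := key _ h0
    change ε e = 0 at this
    rw [h] at this
    exact one_ne_zero this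
  · obtain ⟨f, rfl⟩ := cls_surjective f
    rcases (show ∀ c : ZMod 2, c = 0 ∨ c = 1 by decide) (f (projGen he0 he)) with h1 | h1
    · refine ⟨0, (zero_smul _ _).trans ?_⟩
      have : f = 0 := Z0_projMod_ext h1
      rw [this]
      exact (map_zero (clsHom _ _)).symm
    · refine ⟨1, (one_smul _ _).trans (congrArg cls (Z0_projMod_ext ?_))⟩
      exact Eq.trans (show _ = (1 : ZMod 2) from h) h1.symm

lemma hdim_simple (h : ε e = 1) (s : ℤ × Λ) (l : Λ) :
    hdim (simple ε hε) l ((projMod 𝒜 e he0 he).shift s) = fun n => if s = (n, l) then 1 else 0 := by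
  funext n
  split_ifs with hn
  · subst hn; exact hom_projMod_simple_finrank h _
  · have : Subsingleton ((projMod 𝒜 e he0 he).shift s ⟶ (simple ε hε).shift (n, l)) :=
      ⟨fun f g => by
        rw [hom_projMod_simple_eq_zero (.inl hn) f, hom_projMod_simple_eq_zero (.inl hn) g]⟩
    exact Module.finrank_zero_of_subsingleton

lemma hdim_simple_of_ne (h : ε e = 0) (s : ℤ × Λ) (l : Λ) :
    hdim (simple ε hε) l ((projMod 𝒜 e he0 he).shift s) = 0 := by
  funext n
  have : Subsingleton ((projMod 𝒜 e he0 he).shift s ⟶ (simple ε hε).shift (n, l)) :=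
    ⟨fun f g => by
      rw [hom_projMod_simple_eq_zero (.inr h) f, hom_projMod_simple_eq_zero (.inr h) g]⟩
  exact Module.finrank_zero_of_subsingleton

lemma homFinite_simple (h : ε e = 0 ∨ ε e = 1) (s : ℤ × Λ) (l : Λ) :
    HomFinite (simple ε hε) l ((projMod 𝒜 e he0 he).shift s) := by
  rcases h with h | h
  · refine ⟨fun n => ?_, by rw [hdim_simple_of_ne h]; simp⟩
    have : Subsingleton ((projMod 𝒜 e he0 he).shift s ⟶ (simple ε hε).shift (n, l)) :=
      ⟨fun f g => by
        rw [hom_projMod_simple_eq_zero (.inr h) f, hom_projMod_simple_eq_zero (.inr h) g]⟩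
    infer_instance
  · refine ⟨fun n => ?_, ?_⟩
    · by_cases hn : s = (n, l)
      · subst hn
        exact Module.finite_of_finrank_pos (by rw [hom_projMod_simple_finrank h]; exact one_pos)
      · have : Subsingleton ((projMod 𝒜 e he0 he).shift s ⟶ (simple ε hε).shift (n, l)) :=
          ⟨fun f g => by
            rw [hom_projMod_simple_eq_zero (.inl hn) f, hom_projMod_simple_eq_zero (.inl hn) g]⟩
        infer_instance
    · refine (Set.finite_singleton s.1).subset fun n hn => ?_
      rw [Function.mem_support, hdim_simple h] at hn
      by_contra hc
      exact hn (if_neg fun hs => hc (by rw [hs]; rfl))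

end Simple

end DGMod

/-! #### The Grothendieck group -/

section Basis

variable [GradedAlgebra 𝒜] {V : Type} [Nonempty V] [DecidableEq V] {e : V → R} (he0 : ∀ v, e v ∈ 𝒜 0)
  (he : ∀ v, e v * e v = e v) (ε : V → R →ₐ[ZMod 2] ZMod 2)
  (hε : ∀ v i, i ≠ 0 → ∀ a ∈ 𝒜 i, ε v a = 0) (hεe : ∀ v w, ε v (e w) = if v = w then 1 else 0)

/-- The coordinate of an element of `K₀` at `[P(v){l}]`. -/
def coord (v : V) (l : Λ) : K0 (HP fun v => projMod 𝒜 (e v) (he0 v) (he v)) →+ ℤ :=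
  eulerHom (simple (ε v) (hε v)) l fun w s => homFinite_simple (by
    rw [hεe]; split_ifs <;> simp) s l

/-- The simple modules are dual to the projectives: the Euler pairing between the two families is
the identity matrix. This is the source of linear independence. -/
lemma coord_of (v w : V) (l m : Λ) : coord he0 he ε hε hεe v l
    (K0.of ((HP.gen (fun v => projMod 𝒜 (e v) (he0 v) (he v)) w).twist m)) =
      if w = v ∧ m = l then 1 else 0 := by
  refine (eulerHom_of _ _).trans ?_
  change altSum (hdim _ l ((projMod 𝒜 (e w) (he0 w) (he w)).shift (0, m))) = _
  by_cases hw : v = w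
  · subst hw
    rw [hdim_simple (by rw [hεe, if_pos rfl]), altSum, finsum_eq_single _ (0 : ℤ)]
    · simp [Prod.ext_iff]
    · intro n hn
      rw [if_neg fun h => hn (congrArg Prod.fst h).symm]
      simp
  · rw [hdim_simple_of_ne (by rw [hεe, if_neg hw]), if_neg fun h => hw h.1.symm]
    simp [altSum]

/-- The Grothendieck group is free with basis `[P(v){l}]`. -/
def K0Basis : Module.Basis (V × Λ) ℤ (K0 (HP fun v => projMod 𝒜 (e v) (he0 v) (he v))) :=
  .mk (v := fun p => K0.of ((HP.gen (fun v => projMod 𝒜 (e v) (he0 v) (he v)) p.1).twist p.2))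
    (by
      rw [linearIndependent_iff]
      intro c hc
      ext ⟨v, l⟩
      -- The coordinate at `(v, l)` isolates the coefficient of `[P(v){l}]` in the relation.
      have h := congrArg (coord he0 he ε hε hεe v l) hc
      rw [map_zero, Finsupp.linearCombination_apply, Finsupp.sum, map_sum] at h
      refine Eq.trans ?_ h
      rw [Finset.sum_eq_single (v, l)]
      · simp [coord_of]
      · rintro ⟨w, m⟩ - hne
        rw [map_zsmul, coord_of, if_neg fun h => hne (Prod.ext h.1 h.2), smul_zero]
      · intro hn
        rw [Finsupp.notMem_support_iff.1 hn, zero_smul, map_zero])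
    (fun x _ => HP.cl_mem_closure (Submodule.span ℤ _).toAddSubgroup
      (fun v l => Submodule.subset_span (Set.mem_range_self (v, l))) x)

lemma K0Basis_apply (v : V) (l : Λ) : K0Basis he0 he ε hε hεe (v, l) =
    K0.of ((HP.gen (fun v => projMod 𝒜 (e v) (he0 v) (he v)) v).twist l) :=
  Module.Basis.mk_apply _ _ _

end Basis

end Euler

end UTCat

namespace UTCat

/-! ### Characters of presented algebras -/

/-- A word of nonzero total weight contains a letter of nonzero weight, and `ψ` is multiplicative
and kills that letter. -/
lemma presDeg_eq_zero {k X ι A : Type} [CommRing k] [AddCommMonoid ι] [Ring A] [Algebra k A]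
    {w : X → ι} {r : FreeAlgebra k X → FreeAlgebra k X → Prop} {ψ : RingQuot r →ₐ[k] A}
    (h : ∀ x, w x ≠ 0 → ψ (gen r x) = 0) {i : ι} (hi : i ≠ 0) {a : RingQuot r}
    (ha : a ∈ presDeg w r i) : ψ a = 0 := by
  obtain ⟨a, ha, rfl⟩ := ha
  change ψ (RingQuot.mkAlgHom k r a) = 0
  induction ha using Submodule.span_induction with
  | mem x hx =>
    obtain ⟨l, rfl, rfl⟩ := hx
    induction l with
    | nil => exact absurd List.sum_nil hi
    | cons x l ih =>
      rw [List.map_cons, List.prod_cons, map_mul, map_mul]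
      by_cases hx : w x = 0
      · rw [ih (by simpa [hx] using hi), mul_zero]
      · have : ψ (RingQuot.mkAlgHom k r (FreeAlgebra.ι k x)) = 0 := h x hx
        rw [this, zero_mul]
  | zero => rw [map_zero, map_zero]
  | add x y _ _ hx hy => rw [map_add, map_add, hx, hy, add_zero]
  | smul c x _ hx => rw [map_smul, map_smul, hx, smul_zero]

namespace AlgA

/-- The values on the generators of the character of `A` at `γ`. -/
def charGen (γ : Bas) : AGen → ZMod 2
  | .e γ' => if γ = γ' then 1 else 0
  | _ => 0

/-- The character of `A` at `γ`. -/
def char (γ : Bas) : AlgA →ₐ[ZMod 2] ZMod 2 :=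
  RingQuot.liftAlgHom (ZMod 2) ⟨FreeAlgebra.lift (ZMod 2) (charGen γ), by
    -- Apart from the three relations among idempotents, every nonzero term of a relation contains
    -- an arrow, which the character kills.
    rintro _ _ (_ | _ | _ | _ | _ | _ | _ | _) <;>
      simp only [map_sum, map_mul, map_one, map_zero, FreeAlgebra.lift_ι_apply, charGen]
    · simp
    · split_ifs <;> simp
    · rename_i h
      split_ifs with h1 h2
      · exact absurd (h1.symm.trans h2) h
      all_goals simp
    all_goals simp⟩

lemma char_gen (γ : Bas) (x : AGen) : char γ (gen ARel x) = charGen γ x :=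
  (RingQuot.liftAlgHom_mkAlgHom_apply ..).trans (FreeAlgebra.lift_ι_apply _ _)

lemma char_e (γ γ' : Bas) : char γ (e γ') = if γ = γ' then 1 else 0 := char_gen γ (.e γ')

lemma char_eq_zero (γ : Bas) (i : ℤ × ℤ) (hi : i ≠ 0) (a : AlgA) (ha : a ∈ deg i) :
    char γ a = 0 := by
  refine presDeg_eq_zero (ψ := char γ) (fun x hx => ?_) hi ha
  refine (char_gen γ x).trans ?_
  rcases x with _ | _ | _
  · exact absurd rfl hx
  · rfl
  · rfl

end AlgA

namespace AlgB

/-- The values on the generators of the character of `B` at `p`. -/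
def charGen (p : Bas × Bas) : BGen → ZMod 2
  | .e q => if p = q then 1 else 0
  | _ => 0

/-- The character of `B` at `p`. -/
def char (p : Bas × Bas) : AlgB →ₐ[ZMod 2] ZMod 2 :=
  RingQuot.liftAlgHom (ZMod 2) ⟨FreeAlgebra.lift (ZMod 2) (charGen p), by
    rintro _ _ (_ | _ | _ | _ | _ | _ | _ | _ | _ | _ | _ | _ | _ | _ | _ | _ | _) <;>
      simp only [map_sum, map_mul, map_one, map_zero, FreeAlgebra.lift_ι_apply, charGen]
    · simp
    · split_ifs <;> simp
    · rename_i h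
      split_ifs with h1 h2
      · exact absurd (h1.symm.trans h2) h
      all_goals simp
    all_goals simp⟩

lemma char_gen (p : Bas × Bas) (x : BGen) : char p (gen BRel x) = charGen p x :=
  (RingQuot.liftAlgHom_mkAlgHom_apply ..).trans (FreeAlgebra.lift_ι_apply _ _)

lemma char_e (p q : Bas × Bas) : char p (e q) = if p = q then 1 else 0 := char_gen p (.e q)

lemma char_eq_zero (p : Bas × Bas) (i : ℤ × ℤ × ℤ) (hi : i ≠ 0) (a : AlgB) (ha : a ∈ deg i) :
    char p a = 0 := by
  refine presDeg_eq_zero (ψ := char p) (fun x hx => ?_) hi ha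
  refine (char_gen p x).trans ?_
  rcases x with _ | _
  · exact absurd rfl hx
  · rfl

end AlgB

/-! ### A basis of `U_T` -/

namespace UT

/-- The powers of `T`. -/
def Tpow (l : ℤ) : UT := (Tunit ^ l : UTˣ)

lemma Tpow_zero : Tpow 0 = 1 := congrArg Units.val (zpow_zero Tunit)

lemma Tpow_one : Tpow 1 = T := congrArg Units.val (zpow_one Tunit)

lemma Tpow_neg_one : Tpow (-1) = Tinv := congrArg Units.val (zpow_neg_one Tunit)

lemma Tpow_add (l m : ℤ) : Tpow (l + m) = Tpow l * Tpow m :=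
  congrArg Units.val (zpow_add Tunit l m)

lemma E_mul_Tpow (l : ℤ) : E * Tpow l = Tpow l * E :=
  (show Commute E (Tunit : UT) from E_mul_T).units_zpow_right l

lemma F_mul_Tpow (l : ℤ) : F * Tpow l = Tpow l * F :=
  (show Commute F (Tunit : UT) from F_mul_T).units_zpow_right l

lemma Tpow_mem (l : ℤ) : Tpow l ∈ deg 0 := by
  have h : ∀ {a b : UT}, a ∈ deg 0 → b ∈ deg 0 → a * b ∈ deg 0 := fun {a b} ha hb => by
    have : a * b ∈ deg (0 + 0) := SetLike.GradedMul.mul_mem ha hb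
    rwa [add_zero] at this
  induction l using Int.induction_on with
  | zero =>
    have : (1 : UT) ∈ deg 0 := SetLike.GradedOne.one_mem
    rwa [Tpow_zero]
  | succ n ih => rw [Tpow_add, Tpow_one]; exact h ih T_mem
  | pred n ih => rw [sub_eq_add_neg, Tpow_add, Tpow_neg_one]; exact h ih Tinv_mem

open Finsupp in
/-- The images of the vectors of the basis `T^l γ` under the generators of `U_T`. -/
def repGen : UGen → Bas × ℤ → (Bas × ℤ →₀ ℤ)
  | .E, (.I, l) => single (.E, l) 1
  | .E, (.E, _) => 0
  | .E, (.F, l) => single (.EF, l) 1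
  | .E, (.EF, _) => 0
  | .F, (.I, l) => single (.F, l) 1
  -- This row comes from `FE = 1 - T - EF`, and the one for `EF` from `FEF = F - TF`.
  | .F, (.E, l) => single (.I, l) 1 - single (.I, l + 1) 1 - single (.EF, l) 1
  | .F, (.F, _) => 0
  | .F, (.EF, l) => single (.F, l) 1 - single (.F, l + 1) 1
  | .T, (γ, l) => single (γ, l + 1) 1
  | .Tinv, (γ, l) => single (γ, l - 1) 1

/-- The left regular representation of `U_T`, in the basis `T^l γ`. -/
def rep : UT →ₐ[ℤ] Module.End ℤ (Bas × ℤ →₀ ℤ) :=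
  RingQuot.liftAlgHom ℤ ⟨FreeAlgebra.lift ℤ fun x => Finsupp.linearCombination ℤ (repGen x), by
    -- Checking the relations on basis vectors of the free module is what shows that they force no
    -- linear dependence among the `T^l γ`.
    rintro _ _ (_ | _ | _ | _ | _ | _ | _) <;>
      simp only [map_sub, map_add, map_mul, map_one, map_zero, FreeAlgebra.lift_ι_apply] <;>
      refine Finsupp.lhom_ext' fun ⟨γ, l⟩ => LinearMap.ext_ring ?_ <;> rcases γ <;>
      simp [repGen]⟩

lemma rep_gen (x : UGen) : rep (mk x.v) = Finsupp.linearCombination ℤ (repGen x) :=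
  (RingQuot.liftAlgHom_mkAlgHom_apply ..).trans (FreeAlgebra.lift_ι_apply _ _)

/-- The linear map which takes the basis vectors to the elements `T^l γ`. -/
def ofCoords : (Bas × ℤ →₀ ℤ) →ₗ[ℤ] UT :=
  Finsupp.linearCombination ℤ fun p => Tpow p.2 * p.1.toUT

lemma ofCoords_single (γ : Bas) (l : ℤ) : ofCoords (.single (γ, l) 1) = Tpow l * γ.toUT := by
  simp [ofCoords]

lemma FE : F * E = 1 - T - E * F := by rw [← EF_add_FE]; abel

lemma FEF : F * (E * F) = F - T * F := by
  rw [← mul_assoc, FE, sub_mul, sub_mul, one_mul, mul_assoc E, F_mul_F, mul_zero, sub_zero]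

lemma ofCoords_repGen (x : UGen) (p : Bas × ℤ) :
    ofCoords (repGen x p) = mk x.v * (Tpow p.2 * p.1.toUT) := by
  obtain ⟨γ, l⟩ := p
  cases x
  · change _ = E * _
    rw [← mul_assoc, E_mul_Tpow, mul_assoc]
    rcases γ <;> simp only [repGen, ofCoords_single, map_zero, Bas.toUT]
    · rw [mul_one]
    · rw [E_mul_E, mul_zero]
    · rw [← mul_assoc E, E_mul_E, zero_mul, mul_zero]
  · change _ = F * _
    rw [← mul_assoc, F_mul_Tpow, mul_assoc]
    rcases γ <;> simp only [repGen, map_sub, ofCoords_single, map_zero, Bas.toUT, Tpow_add, Tpow_one]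
    · rw [mul_one]
    · rw [FE]; noncomm_ring
    · rw [F_mul_F, mul_zero]
    · rw [FEF]; noncomm_ring
  · change _ = T * _
    rw [repGen, ofCoords_single, add_comm, Tpow_add, Tpow_one, mul_assoc]
  · change _ = Tinv * _
    rw [repGen, ofCoords_single, sub_eq_add_neg, add_comm, Tpow_add, Tpow_neg_one, mul_assoc]

/-- The map `ofCoords` intertwines `rep` with left multiplication. At the vector of `I`, with `l =
0`, this shows that `ofCoords` is a left inverse of `x ↦ rep x (I, 0)`, that is, that the `T^l γ`
span. -/
lemma ofCoords_rep (x : UT) (c : Bas × ℤ →₀ ℤ) : ofCoords (rep x c) = x * ofCoords c := by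
  obtain ⟨x, rfl⟩ := RingQuot.mkAlgHom_surjective ℤ URel x
  change ofCoords (rep (mk x) c) = mk x * _
  induction x using FreeAlgebra.induction generalizing c with
  | grade0 r =>
    rw [AlgHom.commutes, AlgHom.commutes, Algebra.algebraMap_eq_smul_one,
      Algebra.algebraMap_eq_smul_one, LinearMap.smul_apply, map_smul, smul_mul_assoc, one_mul]
    rfl
  | grade1 x =>
    rw [rep_gen]
    induction c using Finsupp.induction_linear with
    | zero => simp
    | add c c' h h' => rw [map_add, map_add, map_add, h, h', mul_add]
    | single p n =>
      rw [Finsupp.linearCombination_single, map_zsmul, ofCoords_repGen, ofCoords,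
        Finsupp.linearCombination_single, mul_smul_comm]
  | mul a b ha hb => rw [map_mul, map_mul, Module.End.mul_apply, ha, hb, mul_assoc]
  | add a b ha hb => rw [map_add, map_add, LinearMap.add_apply, map_add, ha, hb, add_mul]

lemma rep_Tpow (l m : ℤ) (γ : Bas) :
    rep (Tpow l) (.single (γ, m) 1) = .single (γ, m + l) 1 := by
  induction l using Int.induction_on generalizing m with
  | zero => simp [Tpow_zero]
  | succ n ih =>
    rw [Tpow_add, map_mul, Module.End.mul_apply, Tpow_one]
    have : rep T (.single (γ, m) 1) = .single (γ, m + 1) 1 := by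
      rw [T, rep_gen]; simp [repGen]
    rw [this, ih, add_right_comm, add_assoc]
  | pred n ih =>
    rw [sub_eq_add_neg, Tpow_add, map_mul, Module.End.mul_apply, Tpow_neg_one]
    have : rep Tinv (.single (γ, m) 1) = .single (γ, m - 1) 1 := by
      rw [Tinv, rep_gen]; simp [repGen]
    rw [this, ih, sub_eq_add_neg, add_right_comm, add_assoc]

lemma rep_toUT (γ : Bas) : rep γ.toUT (.single (.I, 0) 1) = .single (γ, 0) 1 := by
  rcases γ
  · simp [Bas.toUT]
  · rw [Bas.toUT, E, rep_gen]; simp [repGen]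
  · rw [Bas.toUT, F, rep_gen]; simp [repGen]
  · rw [Bas.toUT, map_mul, Module.End.mul_apply, E, F, rep_gen, rep_gen]; simp [repGen]

/-- The basis `T^l γ` of `U_T`. -/
def basis : Module.Basis (Bas × ℤ) ℤ UT :=
  .ofRepr
    { toFun := fun x => rep x (.single (.I, 0) 1)
      map_add' := fun x y => by rw [map_add]; rfl
      map_smul' := fun n x => by rw [map_smul]; rfl
      invFun := ofCoords
      left_inv := fun x => by
        rw [ofCoords_rep, ofCoords_single, Tpow_zero, Bas.toUT, mul_one, mul_one]
      right_inv := fun c => by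
        -- This direction gives independence: `T^l γ` takes the vector of `I` to the vector of `(γ,
        -- l)`.
        change rep (ofCoords c) (.single (.I, 0) 1) = c
        induction c using Finsupp.induction_linear with
        | zero => simp
        | add c c' h h' => rw [map_add, map_add, LinearMap.add_apply, h, h']
        | single p n =>
          rw [ofCoords, Finsupp.linearCombination_single, map_zsmul, map_mul, LinearMap.smul_apply,
            Module.End.mul_apply, rep_toUT, rep_Tpow]
          simp }

lemma basis_apply (γ : Bas) (l : ℤ) : basis (γ, l) = Tpow l * γ.toUT :=
  ofCoords_single γ l

end UT

namespace UT2

/-- The basis of pure tensors in `U_T ⊗ U_T`. -/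
def basis : Module.Basis ((Bas × ℤ) × Bas × ℤ) ℤ UT2 := UT.basis.tensorProduct UT.basis

lemma basis_apply (p q : Bas × ℤ) : basis (p, q) = tm (UT.basis p) (UT.basis q) :=
  Module.Basis.tensorProduct_apply _ _ _ _

lemma toUT_mem (γ : Bas) : ∃ i, γ.toUT ∈ UT.deg i := by
  rcases γ
  · exact ⟨0, SetLike.GradedOne.one_mem⟩
  · exact ⟨_, UT.E_mem⟩
  · exact ⟨_, UT.F_mem⟩
  · exact ⟨_, SetLike.GradedMul.mul_mem UT.E_mem UT.F_mem⟩

/-- Powers of `T` are even, so moving one past a basis element costs no sign. The degree of that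
element is irrelevant, but the multiplication rule asks for it to be homogeneous. -/
lemma Tpow_tm_mul (l m : ℤ) (p q : Bas × ℤ) : tm (UT.Tpow l) (UT.Tpow m) * basis (p, q) =
    basis ((p.1, p.2 + l), q.1, q.2 + m) := by
  obtain ⟨i, hi⟩ := toUT_mem p.1
  have h : UT.basis p ∈ UT.deg (0 + i) := by
    rw [UT.basis_apply]
    exact SetLike.GradedMul.mul_mem (UT.Tpow_mem _) hi
  rw [basis_apply, basis_apply, tm_mul_even _ _ (UT.Tpow_mem m) h (by simp), UT.basis_apply,
    UT.basis_apply, UT.basis_apply, UT.basis_apply, ← mul_assoc, ← mul_assoc, ← UT.Tpow_add,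
    ← UT.Tpow_add, add_comm l, add_comm m]

end UT2

end UTCat

namespace UTCat

/-! ### The Grothendieck groups of `HP(A)` and `HP(B)` -/

lemma HP.of_gen_twist_zero {Λ : Type} [AddCommGroup Λ] [DecidableEq Λ] {R : Type} [Ring R]
    [Algebra (ZMod 2) R] {𝒜 : ℤ × Λ → Submodule (ZMod 2) R} {V : Type} [Nonempty V]
    (P : V → DGMod 𝒜) (v : V) : K0.of ((HP.gen P v).twist 0) = K0.of (HP.gen P v) :=
  HP.cl_iso (.shift (0, 0) (.proj v)) (.proj v) (DGMod.shiftZeroIso.app (P v))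

namespace AlgA

/-- The basis `[P(γ){l}]` of `K₀(HP(A))`. -/
def K0basis : Module.Basis (Bas × ℤ) ℤ (K0 HPA) := K0Basis e_mem e_mul_e char char_eq_zero char_e

lemma K0basis_apply (γ : Bas) (l : ℤ) : K0basis (γ, l) = K0.of ((HP.gen P γ).twist l) :=
  K0Basis_apply e_mem e_mul_e char char_eq_zero char_e γ l

/-- The isomorphism `K₀(HP(A)) ≅ U_T`. -/
def toUT : K0 HPA ≃+ UT := (K0basis.equiv UT.basis (Equiv.refl _)).toAddEquiv

lemma toUT_gen_twist (γ : Bas) (l : ℤ) :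
    toUT (K0.of ((HP.gen P γ).twist l)) = UT.Tpow l * γ.toUT := by
  rw [← K0basis_apply, ← UT.basis_apply]
  exact Module.Basis.equiv_apply _ _ _ _

lemma toUT_gen (γ : Bas) : toUT (K0.of (HP.gen P γ)) = γ.toUT := by
  rw [← HP.of_gen_twist_zero, toUT_gen_twist, UT.Tpow_zero, one_mul]

/-- On the shifted generators this is the definition of the isomorphism; `HP.map_cl_shift` carries
it to every object. -/
lemma toUT_twist (M : HPA) (l : ℤ) :
    toUT (K0.of (M.twist l)) = UT.Tpow l * toUT (K0.of M) := by
  refine HP.map_cl_shift toUT.toAddMonoidHom (fun l => AddMonoidHom.mulLeft (UT.Tpow l))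
    (fun γ l l' => ?_) M l
  change toUT _ = UT.Tpow l' * toUT _
  rw [toUT_gen_twist, toUT_gen_twist, add_comm, UT.Tpow_add, mul_assoc]

end AlgA

namespace AlgB

/-- The basis `[P(γ₁ ⊗ γ₂){l₁, l₂}]` of `K₀(HP(B))`. -/
def K0basis : Module.Basis ((Bas × Bas) × ℤ × ℤ) ℤ (K0 HPB) :=
  K0Basis e_mem e_mul_e char char_eq_zero char_e

lemma K0basis_apply (p : Bas × Bas) (l : ℤ × ℤ) : K0basis (p, l) = K0.of ((HP.gen P p).twist l) :=
  K0Basis_apply e_mem e_mul_e char char_eq_zero char_e p l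

/-- The isomorphism `K₀(HP(B)) ≅ U_T ⊗ U_T`. -/
def toUT2 : K0 HPB ≃+ UT2 :=
  (K0basis.equiv UT2.basis (Equiv.prodProdProdComm _ _ _ _)).toAddEquiv

lemma toUT2_gen_twist (p : Bas × Bas) (l : ℤ × ℤ) :
    toUT2 (K0.of ((HP.gen P p).twist l)) = UT2.basis ((p.1, l.1), p.2, l.2) := by
  rw [← K0basis_apply]
  exact Module.Basis.equiv_apply _ _ _ _

lemma toUT2_gen_twist' (p : Bas × Bas) (l : ℤ × ℤ) : toUT2 (K0.of ((HP.gen P p).twist l)) =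
    UT2.tm (UT.Tpow l.1 * p.1.toUT) (UT.Tpow l.2 * p.2.toUT) := by
  rw [toUT2_gen_twist, UT2.basis_apply, UT.basis_apply, UT.basis_apply]

lemma toUT2_gen (p : Bas × Bas) :
    toUT2 (K0.of (HP.gen P p)) = UT2.tm p.1.toUT p.2.toUT := by
  rw [← HP.of_gen_twist_zero, toUT2_gen_twist']
  simp only [Prod.fst_zero, Prod.snd_zero, UT.Tpow_zero, one_mul]

lemma toUT2_twist (M : HPB) (l : ℤ × ℤ) :
    toUT2 (K0.of (M.twist l)) = UT2.tm (UT.Tpow l.1) (UT.Tpow l.2) * toUT2 (K0.of M) := by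
  refine HP.map_cl_shift toUT2.toAddMonoidHom
    (fun l => AddMonoidHom.mulLeft (UT2.tm (UT.Tpow l.1) (UT.Tpow l.2))) (fun p l l' => ?_) M l
  change toUT2 _ = UT2.tm _ _ * toUT2 _
  rw [toUT2_gen_twist, toUT2_gen_twist, UT2.Tpow_tm_mul]
  rfl

end AlgB

end UTCat

namespace UTCat

/-! ### The DG modules `S ⊗ P(γ)` -/

open DGMod DGBimod MulOpposite

namespace S

/-- The inclusion of a summand in `S`. -/
def ι (g : SGen) : Summand g →ₗ[AlgB] Car := LinearMap.single AlgB (fun g => Summand g) g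

lemma ι_same (g : SGen) (x : Summand g) : ι g x g = x :=
  Pi.single_eq_same (M := fun g => (Summand g).carrier) g x

lemma ι_of_ne {g h : SGen} (hh : h ≠ g) (x : Summand g) : ι g x h = 0 :=
  Pi.single_eq_of_ne (M := fun g => (Summand g).carrier) hh x

lemma ι_mem {g : SGen} {i : ℤ × ℤ × ℤ} {x : Summand g} (hx : x ∈ (Summand g).deg i) :
    ι g x ∈ grad i := by
  intro h _
  by_cases hh : h = g
  · subst hh
    change ι h x h ∈ _
    rwa [ι_same]
  · change ι g x h ∈ _
    rw [ι_of_ne hh]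
    exact zero_mem ((Summand h).deg i)

/-- The generators of `S(γ)`. -/
def gens (γ : Bas) : Finset SGen := Finset.univ.filter fun g => g.comp = γ

lemma sum_ι_apply (s : Finset SGen) (x : Car) (h : SGen) :
    (∑ g ∈ s, ι g (x g)) h = if h ∈ s then x h else 0 := by
  rw [Finset.sum_apply]
  split_ifs with hh
  · rw [Finset.sum_eq_single_of_mem h hh fun g _ hg => ι_of_ne hg.symm _, ι_same]
  · exact Finset.sum_eq_zero fun g hg => ι_of_ne (ne_of_mem_of_not_mem hg hh).symm _

lemma sum_gens (γ : Bas) (x : Car) : ∑ g ∈ gens γ, ι g (x g) = proj γ x := by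
  refine car_ext fun h => ?_
  rw [sum_ι_apply, coe_proj]
  by_cases hh : h.comp = γ
  · rw [if_pos hh, if_pos (show h ∈ gens γ from Finset.mem_filter.2 ⟨Finset.mem_univ h, hh⟩)]
  · rw [if_neg hh, if_neg fun hg : h ∈ gens γ => hh (Finset.mem_filter.1 hg).2, map_zero]

end S

/-- An identification of a DG module with the sum of the summands of `S` in a set. -/
structure Model (s : Finset SGen) (C : DGMod AlgB.deg) where
  incl : C →ₗ[AlgB] S.Car
  proj : S.Car →ₗ[AlgB] C
  incl_mem : ∀ i, ∀ c ∈ C.deg i, incl c ∈ S.grad i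
  proj_mem : ∀ i, ∀ x ∈ S.grad i, proj x ∈ C.deg i
  incl_d : ∀ c, incl (C.d c) = S.d (incl c)
  proj_incl : ∀ c, proj (incl c) = c
  incl_proj_eq_sum : ∀ x, incl (proj x) = ∑ g ∈ s, S.ι g (x g)

namespace Model

/-! ### Parts of `S` as iterated cones -/

section Build

variable {s : Finset SGen} {C : DGMod AlgB.deg} (h : Model s C)

include h in
lemma incl_injective : Function.Injective h.incl := Function.LeftInverse.injective h.proj_incl

lemma incl_proj_eq_self {x : S.Car} (hx : ∀ g ∉ s, x g = 0) : h.incl (h.proj x) = x := by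
  rw [h.incl_proj_eq_sum]
  refine funext fun g => ?_
  rw [S.sum_ι_apply]
  split_ifs with hg
  · rfl
  · exact (hx g hg).symm

lemma incl_apply (c : C) {g : SGen} (hg : g ∉ s) : h.incl c g = 0 := by
  rw [← h.proj_incl c, h.incl_proj_eq_sum, S.sum_ι_apply, if_neg hg]

lemma proj_ι {g : SGen} (hg : g ∉ s) (x : S.Summand g) : h.proj (S.ι g x) = 0 := by
  refine h.incl_injective ?_
  rw [h.incl_proj_eq_sum, map_zero]
  refine Finset.sum_eq_zero fun k hk => ?_
  rw [S.ι_of_ne (ne_of_mem_of_not_mem hk hg), map_zero]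

/-- A summand of `S` on which the differential vanishes. -/
def single (g : SGen) (hg : ∀ x, S.d (S.ι g x) = 0) : Model {g} (S.Summand g) where
  incl := S.ι g
  proj := LinearMap.proj (φ := fun g => S.Summand g) g
  incl_mem _ _ hc := S.ι_mem hc
  proj_mem _ _ hx := hx g trivial
  incl_d c := (map_zero (S.ι g)).trans (hg c).symm
  proj_incl := S.ι_same g
  incl_proj_eq_sum _ := (Finset.sum_singleton _ _).symm

variable {g : SGen} (hd : ∀ x, ∀ k ∉ s, S.d (S.ι g x) k = 0)

/-- The component of the differential of `S` from a further summand. -/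
def attach : Z0 ((S.Summand g).shift (-1, 0)) C :=
  ⟨h.proj ∘ₗ S.d ∘ₗ S.ι g, fun i _ hx => by
    have h1 := h.proj_mem _ _ (S.d_mem (S.ι_mem hx))
    have e : i + (-1, 0) + (1, 0) = i := by rw [add_assoc]; exact add_zero i
    rwa [e] at h1, fun x => by
    -- The summand has zero differential, so closedness requires the differential of `C` to kill the
    -- image; under the inclusion in `S` this is `d² = 0`.
    have e : h.proj (S.d (S.ι g 0)) = 0 := by rw [map_zero, map_zero, map_zero]
    refine e.trans (h.incl_injective ?_)
    change h.incl 0 = h.incl (C.d (h.proj (S.d (S.ι g x))))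
    rw [h.incl_d, h.incl_proj_eq_self (hd x), map_zero]
    exact (LinearMap.congr_fun S.d_mul_d _).symm⟩

/-- The mapping cone adds a further summand. -/
def cone (hg : g ∉ s) : Model (insert g s) (DGMod.cone (h.attach hd)) where
  incl := LinearMap.coprod (S.ι g) h.incl
  proj := LinearMap.prod (LinearMap.proj (φ := fun g => S.Summand g) g) h.proj
  incl_mem i c hc := by
    have h1 : c.1 ∈ (S.Summand g).deg (i + (1, 0) + (-1, 0)) := hc.1
    -- The source of `attach` is shifted by `-1` and the cone shifts it back by `1`, so the summand
    -- enters with its own grading.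
    have e : i + (1, 0) + (-1, 0) = i := by rw [add_assoc]; exact add_zero i
    rw [e] at h1
    exact add_mem (S.ι_mem h1) (h.incl_mem i _ hc.2)
  proj_mem i x hx := ⟨by
    have h1 : x g ∈ (S.Summand g).deg i := hx g trivial
    have e : i + (1, 0) + (-1, 0) = i := by rw [add_assoc]; exact add_zero i
    rw [← e] at h1
    exact h1, h.proj_mem i x hx⟩
  incl_d := fun (c : S.Summand g × C) => by
    change S.ι g 0 + h.incl (h.proj (S.d (S.ι g c.1)) + C.d c.2) = S.d (S.ι g c.1 + h.incl c.2)
    rw [map_zero, zero_add, map_add, map_add, h.incl_d, h.incl_proj_eq_self (hd _)]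
  proj_incl := fun (c : S.Summand g × C) => by
    refine Prod.ext ?_ ?_
    · change S.ι g c.1 g + h.incl c.2 g = c.1
      rw [S.ι_same, h.incl_apply c.2 hg, add_zero]
    · change h.proj (S.ι g c.1 + h.incl c.2) = c.2
      rw [map_add, h.proj_ι hg, h.proj_incl, zero_add]
  incl_proj_eq_sum x := by
    rw [Finset.sum_insert hg, ← h.incl_proj_eq_sum]
    rfl

end Build

/-! ### The isomorphism of `S ⊗ P(γ)` with `S(γ)` -/

variable {γ : Bas} {C : DGMod AlgB.deg} (h : Model (S.gens γ) C)

lemma incl_proj (x : S.Car) : h.incl (h.proj x) = S.proj γ x :=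
  (h.incl_proj_eq_sum x).trans (S.sum_gens γ x)

lemma e_smul (x : S.Car) : op (AlgA.e γ) • x = S.proj γ x :=
  (S.op_smul_def _ _).trans (by rw [AlgA.e, S.ract_gen]; rfl)

/-- The idempotent `e(γ)` acts on `S` by the projection, and the differential commutes with the
right action. -/
lemma proj_d (x : S.Car) : h.proj (S.d x) = C.d (h.proj x) := by
  rw [← h.proj_incl (C.d (h.proj x)), h.incl_d, h.incl_proj, ← h.proj_incl (h.proj (S.d x)),
    h.incl_proj]
  exact congrArg h.proj (LinearMap.congr_fun (S.d_mul_rgen (.e γ)) x).symm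

/-- The generator of `P(γ)`. -/
def gen (γ : Bas) : AlgA.P γ := projGen (AlgA.e_mem γ) (AlgA.e_mul_e γ)

/-- The element of `A` given by an element of `P(γ)`. -/
def toA (γ : Bas) : AlgA.P γ →ₗ[AlgA] AlgA := (Submodule.span AlgA {AlgA.e γ}).subtype

lemma smul_gen (a : AlgA.P γ) : toA γ a • gen γ = a := projMod_smul _

lemma toA_mul_e (a : AlgA.P γ) : toA γ a * AlgA.e γ = toA γ a := congrArg (toA γ) (smul_gen a)

/-- The bilinear map `s, a ↦ s a`, with values in `S(γ)`. -/
def actHom : S.Car →+ AlgA.P γ →+ C :=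
  AddMonoidHom.mk' (fun s => AddMonoidHom.mk' (fun a => h.proj (op (toA γ a) • s)) fun a b => by
    rw [map_add, MulOpposite.op_add, add_smul, map_add]) fun s t => AddMonoidHom.ext fun a => by
    change h.proj (op (toA γ a) • (s + t)) = h.proj (op (toA γ a) • s) + h.proj (op (toA γ a) • t)
    rw [smul_add, map_add]

/-- Associativity of the right action of `A`, which lets `(s, a) ↦ s a` descend to the tensor
product. -/
lemma actHom_balanced (s : S.Car) (a : AlgA) (m : AlgA.P γ) :
    h.actHom (op a • s) m = h.actHom s (a • m) := by
  change h.proj (op (toA γ m) • op a • s) = h.proj (op (toA γ (a • m)) • s)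
  rw [map_smul (toA γ), smul_smul]
  rfl

/-- The map `S ⊗ P(γ) → S(γ)`, as a map of abelian groups. -/
def ofTensAdd : (UTCat.S).Tens (AlgA.P γ) →+ C :=
  liftTens (S := UTCat.S) (M := AlgA.P γ) h.actHom h.actHom_balanced

/-- The map `S ⊗ P(γ) → S(γ)`. -/
def ofTens : Z0 ((UTCat.S).tensor (AlgA.P γ)) C :=
  ⟨{ toFun := h.ofTensAdd
     map_add' := map_add _
     map_smul' := fun b x => by
      change h.ofTensAdd (b • x) = b • h.ofTensAdd x
      refine tm_induction (S := UTCat.S) (M := AlgA.P γ)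
        (p := fun x => h.ofTensAdd (b • x) = b • h.ofTensAdd x) ?_ (fun (s : S.Car) a => ?_)
        (fun x y hx hy => ?_) x
      · rw [smul_zero, map_zero, smul_zero]
      · change h.proj (op (toA γ a) • b • s) = b • h.proj (op (toA γ a) • s)
        rw [← map_smul, smul_comm b]
      · rw [smul_add, map_add, map_add, smul_add, hx, hy] },
    fun i x hx => by
      refine AddSubgroup.closure_induction (p := fun x _ => h.ofTensAdd x ∈ C.deg i) ?_ ?_
        (fun x y _ _ hx hy => ?_) (fun x _ hx => ?_) hx
      · rintro _ ⟨j, k, rfl, s, hs, a, ha, rfl⟩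
        exact h.proj_mem _ _ (S.ract_mem ha hs)
      · rw [map_zero]; exact zero_mem _
      · rw [map_add]; exact add_mem hx hy
      · rw [map_neg]; exact neg_mem hx,
    fun x => by
      change h.ofTensAdd (tensD (S := UTCat.S) (AlgA.P γ) x) = C.d (h.ofTensAdd x)
      refine tm_induction (S := UTCat.S) (M := AlgA.P γ)
        (p := fun x => h.ofTensAdd (tensD (S := UTCat.S) (AlgA.P γ) x) = C.d (h.ofTensAdd x)) ?_
        (fun (s : S.Car) a => ?_) (fun x y hx hy => ?_) x
      · rw [map_zero, map_zero, map_zero]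
      · have e1 : tensD (S := UTCat.S) (AlgA.P γ) ((UTCat.S).tm s a) =
            (UTCat.S).tm (S.d s) a :=
          (tensD_tm (S := UTCat.S) (AlgA.P γ) s a).trans
            ((congrArg (_ + ·) (tm_zero (S := UTCat.S) (M := AlgA.P γ) s)).trans (add_zero _))
        rw [e1]
        change h.proj (op (toA γ a) • S.d s) = C.d (h.proj (op (toA γ a) • s))
        rw [← h.proj_d]
        exact congrArg h.proj ((UTCat.S).d_rsmul (toA γ a) s).symm
      · rw [map_add, map_add, map_add, map_add, hx, hy]⟩

/-- The map `S(γ) → S ⊗ P(γ)`. -/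
def toTens : Z0 C ((UTCat.S).tensor (AlgA.P γ)) :=
  ⟨{ toFun := fun c => (UTCat.S).tm (h.incl c) (gen γ)
     map_add' := fun c c' => (congrArg ((UTCat.S).tm · (gen γ)) (map_add h.incl c c')).trans
      (add_tm (S := UTCat.S) (M := AlgA.P γ) _ _ _)
     map_smul' := fun b c => congrArg ((UTCat.S).tm · (gen γ)) (map_smul h.incl b c) },
    fun i c hc => by
      have h1 := tm_mem (S := UTCat.S) (M := AlgA.P γ) (h.incl_mem i c hc)
        (show gen γ ∈ (AlgA.P γ).deg 0 from AlgA.e_mem γ)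
      have e : tdeg S.φ i 0 = i := by simp [tdeg]
      rwa [e] at h1,
    fun c => (congrArg ((UTCat.S).tm · (gen γ)) (h.incl_d c)).trans
      ((tensD_tm (S := UTCat.S) (AlgA.P γ) (h.incl c) (gen γ)).trans
        ((congrArg (_ + ·) (tm_zero (S := UTCat.S) (M := AlgA.P γ) _)).trans (add_zero _))).symm⟩

lemma ofTens_toTens (c : C) : h.ofTens (h.toTens c) = c := by
  change h.proj (op (AlgA.e γ) • h.incl c) = c
  rw [e_smul, ← h.incl_proj, h.proj_incl, h.proj_incl]

/-- This is `s ⊗ a = s a ⊗ e(γ)`, valid since `a = a e(γ)`; the same identity puts `s a` in `S(γ)`,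
so that projecting and including it changes nothing. -/
lemma toTens_ofTens (x : (UTCat.S).tensor (AlgA.P γ)) : h.toTens (h.ofTens x) = x := by
  refine LinearMap.congr_fun (f := h.toTens.1.comp h.ofTens.1) (g := LinearMap.id)
    (tens_ext (S := UTCat.S) (M := AlgA.P γ) fun s a => ?_) x
  have e : ∀ s : S.Car, h.incl (h.proj (op (toA γ a) • s)) = op (toA γ a) • s := fun s => by
    rw [h.incl_proj, ← e_smul, smul_smul, ← op_mul, toA_mul_e]
  refine (congrArg ((UTCat.S).tm · (gen γ)) (e s)).trans ?_
  refine (tm_balanced (S := UTCat.S) (M := AlgA.P γ) s (toA γ a) (gen γ)).trans ?_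
  exact congrArg _ (smul_gen a)

end Model

/-! ### The classes of the DG modules `S ⊗ P(γ)` -/

/-- The class of a summand of `S`. -/
def summandClass (g : SGen) : K0 HPB := HP.cl (.shift g.shift (.proj g.vertex) : IsDGP AlgB.P _)

/-- A part of `S` belongs to the DG category of `B`, with the sum of the classes of its summands as
its class. -/
def HasModel (s : Finset SGen) : Prop :=
  ∃ (C : DGMod AlgB.deg) (_ : Model s C) (hC : IsDGP AlgB.P C),
    HP.cl hC = ∑ g ∈ s, summandClass g

lemma HasModel.single (g : SGen) (hg : ∀ x, S.d (S.ι g x) = 0) : HasModel {g} :=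
  ⟨_, .single g hg, _, (Finset.sum_singleton _ _).symm⟩

/-- The cone is formed on the summand shifted by `[-1]`, so subtracting the class of its source adds
the class of the summand. -/
lemma HasModel.cone {s : Finset SGen} (h : HasModel s) (g : SGen)
    (hd : ∀ x, ∀ k ∉ s, S.d (S.ι g x) k = 0) (hg : g ∉ s) : HasModel (insert g s) := by
  obtain ⟨C, h, hC, e⟩ := h
  have hP : IsDGP AlgB.P (S.Summand g) := .shift g.shift (.proj g.vertex)
  refine ⟨_, h.cone hd hg, .cone (h.attach hd) (.shift (-1, 0) hP) hC, ?_⟩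
  rw [HP.cl_cone (h.attach hd) (.shift (-1, 0) hP) hC, e, Finset.sum_insert hg, HP.cl_shift hP,
    HP.cl_iso (.shift (0, 0) hP) hP (shiftZeroIso.app _)]
  simp only [Int.negOnePow_neg, Int.negOnePow_one, Units.val_neg, Units.val_one, neg_smul, one_smul,
    sub_neg_eq_add]
  exact add_comm _ _

namespace S

open SGen

lemma el_ι_of_ne {g h g' : SGen} (hh : g ≠ h) (b : AlgB) (x : Summand h) :
    el g g' b (ι h x) = 0 :=
  car_ext fun k => by
    rw [coe_el, ι_of_ne hh, map_zero, zero_mul, ite_self]; rfl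

lemma el_apply_of_ne {g g' k : SGen} (hh : k ≠ g') (b : AlgB) (x : Car) :
    el g g' b x k = 0 := Pi.single_eq_of_ne hh _

end S

open SGen in
-- The nonzero components of the differential on each `S(γ)` form a chain, such as `E ⊗ F → I ⊗ EF →
-- EF ⊗ I → F ⊗ E` for `EF`. The last summand is a subcomplex, and the others are attached one at a
-- time backwards along the chain.
lemma hasModel_gens (γ : Bas) : HasModel (S.gens γ) := by
  have h0 : ∀ g ∈ ({I_II, E_IE, F_FI, EF_FE} : Finset SGen), ∀ x, S.d (S.ι g x) = 0 := by
    intro g hg x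
    fin_cases hg <;> simp [S.d, S.el_ι_of_ne]
  -- The pairs are the arrows of the differential: from `g` it reaches only `g'`, which is already
  -- present when `g` is attached.
  have h1 : ∀ g g', (g, g') ∈ ({(E_EI, E_IE), (F_IF, F_FI), (EF_EF, EF_IEF), (EF_IEF, EF_EFI),
      (EF_EFI, EF_FE)} : Finset (SGen × SGen)) → ∀ x, ∀ k ≠ g', S.d (S.ι g x) k = 0 := by
    intro g g' hg x k hk
    simp only [Finset.mem_insert, Finset.mem_singleton, Prod.mk.injEq] at hg
    rcases hg with ⟨rfl, rfl⟩ | ⟨rfl, rfl⟩ | ⟨rfl, rfl⟩ | ⟨rfl, rfl⟩ | ⟨rfl, rfl⟩ <;>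
      simp [S.d, S.el_ι_of_ne, S.el_apply_of_ne hk]
  cases γ
  · exact .single I_II (h0 _ (by decide))
  · exact (HasModel.single E_IE (h0 _ (by decide))).cone E_EI
      (fun x k hk => h1 _ E_IE (by decide) x k fun e => hk (by simp [e])) (by decide)
  · exact (HasModel.single F_FI (h0 _ (by decide))).cone F_IF
      (fun x k hk => h1 _ F_FI (by decide) x k fun e => hk (by simp [e])) (by decide)
  · exact (((HasModel.single EF_FE (h0 _ (by decide))).cone EF_EFI
      (fun x k hk => h1 _ EF_FE (by decide) x k fun e => hk (by simp [e])) (by decide)).cone EF_IEF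
      (fun x k hk => h1 _ EF_EFI (by decide) x k fun e => hk (by simp [e])) (by decide)).cone EF_EF
      (fun x k hk => h1 _ EF_IEF (by decide) x k fun e => hk (by simp [e])) (by decide)

lemma isDGP_tensor_P (γ : Bas) : IsDGP AlgB.P ((UTCat.S).tensor (AlgA.P γ)) := by
  obtain ⟨C, h, hC, -⟩ := hasModel_gens γ
  exact .iso h.toTens h.ofTens h.ofTens_toTens h.toTens_ofTens hC

lemma isDGP_S_tensor (M : HPA) : IsDGP AlgB.P ((UTCat.S).tensor M.obj) :=
  (UTCat.S).isDGP_tensor AlgA.P AlgB.P isDGP_tensor_P M.property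

lemma cl_tensor_P (γ : Bas) : HP.cl (isDGP_tensor_P γ) = ∑ g ∈ S.gens γ, summandClass g := by
  obtain ⟨C, h, hC, e⟩ := hasModel_gens γ
  rw [← e]
  exact (HP.cl_iso hC (isDGP_tensor_P γ)
    (isoOfInv h.toTens h.ofTens h.ofTens_toTens h.toTens_ofTens)).symm

end UTCat

namespace UTCat

/-! ### The comultiplication -/

open DGMod DGBimod

instance (hS : ∀ M : HPA, IsDGP AlgB.P (S.tensor M.obj)) : (delta hS).CommShift ℤ :=
  ObjectProperty.instCommShiftFullSubcategoryLift (IsDGP AlgB.P) ((IsDGP AlgA.P).ι ⋙ S.tensorF) hS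

instance (hS : ∀ M : HPA, IsDGP AlgB.P (S.tensor M.obj)) : (delta hS).IsTriangulated :=
  ObjectProperty.isTriangulated_lift (IsDGP AlgB.P) ((IsDGP AlgA.P).ι ⋙ S.tensorF) hS

/-- The homological shift of a summand becomes the sign, its internal shift the powers of `T`. -/
lemma toUT2_summandClass (g : SGen) : AlgB.toUT2 (summandClass g) =
    (g.shift.1.negOnePow : ℤ) • UT2.tm (UT.Tpow g.shift.2.1 * g.vertex.1.toUT)
      (UT.Tpow g.shift.2.2 * g.vertex.2.toUT) := by
  rw [← AlgB.toUT2_gen_twist', ← map_zsmul]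
  exact congrArg _ (HP.cl_shift (.proj g.vertex) g.shift.1 g.shift.2)

lemma comul_gen (x : UGen) : comul (UT.mk x.v) = UT2.comulGen x :=
  (RingQuot.liftAlgHom_mkAlgHom_apply ..).trans (FreeAlgebra.lift_ι_apply _ _)

/-- A comparison of four explicit sums. For `EF`, expanding `(E ⊗ 1 + 1 ⊗ E)(F ⊗ T + 1 ⊗ F)` gives
`EF ⊗ T + E ⊗ F - F ⊗ ET + 1 ⊗ EF`, one term for each summand of `S(EF)`. -/
lemma comul_toUT (γ : Bas) : comul γ.toUT = AlgB.toUT2 (HP.cl (isDGP_tensor_P γ)) := by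
  have o : (1 : UT) ∈ UT.deg 0 := SetLike.GradedOne.one_mem
  have hE : comul UT.E = UT2.tm UT.E 1 + UT2.tm 1 UT.E := comul_gen .E
  have hF : comul UT.F = UT2.tm UT.F UT.T + UT2.tm 1 UT.F := comul_gen .F
  rw [cl_tensor_P, map_sum]
  simp only [toUT2_summandClass]
  cases γ
  · rw [show S.gens .I = {.I_II} by decide, Finset.sum_singleton]
    simp [SGen.shift, SGen.vertex, Bas.toUT, UT.Tpow_zero, UT2.tm_one_one]
  · rw [show S.gens .E = {.E_EI, .E_IE} by decide, Finset.sum_pair (by decide)]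
    simp [SGen.shift, SGen.vertex, Bas.toUT, UT.Tpow_zero, hE]
  · rw [show S.gens .F = {.F_IF, .F_FI} by decide, Finset.sum_pair (by decide)]
    simp [SGen.shift, SGen.vertex, Bas.toUT, UT.Tpow_zero, UT.Tpow_one, hF, add_comm]
  · rw [show S.gens .EF = {.EF_EF, .EF_IEF, .EF_EFI, .EF_FE} by decide,
      Finset.sum_insert (by decide), Finset.sum_insert (by decide), Finset.sum_pair (by decide)]
    simp only [SGen.shift, SGen.vertex, Bas.toUT, UT.Tpow_zero, UT.Tpow_one, one_mul, mul_one,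
      map_mul, hE, hF, add_mul, mul_add, Int.negOnePow_zero, Int.negOnePow_neg, Int.negOnePow_one,
      Units.val_one, Units.val_neg, one_smul, neg_smul]
    -- Only the product `(1 ⊗ E)(F ⊗ T)` moves two odd elements past each other; its sign matches
    -- the shift `[-1]` of `P(F ⊗ E)`.
    rw [UT2.tm_mul_even _ _ o UT.F_mem (by simp), UT2.tm_mul_even _ _ o o (by simp),
      UT2.tm_mul_odd _ _ UT.E_mem UT.F_mem (by decide), UT2.tm_mul_even _ _ UT.E_mem o (by simp)]
    simp only [one_mul, mul_one, UT.E_mul_T]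
    abel

lemma comul_Tpow (l : ℤ) : comul (UT.Tpow l) = UT2.tm (UT.Tpow l) (UT.Tpow l) := by
  have hT : comul UT.T = UT2.tm UT.T UT.T := comul_gen .T
  have hTinv : comul UT.Tinv = UT2.tm UT.Tinv UT.Tinv := comul_gen .Tinv
  induction l using Int.induction_on with
  | zero => rw [UT.Tpow_zero, map_one, UT2.tm_one_one]
  | succ n ih =>
    rw [UT.Tpow_add, UT.Tpow_one, map_mul, ih, hT,
      UT2.tm_mul_even _ _ (UT.Tpow_mem _) UT.T_mem (by simp)]
  | pred n ih =>
    rw [sub_eq_add_neg, UT.Tpow_add, UT.Tpow_neg_one, map_mul, ih, hTinv,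
      UT2.tm_mul_even _ _ (UT.Tpow_mem _) UT.Tinv_mem (by simp)]

/-- Both sides are additive, so they need only agree on the spanning classes `[P(γ){l}]`. -/
lemma toUT2_map_delta (x : K0 HPA) :
    AlgB.toUT2 (K0.map (delta isDGP_S_tensor) x) = comul (AlgA.toUT x) := by
  refine HP.cl_mem_closure (AddMonoidHom.eqLocus
    (AlgB.toUT2.toAddMonoidHom.comp (K0.map (delta isDGP_S_tensor)))
    ((comul : UT →+ UT2).comp AlgA.toUT.toAddMonoidHom)) (fun γ l => ?_) x
  change AlgB.toUT2 (K0.map (delta isDGP_S_tensor) _) = comul (AlgA.toUT _)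
  -- The factor `T^l ⊗ T^l` is the twist `{l, l}`, which is what `S ⊗ -` makes of the twist `{l}`.
  rw [K0.map_of, AlgA.toUT_gen_twist, map_mul, comul_Tpow, comul_toUT,
    ← AlgB.toUT2_twist ⟨_, isDGP_tensor_P γ⟩ (l, l)]
  exact congrArg _ (HP.cl_iso (isDGP_S_tensor ((HP.gen AlgA.P γ).twist l))
    (.shift (0, (l, l)) (isDGP_tensor_P γ)) (S.shiftTensIso (AlgA.P γ) (0, l) (0, (l, l)) rfl))

end UTCat

end

open UTCat in
/-- The categories `HP(A)` and `HP(B)` are triangulated by the triangles isomorphic to mapping cone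
triangles, tensoring with the DG bimodule `S` is an exact functor `δ : HP(A) ⥤ HP(B)`, and there are
isomorphisms of Grothendieck groups with `U_T` and `U_T ⊗ U_T` under which `K₀(δ)` becomes the
comultiplication of `U_T`. -/
theorem theorem1p2 :
    ∃ (_ : Pretriangulated HPA) (_ : Pretriangulated HPB),
      distTriang HPA = coneTriangles AlgA.P ∧ distTriang HPB = coneTriangles AlgB.P ∧
      IsTriangulated HPA ∧ IsTriangulated HPB ∧
      ∃ (hS : ∀ M : HPA, IsDGP AlgB.P (S.tensor M.obj))
        (_ : (delta hS).CommShift ℤ) (_ : (delta hS).IsTriangulated)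
        (φA : K0 HPA ≃+ UT) (φB : K0 HPB ≃+ UT2),
        (∀ γ : Bas, φA (K0.of (HP.gen AlgA.P γ)) = γ.toUT) ∧
        (∀ (M : HPA) (l : ℤ), φA (K0.of (M.twist l)) = (UT.Tunit ^ l : UTˣ) * φA (K0.of M)) ∧
        (∀ γ₁ γ₂ : Bas,
          φB (K0.of (HP.gen AlgB.P (γ₁, γ₂))) = UT2.tm γ₁.toUT γ₂.toUT) ∧
        (∀ (M : HPB) (l₁ l₂ : ℤ), φB (K0.of (M.twist (l₁, l₂))) =
          UT2.tm (UT.Tunit ^ l₁ : UTˣ) (UT.Tunit ^ l₂ : UTˣ) * φB (K0.of M)) ∧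
        ∀ x : K0 HPA, φB (K0.map (delta hS) x) = comul (φA x) :=
  -- The two `rfl` hold because a triangle of the full subcategory is distinguished when its image
  -- among DG modules is, and there this means being isomorphic to a cone triangle.
  ⟨inferInstance, inferInstance, rfl, rfl, inferInstance, inferInstance, isDGP_S_tensor,
    inferInstance, inferInstance, AlgA.toUT, AlgB.toUT2, AlgA.toUT_gen, AlgA.toUT_twist,
    fun γ₁ γ₂ => AlgB.toUT2_gen (γ₁, γ₂), fun M l₁ l₂ => AlgB.toUT2_twist M (l₁, l₂),
    toUT2_map_delta⟩
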